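/- Let $n\ge 1$ be an integer, $t\ge 2$, and let $\alpha,\beta,\gamma\in\mathbb R$ satisfy $n-2\alpha>0$, $n-\beta>0$, $n-t\gamma>0$ and $\gamma=\frac{1+\alpha}{t}+\frac{\beta}{2t}$. For $q\in\{2,2(t-1)\}$ let $H^{2,q}_{\alpha,\beta}(\mathbb R^n)$ be the completion of $C_0^\infty(\mathbb R^n)$ under the norm $$\Big(\int_{\mathbb R^n}|\Delta u|^2|x|^{-2\alpha}dx\Big)^{1/2}+\Big(\int_{\mathbb R^n}|\nabla u|^q|x|^{-\beta}dx\Big)^{1/q}.$$ For $q=2$ this is the weighted Sobolev space $H^2_{\alpha,\beta}(\mathbb R^n)$. Its elements are real functions on $\mathbb R^n\setminus\{0\}$, determined up to an additive constant. Their gradient and Laplacian are the limits of those of the approximating test functions, which are also the distributional ones on $\mathbb R^n\setminus\{0\}$. Integrals take values in $[0,\infty]$, with $0\cdot\infty=0$. Let $q\in\{2,2(t-1)\}$. (i) For every radial $u\in H^{2,q}_{\alpha,\beta}(\mathbb R^n)$, $$\int_{\mathbb R^n}\frac{|\Delta u|^2}{|x|^{2\alpha}}dx\int_{\mathbb R^n}\frac{|\nabla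 u|^{2(t-1)}}{|x|^{\beta}}dx\ \ge\ \Big(\frac{n+t(1+2\alpha-\gamma)}{t}\Big)^2\Big(\int_{\mathbb R^n}\frac{|\nabla u|^t}{|x|^{t\gamma}}dx\Big)^2 .\qquad(*)$$ (ii) Assume in addition $$(1+2\alpha)(t-2)+1+\alpha-\tfrac\beta2>0,\qquad t<3+\alpha-\tfrac\beta2,\qquad n+2\alpha>0,$$ and, if $t>2$, also $n-\beta<\frac{2(t-1)}{t-2}\big(1+\alpha-\frac\beta2\big)$. Put, for $x\neq 0$, $U=U_1$ if $t=2$ and $U=U_2$ if $t>2$, where $$U_1(x)=\int_{|x|}^\infty s^{1+2\alpha}\exp\Big(-\frac{s^{1+\alpha-\frac\beta2}}{1+\alpha-\frac\beta2}\Big)ds,$$ $$U_2(x)=\int_{|x|}^\infty r^{1+2\alpha}\Big(1+(t-2)\frac{r^{(1+2\alpha)(t-2)+1+\alpha-\frac\beta2}}{(1+2\alpha)(t-2)+1+\alpha-\frac\beta2}\Big)^{\frac1{2-t}}dr .$$ Then: (a) the constant in $(*)$ is sharp: it cannot be replaced by a larger one for the radial $u\in H^{2,q}_{\alpha,\beta}(\mathbb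 R^n)$; (b) for $u=U$ the three integrals in $(*)$ are finite and positive and equality holds in $(*)$; moreover $U\in H^{2,2(t-1)}_{\alpha,\beta}(\mathbb R^n)$, and $U\in H^2_{\alpha,\beta}(\mathbb R^n)$ if $(n-\beta)(t-2)<2\big(1+\alpha-\frac\beta2\big)$ (in particular if $t=2$); (c) a radial $u\in H^{2,q}_{\alpha,\beta}(\mathbb R^n)$ satisfies $\int_{\mathbb R^n}|\nabla u|^{2(t-1)}|x|^{-\beta}dx<\infty$ and equality in $(*)$ if and only if $u(x)=c\,U(\lambda x)+d$ for almost every $x$, for some $c,d\in\mathbb R$ and $\lambda>0$. -/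

import Mathlib

noncomputable section

open MeasureTheory Filter Topology Set
open scoped ENNReal ContDiff Laplacian Gradient

namespace CKN

/-- The Euclidean space `ℝⁿ`. -/
abbrev E (n : ℕ) : Type := EuclideanSpace ℝ (Fin n)

/-- `φ ∈ C₀^∞(ℝⁿ)`. -/
def IsTest {n : ℕ} (φ : E n → ℝ) : Prop :=
  ContDiff ℝ ∞ φ ∧ HasCompactSupport φ

/-- `G` is the distributional gradient of `u` on `ℝⁿ \ {0}`. -/
def HasWeakGradient {n : ℕ} (u : E n → ℝ) (G : E n → E n) : Prop :=
  LocallyIntegrableOn u {0}ᶜ ∧ LocallyIntegrableOn G {0}ᶜ ∧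
    ∀ ψ : E n → ℝ, IsTest ψ → tsupport ψ ⊆ {0}ᶜ → ∀ e : E n,
      ∫ x, u x * fderiv ℝ ψ x e = -∫ x, inner ℝ (G x) e * ψ x

/-- `L` is the distributional Laplacian of `u` on `ℝⁿ \ {0}`. -/
def HasWeakLaplacian {n : ℕ} (u : E n → ℝ) (L : E n → ℝ) : Prop :=
  LocallyIntegrableOn u {0}ᶜ ∧ LocallyIntegrableOn L {0}ᶜ ∧
    ∀ ψ : E n → ℝ, IsTest ψ → tsupport ψ ⊆ {0}ᶜ →
      ∫ x, u x * Δ ψ x = ∫ x, L x * ψ x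

/-- `∫_{ℝⁿ} |F|^p |x|^{-s} dx`, with values in `[0, ∞]`. -/
def wInt {n : ℕ} {V : Type*} [NormedAddCommGroup V] (p s : ℝ) (F : E n → V) : ℝ≥0∞ :=
  ∫⁻ x, ‖F x‖ₑ ^ p * ENNReal.ofReal (‖x‖ ^ (-s))

/-- The function `u`, with gradient `G` and Laplacian `L`, represents an element of the completion
of `C₀^∞(ℝⁿ)` for the norm
`(∫ |Δφ|² |x|^{-2α} dx)^{1/2} + (∫ |∇φ|^q |x|^{-β} dx)^{1/q}`.
For `q = 2` this is the space `H²_{α,β}(ℝⁿ)`. The norm does not see additive constants, so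
an element of the completion is a function up to an additive constant. It is given by the limits
`L` of the `Δφₖ` and `G` of the `∇φₖ`. Away from the origin, where the weights are bounded above and
below on compact sets, these are the distributional derivatives of `u`. -/
structure MemH2 {n : ℕ} (q α β : ℝ) (u : E n → ℝ) (G : E n → E n) (L : E n → ℝ) : Prop where
  weakGradient : HasWeakGradient u G
  weakLaplacian : HasWeakLaplacian u L
  approx : ∃ φ : ℕ → E n → ℝ, (∀ k, IsTest (φ k)) ∧
    Tendsto (fun k => wInt 2 (2 * α) (fun x => Δ (φ k) x - L x)) atTop (𝓝 0) ∧
    Tendsto (fun k => wInt q β (fun x => ∇ (φ k) x - G x)) atTop (𝓝 0)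

/-- `u` is (almost everywhere equal to) a radial function. -/
def IsRadial {n : ℕ} (u : E n → ℝ) : Prop :=
  ∃ f : ℝ → ℝ, u =ᵐ[volume] fun x => f ‖x‖

/-- The constant `((n + t (1 + 2α - γ)) / t)²`. -/
def sharpConst (n : ℕ) (t α γ : ℝ) : ℝ :=
  ((n + t * (1 + 2 * α - γ)) / t) ^ 2

/-- The profile for `t = 2`. -/
def U₁ {n : ℕ} (α β : ℝ) (x : E n) : ℝ :=
  ∫ s in Ioi ‖x‖,
    s ^ (1 + 2 * α) * Real.exp (-(s ^ (1 + α - β / 2) / (1 + α - β / 2)))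

/-- The profile for `t > 2`. -/
def U₂ {n : ℕ} (t α β : ℝ) (x : E n) : ℝ :=
  ∫ r in Ioi ‖x‖,
    r ^ (1 + 2 * α) *
      (1 + (t - 2) * (r ^ ((1 + 2 * α) * (t - 2) + 1 + α - β / 2) /
        ((1 + 2 * α) * (t - 2) + 1 + α - β / 2))) ^ (1 / (2 - t))

open Classical in
/-- The extremal profile: `U₁` if `t = 2` and `U₂` otherwise. -/
def profile {n : ℕ} (t α β : ℝ) : E n → ℝ :=
  if t = 2 then U₁ α β else U₂ t α β

end CKN

end

/-! In the variable `s = log |x|` a radial function has a profile `w`, a flux `W = e^{(n-2)s} w'`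
and the Laplacian `e^{-ns} W'`. Put `m = n/2 + α`, `a = e^{(n/2-α)s} Δu` and `y = e^{-ms} W`, so
that `y' = a - m y`. Up to the area of the sphere, the three integrals are `∫ a²`, `∫ |y|^{2(t-1)}
e^{2κs}` and `∫ |y|^t e^{κs}`, with `κ` given by `kap`.

Since `(a - 2my)² = a² - 2m (y²)'`, the integrals of `(a - 2my)²` and `a²` agree. With `Q =
|y|^{t-2} y e^{κs}` (`dualPow`), integrating `(|y|^t e^{κs})'` over the line gives `∫ (a - 2my) Q =
-((κ + tm)/t) ∫ |y|^t e^{κs}`. The inequality is Cauchy–Schwarz for `a - 2my` and `Q`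
(`CoreIdentities.sq_le`), and `((κ + tm)/t)²` is the sharp constant (`sharpConst_eq`).

The delicate point is the absence of boundary terms. A nonzero constant flux has zero Laplacian, so
finiteness of the first integral alone does not suffice. Membership in the completion forces `W` to
vanish at the end where `e^{ms}` does (`MemH2.fluxZero`), and a Hardy inequality then puts `y` in
`L²`. The case `m = 0` has a separate argument, and for `m = κ = 0` the constant is zero. The
reduction to one dimension for functions with only distributional derivatives is
`exists_radialData`, which rests on `exists_of_weak_ode`.

Equality in Cauchy–Schwarz reads `y' = m y - c Q`. Then `z = e^{-ms} y` solves the Bernoulli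
equation `z' = -c |z|^{t-2} z e^{σs}`. As `y = e^{ms} z` is square integrable, pure exponentials are
excluded and only multiples of translates of `zProf` remain (`eq_zProf_of_hasDerivAt`); translation
in `s` is dilation in `x`. Conversely the profile satisfies the equation with `c = 1`. For sharpness
its flux is truncated, which gives radial test functions along which all three integrals converge
(`le_of_forall_isTest`). -/

noncomputable section

open MeasureTheory Filter Topology Set
open scoped ENNReal ContDiff Laplacian Gradient

namespace CKN

/-! ### Calculus of locally absolutely continuous functions on the line. -/

/-- `F` is a locally absolutely continuous function on `ℝ` with derivative `f`. -/
def IsPrim (F f : ℝ → ℝ) : Prop :=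
  LocallyIntegrable f ∧ ∀ a b, ∫ x in a..b, f x = F b - F a

lemma intervalIntegrable_of_locallyIntegrable {f : ℝ → ℝ} (hf : LocallyIntegrable f) (a b : ℝ) :
    IntervalIntegrable f volume a b :=
  intervalIntegrable_iff.mpr <|
    (hf.integrableOn_isCompact isCompact_uIcc).mono_set uIoc_subset_uIcc

lemma locallyIntegrable_of_intervalIntegrable {f : ℝ → ℝ}
    (hf : ∀ a b, IntervalIntegrable f volume a b) : LocallyIntegrable f := by
  intro x
  refine ⟨Ioc (x - 1) (x + 1), Ioc_mem_nhds (by linarith) (by linarith), ?_⟩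
  exact (hf (x - 1) (x + 1)).1

namespace IsPrim

variable {F f G g : ℝ → ℝ}

lemma intervalIntegrable (h : IsPrim F f) (a b : ℝ) : IntervalIntegrable f volume a b :=
  intervalIntegrable_of_locallyIntegrable h.1 a b

lemma eq_add (h : IsPrim F f) (a : ℝ) : F = fun x => F a + ∫ s in a..x, f s := by
  funext x; rw [h.2]; ring

lemma absolutelyContinuous (h : IsPrim F f) (a b : ℝ) : AbsolutelyContinuousOnInterval F a b := by
  have h1 := (h.intervalIntegrable a b).absolutelyContinuousOnInterval_intervalIntegral
    (c := a) (by simp)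
  have h2 : AbsolutelyContinuousOnInterval (fun _ : ℝ => F a) a b :=
    (LipschitzWith.const (F a)).lipschitzOnWith.absolutelyContinuousOnInterval
  have := h2.add h1
  rw [h.eq_add a]
  exact this

lemma continuous (h : IsPrim F f) : Continuous F := by
  rw [h.eq_add 0]
  exact continuous_const.add
    (intervalIntegral.continuous_primitive (fun a b => h.intervalIntegrable a b) 0)

lemma ae_hasDerivAt (h : IsPrim F f) : ∀ᵐ x, HasDerivAt F (f x) x := by
  filter_upwards [LocallyIntegrable.ae_hasDerivAt_integral h.1] with x hx
  rw [h.eq_add 0]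
  exact (hx 0).const_add _

lemma of_absolutelyContinuous (hF : ∀ a b, AbsolutelyContinuousOnInterval F a b)
    (h : ∀ᵐ x, HasDerivAt F (f x) x) : IsPrim F f := by
  have hd : deriv F =ᵐ[volume] f := h.mono fun x hx => hx.deriv
  have hi : ∀ a b, IntervalIntegrable f volume a b := fun a b =>
    (hF a b).intervalIntegrable_deriv.congr_ae (ae_restrict_of_ae hd)
  refine ⟨locallyIntegrable_of_intervalIntegrable hi, fun a b => ?_⟩
  rw [← (hF a b).integral_deriv_eq_sub]
  exact intervalIntegral.integral_congr_ae (hd.mono fun x hx _ => hx.symm)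

lemma of_hasDerivAt (h : ∀ x, HasDerivAt F (f x) x) (hf : Continuous f) : IsPrim F f :=
  ⟨hf.locallyIntegrable, fun a b =>
    intervalIntegral.integral_eq_sub_of_hasDerivAt (fun x _ => h x) (hf.intervalIntegrable a b)⟩

lemma hasDerivAt (h : IsPrim F f) (hf : Continuous f) (x : ℝ) : HasDerivAt F (f x) x := by
  rw [h.eq_add 0]
  exact (intervalIntegral.integral_hasDerivAt_right (hf.intervalIntegrable 0 x)
    (hf.stronglyMeasurableAtFilter _ _) hf.continuousAt).const_add _

lemma congr (h : IsPrim F f) (hfg : f =ᵐ[volume] g) : IsPrim F g :=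
  of_absolutelyContinuous h.absolutelyContinuous (by
    filter_upwards [h.ae_hasDerivAt, hfg] with x hx hx'
    rwa [← hx'])

lemma mul (hF : IsPrim F f) (hG : IsPrim G g) :
    IsPrim (fun x => F x * G x) (fun x => f x * G x + F x * g x) :=
  of_absolutelyContinuous
    (fun a b => (hF.absolutelyContinuous a b).mul (hG.absolutelyContinuous a b)) (by
      filter_upwards [hF.ae_hasDerivAt, hG.ae_hasDerivAt] with x hx hx'
      exact hx.mul hx')

/-- A `C¹` function is Lipschitz on the bounded range of `F` over an interval, so absolute
continuity survives. This is applied to `y ↦ y²` and `y ↦ |y|^t`. -/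
lemma comp {Φ φ : ℝ → ℝ} (hΦ : ∀ x, HasDerivAt Φ (φ x) x) (hφ : Continuous φ) (hF : IsPrim F f) :
    IsPrim (fun x => Φ (F x)) (fun x => φ (F x) * f x) := by
  have hC : ContDiff ℝ 1 Φ := by
    rw [contDiff_one_iff_deriv]
    refine ⟨fun x => (hΦ x).differentiableAt, ?_⟩
    rwa [show deriv Φ = φ from funext fun x => (hΦ x).deriv]
  refine of_absolutelyContinuous (fun a b => ?_) ?_
  · obtain ⟨R, hR⟩ := (hF.absolutelyContinuous a b).exists_bound
    obtain ⟨K, hK⟩ := (hC.contDiffOn (s := Icc (-R) R)).exists_lipschitzOnWith (by decide)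
      (convex_Icc _ _) isCompact_Icc
    have hm : ∀ x ∈ uIcc a b, F x ∈ Icc (-R) R := fun x hx => abs_le.1 (hR x hx)
    have hac := hF.absolutelyContinuous a b
    rw [absolutelyContinuousOnInterval_iff] at hac ⊢
    intro ε hε
    -- The divisor is `K + 1` because the Lipschitz constant `K` may be zero.
    obtain ⟨δ, hδ, H⟩ := hac (ε / (K + 1)) (by positivity)
    refine ⟨δ, hδ, fun E hE hEδ => ?_⟩
    have h1 := H E hE hEδ
    calc ∑ i ∈ Finset.range E.1, dist (Φ (F (E.2 i).1)) (Φ (F (E.2 i).2))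
        ≤ ∑ i ∈ Finset.range E.1, K * dist (F (E.2 i).1) (F (E.2 i).2) :=
          Finset.sum_le_sum fun i hi => hK.dist_le_mul _ (hm _ (hE.1 i hi).1) _ (hm _ (hE.1 i hi).2)
      _ = K * ∑ i ∈ Finset.range E.1, dist (F (E.2 i).1) (F (E.2 i).2) := by
          rw [Finset.mul_sum]
      _ ≤ K * (ε / (K + 1)) := by gcongr
      _ < (K + 1) * (ε / (K + 1)) := by gcongr; linarith
      _ = ε := by field_simp
  · filter_upwards [hF.ae_hasDerivAt] with x hx
    exact (hΦ (F x)).comp x hx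

/-- Integrability of the derivative makes the limit exist; an integrable function cannot have a
nonzero limit along a half-line. -/
lemma tendsto_atTop_zero (h : IsPrim F f) (hf : Integrable f) (hF : Integrable F) :
    Tendsto F atTop (𝓝 0) := by
  have h1 : Tendsto F atTop (𝓝 (F 0 + ∫ x in Ioi 0, f x)) := by
    have := intervalIntegral_tendsto_integral_Ioi (0 : ℝ) hf.integrableOn tendsto_id
    nth_rewrite 1 [h.eq_add 0]
    exact this.const_add _
  have h2 : F 0 + ∫ x in Ioi 0, f x = 0 := by
    refine IntegrableAtFilter.eq_zero_of_tendsto (μ := volume) (l := atTop)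
      ⟨univ, univ_mem, hF.integrableOn⟩ ?_ h1
    intro s hs
    obtain ⟨b, hb⟩ := mem_atTop_sets.1 hs
    refine measure_mono_top (fun x hx => hb x hx) (Real.volume_Ici (a := b))
  rwa [h2] at h1

lemma tendsto_atBot_zero (h : IsPrim F f) (hf : Integrable f) (hF : Integrable F) :
    Tendsto F atBot (𝓝 0) := by
  have h1 : Tendsto F atBot (𝓝 (F 0 - ∫ x in Iic 0, f x)) := by
    have := intervalIntegral_tendsto_integral_Iic (0 : ℝ) hf.integrableOn tendsto_id
    have h3 : F = fun x => F 0 - ∫ s in x..0, f s := by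
      funext x; rw [h.2]; ring
    nth_rewrite 1 [h3]
    exact this.const_sub _
  have h2 : F 0 - ∫ x in Iic 0, f x = 0 := by
    refine IntegrableAtFilter.eq_zero_of_tendsto (μ := volume) (l := atBot)
      ⟨univ, univ_mem, hF.integrableOn⟩ ?_ h1
    intro s hs
    obtain ⟨b, hb⟩ := mem_atBot_sets.1 hs
    refine measure_mono_top (fun x hx => hb x hx) (Real.volume_Iic (a := b))
  rwa [h2] at h1

/-- This is the form in which the integrations by parts over the whole line are done: no boundary
terms once `F` and its derivative are both integrable. -/
lemma integral_eq_zero (h : IsPrim F f) (hf : Integrable f) (hF : Integrable F) :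
    ∫ x, f x = 0 := by
  have h1 := intervalIntegral_tendsto_integral hf tendsto_neg_atTop_atBot tendsto_id
  have h2 : Tendsto (fun x : ℝ => F x - F (-x)) atTop (𝓝 (0 - 0)) :=
    (h.tendsto_atTop_zero hf hF).sub
      ((h.tendsto_atBot_zero hf hF).comp tendsto_neg_atTop_atBot)
  simp only [h.2, id] at h1
  rw [sub_zero] at h2
  exact tendsto_nhds_unique h1 h2

/-- Integration by parts against a compactly supported `C¹` function. -/
lemma integral_mul_deriv (h : IsPrim F f) {η η' : ℝ → ℝ} (hη : ∀ x, HasDerivAt η (η' x) x)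
    (hη' : Continuous η') (hc : HasCompactSupport η) :
    ∫ x, F x * η' x = -∫ x, f x * η x := by
  have hηc : Continuous η := continuous_iff_continuousAt.2 fun x => (hη x).continuousAt
  have e : η' = deriv η := funext fun x => ((hη x).deriv).symm
  have hc' : HasCompactSupport η' := by rw [e]; exact hc.deriv
  have i1 : Integrable (fun x => f x * η x) := by
    have := h.1.integrable_smul_right_of_hasCompactSupport hηc hc
    simpa using this
  have i2 : Integrable (fun x => F x * η' x) :=
    (h.continuous.mul hη').integrable_of_hasCompactSupport hc'.mul_left
  have i3 : Integrable (fun x => F x * η x) :=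
    (h.continuous.mul hηc).integrable_of_hasCompactSupport hc.mul_left
  have := (h.mul (of_hasDerivAt hη hη')).integral_eq_zero (i1.add i2) i3
  rw [integral_add i1 i2] at this
  linarith

end IsPrim

/-! ### The one-dimensional inequality for `y' = a - m y`. -/

/-- `|y|^(t-2) y e^{κ s}`. -/
def dualPow (t κ : ℝ) (y : ℝ → ℝ) (s : ℝ) : ℝ := |y s| ^ (t - 2) * y s * Real.exp (κ * s)

section

variable {t κ m : ℝ} {y a W : ℝ → ℝ}

lemma continuous_dualPow (ht : 2 ≤ t) (hy : Continuous y) : Continuous (dualPow t κ y) := by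
  unfold dualPow
  have : Continuous fun s => |y s| ^ (t - 2) :=
    hy.abs.rpow_const fun x => Or.inr (by linarith)
  fun_prop

/-- `dualPow` is the second factor in Cauchy–Schwarz: its square is the integrand of the dual
gradient integral, and its product with `y` is that of the middle integral. -/
lemma dualPow_sq (ht : 2 ≤ t) (s : ℝ) :
    dualPow t κ y s ^ 2 = |y s| ^ (2 * (t - 1)) * Real.exp (2 * κ * s) := by
  unfold dualPow
  rcases eq_or_ne (y s) 0 with h | h
  · rw [h]; simp [Real.zero_rpow (show 2 * (t - 1) ≠ 0 by linarith)]
  · have h0 : 0 < |y s| := abs_pos.2 h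
    have e1 : |y s| ^ (2 * (t - 1)) = (|y s| ^ (t - 2)) ^ 2 * |y s| ^ 2 := by
      rw [← Real.rpow_natCast, ← Real.rpow_natCast, ← Real.rpow_mul h0.le, ← Real.rpow_add h0]
      congr 1; push_cast; ring
    have e2 : Real.exp (2 * κ * s) = Real.exp (κ * s) ^ 2 := by
      rw [← Real.exp_nat_mul]; congr 1; push_cast; ring
    rw [e1, e2, sq_abs]; ring

lemma mul_dualPow (ht : 2 ≤ t) (s : ℝ) :
    y s * dualPow t κ y s = |y s| ^ t * Real.exp (κ * s) := by
  unfold dualPow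
  rcases eq_or_ne (y s) 0 with h | h
  · rw [h]; simp [Real.zero_rpow (show t ≠ 0 by linarith)]
  · have h0 : 0 < |y s| := abs_pos.2 h
    have e1 : |y s| ^ t = |y s| ^ (t - 2) * |y s| ^ 2 := by
      rw [← Real.rpow_natCast, ← Real.rpow_add h0]
      congr 1; push_cast; ring
    rw [e1, sq_abs]; ring

/-- Passing from `W` to `y = e^{-ms} W`. -/
lemma IsPrim.expWeighted (hW : IsPrim W fun s => Real.exp (m * s) * a s) :
    IsPrim (fun s => Real.exp (-m * s) * W s)
      (fun s => a s - m * (Real.exp (-m * s) * W s)) := by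
  have h1 : ∀ x, HasDerivAt (fun s => Real.exp (-m * s)) (Real.exp (-m * x) * -m) x := fun x => by
    have := ((hasDerivAt_id x).const_mul (-m)).exp
    simpa using this
  have h2 := (IsPrim.of_hasDerivAt h1 (by fun_prop)).mul hW
  refine h2.congr (Eventually.of_forall fun s => ?_)
  have : Real.exp (-m * s) * Real.exp (m * s) = 1 := by
    rw [← Real.exp_add]; simp
  calc _ = a s * (Real.exp (-m * s) * Real.exp (m * s)) - m * (Real.exp (-m * s) * W s) := by ring
    _ = _ := by rw [this]; ring

/-- After factoring out `e^{ms}`, the inequality `2pq ≤ p² + q²` separates `a` from the exponential.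
The condition on `x` puts it on the side of `s` where `e^{m r}` decays, so the bound does not depend
on `x`, which may then run to that end of the line. -/
lemma IsPrim.abs_sub_le (hm : m ≠ 0) (hW : IsPrim W fun s => Real.exp (m * s) * a s)
    (ha : Integrable fun s => a s ^ 2) {x s : ℝ} (hx : m * (x - s) ≤ 0) :
    |W s - W x| ≤ Real.exp (m * s) * ((1 / |m| + ∫ r, a r ^ 2) / 2) := by
  set g : ℝ → ℝ := fun r => Real.exp (m * s) / 2 * (Real.exp (2 * m * (r - s)) + a r ^ 2) with hg
  have gi : IntervalIntegrable g volume x s := by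
    refine IntervalIntegrable.const_mul (IntervalIntegrable.add ?_ ha.intervalIntegrable) _
    exact Continuous.intervalIntegrable (by fun_prop) _ _
  have h1 : ‖∫ r in x..s, Real.exp (m * r) * a r‖ ≤ |∫ r in x..s, g r| := by
    refine intervalIntegral.norm_integral_le_abs_of_norm_le (Eventually.of_forall fun r => ?_) gi
    have e1 : Real.exp (m * r) = Real.exp (m * s) * Real.exp (m * (r - s)) := by
      rw [← Real.exp_add]; ring_nf
    have e2 : Real.exp (2 * m * (r - s)) = Real.exp (m * (r - s)) ^ 2 := by
      rw [← Real.exp_nat_mul]; congr 1; push_cast; ring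
    rw [Real.norm_eq_abs, abs_mul, abs_of_pos (Real.exp_pos _), e1, hg]
    simp only
    rw [e2]
    have := sq_nonneg (Real.exp (m * (r - s)) - |a r|)
    have h3 : Real.exp (m * (r - s)) * |a r| ≤ (Real.exp (m * (r - s)) ^ 2 + a r ^ 2) / 2 := by
      nlinarith [sq_abs (a r)]
    calc Real.exp (m * s) * Real.exp (m * (r - s)) * |a r|
        = Real.exp (m * s) * (Real.exp (m * (r - s)) * |a r|) := by ring
      _ ≤ Real.exp (m * s) * ((Real.exp (m * (r - s)) ^ 2 + a r ^ 2) / 2) := by gcongr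
      _ = _ := by ring
  have h2 : ∫ r in x..s, Real.exp (2 * m * (r - s)) = (1 - Real.exp (2 * m * (x - s))) / (2 * m) := by
    have hd : ∀ r ∈ uIcc x s, HasDerivAt (fun r => Real.exp (2 * m * (r - s)) / (2 * m))
        (Real.exp (2 * m * (r - s))) r := fun r _ => by
      have := ((((hasDerivAt_id r).sub_const s).const_mul (2 * m)).exp).div_const (2 * m)
      refine this.congr_deriv ?_
      simp only [mul_one]; field_simp; simp
    rw [intervalIntegral.integral_eq_sub_of_hasDerivAt hd
      (Continuous.intervalIntegrable (by fun_prop) _ _)]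
    simp; ring
  have h3 : |(1 - Real.exp (2 * m * (x - s))) / (2 * m)| ≤ 1 / |m| := by
    have e0 : Real.exp (2 * m * (x - s)) ≤ 1 := Real.exp_le_one_iff.2 (by nlinarith)
    have hm' : 0 < |m| := abs_pos.2 hm
    rw [abs_div, abs_mul, abs_two, abs_of_nonneg (by linarith),
      div_le_div_iff₀ (by positivity) hm']
    nlinarith [Real.exp_pos (2 * m * (x - s))]
  have h4 : |∫ r in x..s, a r ^ 2| ≤ ∫ r, a r ^ 2 := by
    rw [← Real.norm_eq_abs]
    refine (intervalIntegral.norm_integral_le_integral_norm_uIoc).trans ?_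
    have : ∀ r, ‖a r ^ 2‖ = a r ^ 2 := fun r => by
      rw [Real.norm_eq_abs, abs_of_nonneg (sq_nonneg _)]
    simp only [this]
    exact setIntegral_le_integral ha (Eventually.of_forall fun r => sq_nonneg _)
  rw [← hW.2, ← Real.norm_eq_abs]
  refine h1.trans ?_
  rw [hg, intervalIntegral.integral_const_mul, intervalIntegral.integral_add
    (Continuous.intervalIntegrable (by fun_prop) _ _) ha.intervalIntegrable, h2, abs_mul,
    abs_of_pos (by positivity)]
  calc _ ≤ Real.exp (m * s) / 2 * (1 / |m| + ∫ r, a r ^ 2) := by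
        gcongr
        exact (abs_add_le _ _).trans (add_le_add h3 h4)
    _ = _ := by ring

/-- `W` vanishes at the end of the line where `e^{m s}` does. -/
def FluxZero (m : ℝ) (W : ℝ → ℝ) : Prop :=
  (0 < m → Tendsto W atBot (𝓝 0)) ∧ (m < 0 → Tendsto W atTop (𝓝 0))

lemma IsPrim.exists_bound_of_fluxZero (hm : m ≠ 0)
    (hW : IsPrim W fun s => Real.exp (m * s) * a s)
    (ha : Integrable fun s => a s ^ 2) (hf : FluxZero m W) :
    ∃ C, ∀ s, |Real.exp (-m * s) * W s| ≤ C := by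
  refine ⟨(1 / |m| + ∫ r, a r ^ 2) / 2, fun s => ?_⟩
  have key : |W s| ≤ Real.exp (m * s) * ((1 / |m| + ∫ r, a r ^ 2) / 2) := by
    rcases lt_or_gt_of_ne hm with h | h
    · have h1 : Tendsto (fun x => |W s - W x|) atTop (𝓝 |W s - 0|) :=
        ((hf.2 h).const_sub _).abs
      rw [sub_zero] at h1
      refine le_of_tendsto h1 ?_
      filter_upwards [eventually_ge_atTop s] with x hx
      exact hW.abs_sub_le hm ha (mul_nonpos_of_nonpos_of_nonneg h.le (by linarith))
    · have h1 : Tendsto (fun x => |W s - W x|) atBot (𝓝 |W s - 0|) :=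
        ((hf.1 h).const_sub _).abs
      rw [sub_zero] at h1
      refine le_of_tendsto h1 ?_
      filter_upwards [eventually_le_atBot s] with x hx
      exact hW.abs_sub_le hm ha (mul_nonpos_of_nonneg_of_nonpos h.le (by linarith))
  rw [abs_mul, abs_of_pos (Real.exp_pos _)]
  calc _ ≤ Real.exp (-m * s) * (Real.exp (m * s) * ((1 / |m| + ∫ r, a r ^ 2) / 2)) := by gcongr
    _ = (Real.exp (-m * s) * Real.exp (m * s)) * ((1 / |m| + ∫ r, a r ^ 2) / 2) := by ring
    _ = _ := by rw [← Real.exp_add]; simp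

lemma IsPrim.aestronglyMeasurable (hy : IsPrim y fun s => a s - m * y s) :
    AEStronglyMeasurable a := by
  have h1 := hy.1.aestronglyMeasurable
  have h2 : AEStronglyMeasurable (fun s => m * y s) volume :=
    (hy.continuous.const_mul m).aestronglyMeasurable
  exact (h1.add h2).congr (Eventually.of_forall fun s => by simp)

lemma IsPrim.sq (hy : IsPrim y fun s => a s - m * y s) :
    IsPrim (fun s => y s ^ 2) fun s => 2 * y s * (a s - m * y s) :=
  IsPrim.comp (Φ := fun x => x ^ 2) (φ := fun x => 2 * x)
    (fun x => by simpa using hasDerivAt_pow 2 x) (by fun_prop) hy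

/-- A one dimensional Hardy inequality. -/
lemma IsPrim.integrable_sq (hm : m ≠ 0) (hy : IsPrim y fun s => a s - m * y s)
    (ha : Integrable fun s => a s ^ 2) {C : ℝ} (hC : ∀ s, |y s| ≤ C) :
    Integrable fun s => y s ^ 2 := by
  have hyc := hy.continuous
  refine integrable_of_intervalIntegral_norm_bounded (μ := volume)
    (((∫ r, a r ^ 2) + 2 * |m| * C ^ 2) / m ^ 2) (a := fun n : ℝ => -n) (b := fun n : ℝ => n)
    (l := atTop)
    (fun n => (hyc.pow 2).integrableOn_Ioc) tendsto_neg_atTop_atBot tendsto_id ?_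
  filter_upwards [eventually_ge_atTop (0 : ℝ)] with R hR
  have hm2 : 0 < m ^ 2 := by positivity
  have e : ∀ s, ‖y s ^ 2‖ = y s ^ 2 := fun s => by
    rw [Real.norm_eq_abs, abs_of_nonneg (sq_nonneg _)]
  simp only [e]
  rw [le_div_iff₀ hm2]
  have i1 : IntervalIntegrable (fun s => 2 * y s * (a s - m * y s)) volume (-R) R :=
    hy.sq.intervalIntegrable _ _
  have i2 : IntervalIntegrable (fun s => a s ^ 2) volume (-R) R := ha.intervalIntegrable
  have h1 := hy.sq.2 (-R) R
  -- The factor `2 y (a - m y)` is `(y²)'`, and the difference of the two integrands is `(a - m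
  -- y)²`. Hence `m² ∫ y²` is at most `∫ a²` plus boundary terms, which the bound on `y` controls.
  have h2 : ∫ s in (-R)..R, m ^ 2 * y s ^ 2 ≤
      ∫ s in (-R)..R, (a s ^ 2 - m * (2 * y s * (a s - m * y s))) := by
    refine intervalIntegral.integral_mono_on (by linarith)
      (Continuous.intervalIntegrable (by fun_prop) _ _) (i2.sub (i1.const_mul m)) fun s _ => ?_
    nlinarith [sq_nonneg (a s - m * y s)]
  rw [intervalIntegral.integral_sub i2 (i1.const_mul m), intervalIntegral.integral_const_mul,
    intervalIntegral.integral_const_mul, h1] at h2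
  have h3 : ∫ s in (-R)..R, a s ^ 2 ≤ ∫ s, a s ^ 2 := by
    rw [intervalIntegral.integral_of_le (by linarith)]
    exact setIntegral_le_integral ha (Eventually.of_forall fun r => sq_nonneg _)
  have hy1 : ∀ s, y s ^ 2 ≤ C ^ 2 := fun s => by
    rw [← sq_abs]; exact pow_le_pow_left₀ (abs_nonneg _) (hC s) 2
  have h4 : -(m * (y R ^ 2 - y (-R) ^ 2)) ≤ 2 * |m| * C ^ 2 := by
    have hh : |y R ^ 2 - y (-R) ^ 2| ≤ 2 * C ^ 2 := by
      rw [abs_le]; constructor <;>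
        nlinarith [hy1 R, hy1 (-R), sq_nonneg (y R), sq_nonneg (y (-R))]
    calc -(m * (y R ^ 2 - y (-R) ^ 2)) ≤ |m * (y R ^ 2 - y (-R) ^ 2)| := neg_le_abs _
      _ = |m| * |y R ^ 2 - y (-R) ^ 2| := abs_mul _ _
      _ ≤ |m| * (2 * C ^ 2) := by gcongr
      _ = _ := by ring
  linarith

lemma IsPrim.memLp_of_sq (hy : IsPrim y fun s => a s - m * y s)
    (ha : Integrable fun s => a s ^ 2) : MemLp a 2 :=
  (memLp_two_iff_integrable_sq hy.aestronglyMeasurable).2 ha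

lemma memLp_dualPow (ht : 2 ≤ t) (hy : Continuous y)
    (hb : Integrable fun s => |y s| ^ (2 * (t - 1)) * Real.exp (2 * κ * s)) :
    MemLp (dualPow t κ y) 2 := by
  rw [memLp_two_iff_integrable_sq (continuous_dualPow ht hy).aestronglyMeasurable]
  simpa only [dualPow_sq ht] using hb

/-- The derivative of `|y|^t e^{κ s}`. -/
lemma IsPrim.pow_exp (ht : 2 ≤ t) (hy : IsPrim y fun s => a s - m * y s) :
    IsPrim (fun s => |y s| ^ t * Real.exp (κ * s))
      (fun s => t * ((a s - 2 * m * y s) * dualPow t κ y s) +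
        (κ + t * m) * (|y s| ^ t * Real.exp (κ * s))) := by
  have h1 : ∀ x : ℝ, HasDerivAt (fun x : ℝ => |x| ^ t) (t * |x| ^ (t - 2) * x) x := fun x =>
    hasDerivAt_abs_rpow x (by linarith)
  have h1c : Continuous fun x : ℝ => t * |x| ^ (t - 2) * x := by
    have : Continuous fun x : ℝ => |x| ^ (t - 2) :=
      continuous_abs.rpow_const fun x => Or.inr (by linarith)
    fun_prop
  have h2 : ∀ x, HasDerivAt (fun s => Real.exp (κ * s)) (κ * Real.exp (κ * x)) x := fun x => by
    have := ((hasDerivAt_id x).const_mul κ).exp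
    simpa [mul_comm] using this
  refine ((IsPrim.comp h1 h1c hy).mul (IsPrim.of_hasDerivAt h2 (by fun_prop))).congr
    (Eventually.of_forall fun s => ?_)
  have := mul_dualPow (κ := κ) (y := y) ht s
  simp only
  -- Here `y' = a - m y` is split as `(a - 2 m y) + m y`: the first part is the combination whose
  -- square integrates like `a²`, and the second gives back `|y|^t e^{κs}`.
  rw [show (κ + t * m) * (|y s| ^ t * Real.exp (κ * s)) =
    κ * (|y s| ^ t * Real.exp (κ * s)) + t * m * (y s * dualPow t κ y s) by rw [this]; ring]
  unfold dualPow
  ring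

/-- With `h = |y|^t e^{κs}`, the integrand in `hb` is `h^{2(t-1)/t} e^{2κs/t}`. If `h > 1`
eventually where `κ s ≥ 0`, this would be at least `1` on a set of infinite measure. It provides
good endpoints when `m = 0` and no Hardy inequality is available. -/
lemma frequently_pow_exp_le_one (ht : 2 ≤ t) (hb : Integrable fun s => |y s| ^ (2 * (t - 1)) * Real.exp (2 * κ * s))
    {l : Filter ℝ} (hl : ∀ᶠ s in l, 0 ≤ κ * s) (hinf : ∀ S ∈ l, volume S = ⊤) :
    ∃ᶠ s in l, |y s| ^ t * Real.exp (κ * s) ≤ 1 := by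
  intro hcon
  have h1 : {s | 0 ≤ κ * s ∧ ¬ |y s| ^ t * Real.exp (κ * s) ≤ 1} ∈ l := hl.and hcon
  have h2 := hb.measure_norm_ge_lt_top (ε := 1) one_pos
  refine absurd (hinf _ h1) (ne_top_of_le_ne_top h2.ne (measure_mono fun s hs => ?_))
  obtain ⟨hs0, hs1⟩ := hs
  push Not at hs1
  simp only [mem_ofPred_eq]
  rw [Real.norm_eq_abs, abs_of_nonneg (by positivity)]
  have e : |y s| ^ (2 * (t - 1)) * Real.exp (2 * κ * s) =
      (|y s| ^ t * Real.exp (κ * s)) ^ (2 * (t - 1) / t) * Real.exp (2 / t * (κ * s)) := by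
    rw [Real.mul_rpow (by positivity) (by positivity), ← Real.rpow_mul (abs_nonneg _),
      ← Real.exp_mul, mul_assoc (|y s| ^ _) (Real.exp _) (Real.exp _), ← Real.exp_add]
    congr 2
    · field_simp
    · field_simp; ring
  rw [e]
  have h3 : 1 ≤ (|y s| ^ t * Real.exp (κ * s)) ^ (2 * (t - 1) / t) :=
    Real.one_le_rpow hs1.le (div_nonneg (by linarith) (by linarith))
  have h4 : 1 ≤ Real.exp (2 / t * (κ * s)) :=
    Real.one_le_exp (mul_nonneg (div_nonneg (by linarith) (by linarith)) hs0)
  nlinarith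

/-- Integrability of `|y|^t e^{κ s}` in the degenerate case `m = 0`. -/
lemma IsPrim.integrable_pow_exp_of_zero (ht : 2 ≤ t) (hκ : κ ≠ 0) (hy : IsPrim y a)
    (ha : Integrable fun s => a s ^ 2)
    (hb : Integrable fun s => |y s| ^ (2 * (t - 1)) * Real.exp (2 * κ * s)) :
    Integrable fun s => |y s| ^ t * Real.exp (κ * s) := by
  have hy0 : IsPrim y fun s => a s - 0 * y s := by simpa using hy
  have hyc := hy.continuous
  have hP := hy0.pow_exp (κ := κ) ht
  set h : ℝ → ℝ := fun s => |y s| ^ t * Real.exp (κ * s) with hh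
  have hhc : Continuous h := hP.continuous
  have hh0 : ∀ s, 0 ≤ h s := fun s => by positivity
  -- `h' = g + κ h` with `g` a product of two `L²` functions, so `κ ∫ h` over an interval is a
  -- difference of boundary values up to a bounded error.
  set g : ℝ → ℝ := fun s => t * (a s * dualPow t κ y s) with hg
  have gi : Integrable g :=
    ((hy0.memLp_of_sq ha).integrable_mul (memLp_dualPow ht hyc hb)).const_mul t
  have hP' : IsPrim h fun s => g s + κ * h s := by
    refine hP.congr (Eventually.of_forall fun s => ?_)
    simp [hg, hh]
  have key : ∀ x₁ x₂, x₁ ≤ x₂ → κ * ∫ s in x₁..x₂, h s ≤ h x₂ - h x₁ + ∫ s, |g s| ∧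
      -(κ * ∫ s in x₁..x₂, h s) ≤ h x₁ - h x₂ + ∫ s, |g s| := fun x₁ x₂ h12 => by
    have h1 := hP'.2 x₁ x₂
    rw [intervalIntegral.integral_add (f := g) (g := fun s => κ * h s) gi.intervalIntegrable
      (Continuous.intervalIntegrable (by fun_prop) _ _),
      intervalIntegral.integral_const_mul κ h] at h1
    have h2 : |∫ s in x₁..x₂, g s| ≤ ∫ s, |g s| := by
      rw [← Real.norm_eq_abs]
      refine (intervalIntegral.norm_integral_le_integral_norm_uIoc).trans ?_
      exact setIntegral_le_integral gi.abs (Eventually.of_forall fun r => abs_nonneg _)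
    rw [abs_le] at h2
    constructor <;> linarith
  refine integrable_of_intervalIntegral_norm_bounded (μ := volume)
    ((1 + ∫ s, |g s|) / |κ|) (a := fun n : ℝ => -n) (b := fun n : ℝ => n) (l := atTop)
    (fun n => hhc.integrableOn_Ioc) tendsto_neg_atTop_atBot tendsto_id ?_
  filter_upwards [eventually_ge_atTop (0 : ℝ)] with R hR
  have e : ∀ s, ‖h s‖ = h s := fun s => by rw [Real.norm_eq_abs, abs_of_nonneg (hh0 _)]
  simp only [e]
  rw [le_div_iff₀ (abs_pos.2 hκ)]
  have hii : ∀ x₁ x₂, IntervalIntegrable h volume x₁ x₂ := fun _ _ => hhc.intervalIntegrable _ _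
  -- The sign of `κ` decides at which end points with `h ≤ 1` are available; the boundary term at
  -- the other end has the favourable sign.
  rcases lt_or_gt_of_ne hκ with hk | hk
  · have hfr := frequently_pow_exp_le_one (l := atBot) ht hb
      ((eventually_le_atBot 0).mono fun s hs => mul_nonneg_of_nonpos_of_nonpos hk.le hs)
      (fun S hS => by
        obtain ⟨b, hb⟩ := mem_atBot_sets.1 hS
        exact measure_mono_top (fun x hx => hb x hx) (Real.volume_Iic (a := b)))
    obtain ⟨x, hx1, hx2⟩ := (hfr.and_eventually (eventually_le_atBot (-R))).exists
    have h1 := (key x R (by linarith)).2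
    have h2 : ∫ s in (-R)..R, h s ≤ ∫ s in x..R, h s :=
      intervalIntegral.integral_mono_interval hx2 (by linarith) le_rfl
        (Eventually.of_forall hh0) (hii _ _)
    rw [abs_of_neg hk]
    nlinarith [hh0 R, show h x ≤ 1 from hx1]
  · have hfr := frequently_pow_exp_le_one (l := atTop) ht hb
      ((eventually_ge_atTop 0).mono fun s hs => mul_nonneg hk.le hs)
      (fun S hS => by
        obtain ⟨b, hb⟩ := mem_atTop_sets.1 hS
        exact measure_mono_top (fun x hx => hb x hx) (Real.volume_Ici (a := b)))
    obtain ⟨x, hx1, hx2⟩ := (hfr.and_eventually (eventually_ge_atTop R)).exists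
    have h1 := (key (-R) x (by linarith)).1
    have h2 : ∫ s in (-R)..R, h s ≤ ∫ s in (-R)..x, h s :=
      intervalIntegral.integral_mono_interval le_rfl (by linarith) hx2
        (Eventually.of_forall hh0) (hii _ _)
    rw [abs_of_pos hk]
    nlinarith [hh0 (-R), show h x ≤ 1 from hx1]

/-- The integrability facts and the two integral identities behind the inequality. -/
structure CoreIdentities (t κ m : ℝ) (y a : ℝ → ℝ) : Prop where
  integrable : Integrable fun s => |y s| ^ t * Real.exp (κ * s)
  memLp_left : MemLp (fun s => a s - 2 * m * y s) 2
  memLp_right : MemLp (dualPow t κ y) 2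
  integral_sq : ∫ s, (a s - 2 * m * y s) ^ 2 = ∫ s, a s ^ 2
  integral_mul : t * ∫ s, (a s - 2 * m * y s) * dualPow t κ y s =
    -((κ + t * m) * ∫ s, |y s| ^ t * Real.exp (κ * s))

lemma IsPrim.integral_mul_dualPow (ht : 2 ≤ t) (hy : IsPrim y fun s => a s - m * y s)
    (h : Integrable fun s => |y s| ^ t * Real.exp (κ * s))
    (hP : MemLp (fun s => a s - 2 * m * y s) 2) (hQ : MemLp (dualPow t κ y) 2) :
    t * ∫ s, (a s - 2 * m * y s) * dualPow t κ y s =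
    -((κ + t * m) * ∫ s, |y s| ^ t * Real.exp (κ * s)) := by
  have i1 : Integrable fun s => t * ((a s - 2 * m * y s) * dualPow t κ y s) :=
    (hP.integrable_mul hQ).const_mul t
  have i2 := h.const_mul (κ + t * m)
  have h1 := (hy.pow_exp (κ := κ) ht).integral_eq_zero (i1.add i2) h
  rw [integral_add i1 i2, integral_const_mul, integral_const_mul] at h1
  linarith

/-- Once `y` is in `L²`, the middle integrand is the product of `y` and `dualPow`, hence integrable,
and `(y²)'` integrates to zero. The first identity is then `(a - 2my)² = a² - 2m (y²)'`. -/
lemma IsPrim.coreIdentities_of_integrable_sq (ht : 2 ≤ t)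
    (hy : IsPrim y fun s => a s - m * y s) (ha : Integrable fun s => a s ^ 2)
    (hy2 : Integrable fun s => y s ^ 2)
    (hb : Integrable fun s => |y s| ^ (2 * (t - 1)) * Real.exp (2 * κ * s)) :
    CoreIdentities t κ m y a := by
  have hyL : MemLp y 2 :=
    (memLp_two_iff_integrable_sq hy.continuous.aestronglyMeasurable).2 hy2
  have haL := hy.memLp_of_sq ha
  have hQ := memLp_dualPow ht hy.continuous hb
  have hP : MemLp (fun s => a s - 2 * m * y s) 2 := haL.sub (hyL.const_mul (2 * m))
  have hh : Integrable fun s => |y s| ^ t * Real.exp (κ * s) := by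
    have := hyL.integrable_mul hQ
    refine this.congr (Eventually.of_forall fun s => ?_)
    exact mul_dualPow ht s
  refine ⟨hh, hP, hQ, ?_, hy.integral_mul_dualPow ht hh hP hQ⟩
  have hay : Integrable fun s => y s * a s := hyL.integrable_mul haL
  have i1 : Integrable fun s => 2 * y s * (a s - m * y s) := by
    refine ((hay.const_mul 2).sub (hy2.const_mul (2 * m))).congr (Eventually.of_forall fun s => ?_)
    simp only [Pi.sub_apply]; ring
  have h0 := hy.sq.integral_eq_zero i1 hy2
  have : ∀ s, (a s - 2 * m * y s) ^ 2 = a s ^ 2 - 2 * m * (2 * y s * (a s - m * y s)) :=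
    fun s => by ring
  simp only [this]
  rw [integral_sub ha (i1.const_mul _), integral_const_mul, h0]
  ring

lemma IsPrim.integrable_sq_of_fluxZero (hm : m ≠ 0)
    (hW : IsPrim W fun s => Real.exp (m * s) * a s) (hf : FluxZero m W)
    (ha : Integrable fun s => a s ^ 2) :
    Integrable fun s => (Real.exp (-m * s) * W s) ^ 2 := by
  obtain ⟨C, hC⟩ := hW.exists_bound_of_fluxZero hm ha hf
  exact hW.expWeighted.integrable_sq hm ha hC

/-- For `m ≠ 0` the vanishing flux and the Hardy inequality put `y` in `L²`. For `m = 0` nothing of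
the kind is claimed, but then `a - 2my` is `a` itself, and only integrability of the middle
integrand has to be found; this takes `κ ≠ 0`. -/
theorem IsPrim.coreIdentities (ht : 2 ≤ t) (hmκ : m ≠ 0 ∨ κ ≠ 0)
    (hW : IsPrim W fun s => Real.exp (m * s) * a s) (hf : FluxZero m W)
    (ha : Integrable fun s => a s ^ 2)
    (hb : Integrable fun s =>
      |Real.exp (-m * s) * W s| ^ (2 * (t - 1)) * Real.exp (2 * κ * s)) :
    CoreIdentities t κ m (fun s => Real.exp (-m * s) * W s) a := by
  rcases eq_or_ne m 0 with hm | hm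
  · subst hm
    have hκ : κ ≠ 0 := by tauto
    have hy := hW.expWeighted
    have hy' : IsPrim (fun s => Real.exp (-0 * s) * W s) a := by simpa using hy
    have hP : MemLp (fun s => a s - 2 * 0 * (Real.exp (-0 * s) * W s)) 2 := by
      simpa using hy.memLp_of_sq ha
    have hQ := memLp_dualPow ht hy.continuous hb
    have hh := hy'.integrable_pow_exp_of_zero ht hκ ha hb
    exact ⟨hh, hP, hQ, by simp, hy.integral_mul_dualPow ht hh hP hQ⟩
  · exact hW.expWeighted.coreIdentities_of_integrable_sq ht ha
      (hW.integrable_sq_of_fluxZero hm hf ha) hb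

/-- Written as a quadratic in `c`, whose discriminant gives Cauchy–Schwarz and whose zero gives the
equality case. -/
lemma integral_sub_mul_sq {P Q : ℝ → ℝ} (hP : MemLp P 2) (hQ : MemLp Q 2) (c : ℝ) :
    ∫ s, (P s - c * Q s) ^ 2 =
      (∫ s, Q s ^ 2) * (c * c) + (-2 * ∫ s, P s * Q s) * c + ∫ s, P s ^ 2 := by
  have h1 : Integrable fun s => P s * Q s := hP.integrable_mul hQ
  have i1 : Integrable fun s => P s ^ 2 - 2 * c * (P s * Q s) :=
    hP.integrable_sq.sub (h1.const_mul _)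
  have e : ∀ s, (P s - c * Q s) ^ 2 = (P s ^ 2 - 2 * c * (P s * Q s)) + c * c * Q s ^ 2 :=
    fun s => by ring
  simp only [e]
  rw [integral_add i1 (hQ.integrable_sq.const_mul _),
    integral_sub hP.integrable_sq (h1.const_mul _), integral_const_mul, integral_const_mul]
  ring

lemma integral_mul_sq_le {P Q : ℝ → ℝ} (hP : MemLp P 2) (hQ : MemLp Q 2) :
    (∫ s, P s * Q s) ^ 2 ≤ (∫ s, P s ^ 2) * ∫ s, Q s ^ 2 := by
  have h2 : ∀ c : ℝ, 0 ≤ (∫ s, Q s ^ 2) * (c * c) + (-2 * ∫ s, P s * Q s) * c + ∫ s, P s ^ 2 := by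
    intro c
    rw [← integral_sub_mul_sq hP hQ]
    exact integral_nonneg fun s => sq_nonneg _
  have := discrim_le_zero h2
  unfold discrim at this
  nlinarith

lemma ae_eq_of_integral_mul_sq_eq {P Q : ℝ → ℝ} (hP : MemLp P 2) (hQ : MemLp Q 2)
    (hQ0 : 0 < ∫ s, Q s ^ 2)
    (h : (∫ s, P s * Q s) ^ 2 = (∫ s, P s ^ 2) * ∫ s, Q s ^ 2) :
    P =ᵐ[volume] fun s => (∫ r, P r * Q r) / (∫ r, Q r ^ 2) * Q s := by
  set c := (∫ r, P r * Q r) / (∫ r, Q r ^ 2) with hc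
  have i3 : Integrable fun s => (P s - c * Q s) ^ 2 := (hP.sub (hQ.const_mul c)).integrable_sq
  have h3 : ∫ s, (P s - c * Q s) ^ 2 = 0 := by
    rw [integral_sub_mul_sq hP hQ, hc]
    field_simp
    linarith
  rw [integral_eq_zero_iff_of_nonneg (fun s => sq_nonneg _) i3] at h3
  filter_upwards [h3] with s hs
  have : P s - c * Q s = 0 := by simpa using hs
  linarith

/-- Cauchy–Schwarz for `a - 2my` and `dualPow`, with the two integrals involving `a - 2my` evaluated
by the identities. -/
lemma CoreIdentities.sq_le (ht : 2 ≤ t) (h : CoreIdentities t κ m y a) :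
    ((κ + t * m) / t) ^ 2 * (∫ s, |y s| ^ t * Real.exp (κ * s)) ^ 2 ≤
      (∫ s, a s ^ 2) * ∫ s, |y s| ^ (2 * (t - 1)) * Real.exp (2 * κ * s) := by
  have h1 := integral_mul_sq_le h.memLp_left h.memLp_right
  have ht0 : t ≠ 0 := by linarith
  have h2 : ∫ s, (a s - 2 * m * y s) * dualPow t κ y s =
      -((κ + t * m) / t * ∫ s, |y s| ^ t * Real.exp (κ * s)) := by
    have := h.integral_mul
    field_simp
    linarith
  rw [h.integral_sq, h2] at h1
  simp only [dualPow_sq ht] at h1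
  linarith [h1]

end

/-! ### Logarithmic polar coordinates. -/

/-- The measure `e^{ns} ds` on the line. -/
def expMeasure (n : ℕ) : Measure ℝ :=
  volume.withDensity fun s => ENNReal.ofReal (Real.exp (n * s))

/-- The surface measure of the unit sphere. -/
abbrev sphereMeasure (n : ℕ) : Measure (Metric.sphere (0 : E n) 1) :=
  (volume : Measure (E n)).toSphere

instance (n : ℕ) : SFinite (expMeasure n) := by unfold expMeasure; infer_instance

/-- Logarithmic polar coordinates. -/
def polarMap (n : ℕ) (p : Metric.sphere (0 : E n) 1 × ℝ) : E n := Real.exp p.2 • (p.1 : E n)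

lemma norm_polarMap {n : ℕ} (p : Metric.sphere (0 : E n) 1 × ℝ) :
    ‖polarMap n p‖ = Real.exp p.2 := by
  simp [polarMap, norm_smul]

lemma log_norm_polarMap {n : ℕ} (p : Metric.sphere (0 : E n) 1 × ℝ) :
    Real.log ‖polarMap n p‖ = p.2 := by
  rw [norm_polarMap, Real.log_exp]

lemma continuous_polarMap (n : ℕ) : Continuous (polarMap n) := by
  unfold polarMap; fun_prop

/-- The substitution `r = e^s` turns `r^{n-1} dr` into `e^{ns} ds`. -/
lemma measurePreserving_exp {n : ℕ} (hn : 1 ≤ n) :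
    MeasurePreserving (Real.expOrderIso : ℝ → Ioi (0 : ℝ)) (expMeasure n)
      (Measure.volumeIoiPow (n - 1)) := by
  have hm : Measurable (Real.expOrderIso : ℝ → Ioi (0 : ℝ)) :=
    Real.expOrderIso.toHomeomorph.continuous.measurable
  refine ⟨hm, ?_⟩
  ext S hS
  rw [Measure.map_apply hm hS, expMeasure, withDensity_apply _ (hm hS), Measure.volumeIoiPow,
    withDensity_apply _ hS,
    setLIntegral_subtype measurableSet_Ioi _ fun a : ℝ ↦ ENNReal.ofReal (a ^ (n - 1))]
  have himg : (Subtype.val '' S : Set ℝ) = Real.exp '' (Real.expOrderIso ⁻¹' S) := by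
    ext r
    constructor
    · rintro ⟨⟨r, hr⟩, hrS, rfl⟩
      refine ⟨Real.log r, ?_, Real.exp_log hr⟩
      have : Real.expOrderIso (Real.log r) = ⟨r, hr⟩ := by
        ext; simp [Real.exp_log hr]
      simpa [this] using hrS
    · rintro ⟨s, hs, rfl⟩
      exact ⟨Real.expOrderIso s, hs, by simp⟩
  rw [himg, lintegral_image_eq_lintegral_abs_deriv_mul (hm hS)
    (fun x _ => (Real.hasDerivAt_exp x).hasDerivWithinAt) Real.exp_injective.injOn]
  refine lintegral_congr fun s => ?_
  rw [← ENNReal.ofReal_mul (abs_nonneg _), abs_of_pos (Real.exp_pos _), ← Real.exp_nat_mul,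
    ← Real.exp_add]
  congr 2
  -- The exponent is a truncated subtraction, which agrees with the real one because `1 ≤ n`.
  have : ((n - 1 : ℕ) : ℝ) = n - 1 := by push_cast [hn]; ring
  rw [this]; ring

lemma polarMap_eq_comp (n : ℕ) : polarMap n =
    Subtype.val ∘ ⇑(homeomorphUnitSphereProd (E n)).symm ∘ Prod.map id ⇑Real.expOrderIso := by
  funext p
  simp [polarMap]

lemma measurePreserving_polarMap {n : ℕ} (hn : 1 ≤ n) :
    MeasurePreserving (polarMap n) ((sphereMeasure n).prod (expMeasure n)) volume := by
  have h1 := (measurePreserving_exp hn)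
  have hfr : Module.finrank ℝ (E n) = n := by simp
  have h2 := (volume : Measure (E n)).measurePreserving_homeomorphUnitSphereProd
  rw [hfr] at h2
  have h2' := MeasurePreserving.symm (homeomorphUnitSphereProd (E n)).toMeasurableEquiv h2
  have h3 := (MeasurePreserving.id (sphereMeasure n)).prod h1
  have h4 : MeasurePreserving (Subtype.val : ({0}ᶜ : Set (E n)) → E n)
      ((volume : Measure (E n)).comap (↑)) volume := by
    refine ⟨measurable_subtype_coe, ?_⟩
    rw [map_comap_subtype_coe (measurableSet_singleton 0).compl]
    have : Nonempty (Fin n) := ⟨⟨0, hn⟩⟩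
    have : Nontrivial (E n) := inferInstance
    exact Measure.restrict_eq_self_of_ae_mem (by simp [ae_iff])
  have h5 := h4.comp (h2'.comp h3)
  rwa [polarMap_eq_comp]

/-- Being an embedding, and not merely measure preserving, lets integrability be transferred for
functions not assumed measurable. -/
lemma measurableEmbedding_polarMap (n : ℕ) : MeasurableEmbedding (polarMap n) := by
  have h1 : MeasurableEmbedding (Real.expOrderIso : ℝ → Ioi (0 : ℝ)) :=
    Real.expOrderIso.toHomeomorph.measurableEmbedding
  have h3 : MeasurableEmbedding (Prod.map (id : Metric.sphere (0 : E n) 1 → _)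
      (Real.expOrderIso : ℝ → Ioi (0 : ℝ))) := MeasurableEmbedding.id.prodMap h1
  have h2 := (homeomorphUnitSphereProd (E n)).symm.measurableEmbedding
  have h4 : MeasurableEmbedding (Subtype.val : ({0}ᶜ : Set (E n)) → E n) :=
    MeasurableEmbedding.subtype_coe (measurableSet_singleton 0).compl
  rw [polarMap_eq_comp]
  exact h4.comp (h2.comp h3)

lemma integrable_expMeasure_iff {n : ℕ} {g : ℝ → ℝ} :
    Integrable g (expMeasure n) ↔ Integrable fun s => Real.exp (n * s) * g s := by
  unfold expMeasure
  rw [integrable_withDensity_iff_integrable_smul₀' (by fun_prop) (by simp)]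
  simp [ENNReal.toReal_ofReal (Real.exp_pos _).le]

lemma integral_expMeasure {n : ℕ} (g : ℝ → ℝ) :
    ∫ s, g s ∂(expMeasure n) = ∫ s, Real.exp (n * s) * g s := by
  unfold expMeasure
  rw [integral_withDensity_eq_integral_toReal_smul (by fun_prop) (by simp)]
  simp [ENNReal.toReal_ofReal (Real.exp_pos _).le]

lemma volume_absolutelyContinuous_expMeasure (n : ℕ) : volume ≪ expMeasure n := by
  unfold expMeasure
  refine withDensity_absolutelyContinuous' (by fun_prop) (Eventually.of_forall fun s => ?_)
  simp [Real.exp_pos]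

lemma expMeasure_absolutelyContinuous (n : ℕ) : expMeasure n ≪ volume :=
  withDensity_absolutelyContinuous _ _

variable {n : ℕ}

lemma sphereMeasure_univ_ne_zero (hn : 1 ≤ n) : sphereMeasure n univ ≠ 0 := by
  have : Nonempty (Fin n) := ⟨⟨0, hn⟩⟩
  have : Nontrivial (E n) := inferInstance
  simp [-Measure.toSphere_apply_univ]

lemma sphereMeasure_univ_ne_top : sphereMeasure n univ ≠ ⊤ := measure_ne_top _ _

lemma map_log_norm (hn : 1 ≤ n) :
    (volume : Measure (E n)).map (fun x => Real.log ‖x‖) =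
      (sphereMeasure n univ) • expMeasure n := by
  rw [← (measurePreserving_polarMap hn).map_eq, Measure.map_map (by fun_prop)
    (continuous_polarMap n).measurable]
  have : ((fun x : E n => Real.log ‖x‖) ∘ polarMap n) = Prod.snd :=
    funext fun p => log_norm_polarMap p
  rw [this, Measure.map_snd_prod]

lemma lintegral_log_norm (hn : 1 ≤ n) {g : ℝ → ℝ≥0∞} (hg : Measurable g) :
    ∫⁻ x : E n, g (Real.log ‖x‖) =
      sphereMeasure n univ * ∫⁻ s, g s * ENNReal.ofReal (Real.exp (n * s)) := by
  have h1 := lintegral_map (μ := (volume : Measure (E n))) hg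
    (show Measurable fun x : E n => Real.log ‖x‖ by fun_prop)
  rw [← h1, map_log_norm hn, lintegral_smul_measure, expMeasure,
    lintegral_withDensity_eq_lintegral_mul _ (by fun_prop) hg, smul_eq_mul]
  simp [mul_comm]

lemma ae_comp_log_norm (hn : 1 ≤ n) {p : ℝ → Prop} (h : ∀ᵐ s, p s) :
    ∀ᵐ x : E n, p (Real.log ‖x‖) := by
  have h1 : ∀ᵐ s ∂((volume : Measure (E n)).map fun x => Real.log ‖x‖), p s := by
    rw [map_log_norm hn]
    exact Measure.ae_smul_measure ((expMeasure_absolutelyContinuous n).ae_le h) _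
  exact ae_of_ae_map (by fun_prop) h1

lemma integrable_comp_polarMap_iff (hn : 1 ≤ n) {F : E n → ℝ} :
    Integrable (fun p => F (polarMap n p)) ((sphereMeasure n).prod (expMeasure n)) ↔
      Integrable F :=
  (measurePreserving_polarMap hn).integrable_comp_emb (measurableEmbedding_polarMap n)

lemma integrable_sphere_integral (hn : 1 ≤ n) {F : E n → ℝ} (hF : Integrable F) :
    Integrable fun s => Real.exp (n * s) * ∫ θ, F (polarMap n (θ, s)) ∂(sphereMeasure n) := by
  have := ((integrable_comp_polarMap_iff hn).2 hF).integral_prod_right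
  exact integrable_expMeasure_iff.1 this

lemma integral_eq_polar (hn : 1 ≤ n) {F : E n → ℝ} (hF : Integrable F) :
    ∫ x, F x = ∫ s, Real.exp (n * s) * ∫ θ, F (polarMap n (θ, s)) ∂(sphereMeasure n) := by
  have h1 := (integrable_comp_polarMap_iff hn).2 hF
  rw [← (measurePreserving_polarMap hn).integral_comp (measurableEmbedding_polarMap n),
    integral_prod_symm _ h1, integral_expMeasure]

/-- The sphere is the outer variable here, so that one can integrate by parts along each ray. -/
lemma integral_eq_polar' (hn : 1 ≤ n) {F : E n → ℝ} (hF : Integrable F) :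
    ∫ x, F x = ∫ θ, (∫ s, Real.exp (n * s) * F (polarMap n (θ, s))) ∂(sphereMeasure n) := by
  have h1 := (integrable_comp_polarMap_iff hn).2 hF
  rw [← (measurePreserving_polarMap hn).integral_comp (measurableEmbedding_polarMap n),
    integral_prod _ h1]
  simp only [integral_expMeasure]

lemma integrable_comp_log_norm (hn : 1 ≤ n) {g : ℝ → ℝ}
    (h : Integrable fun s => Real.exp (n * s) * g s) :
    Integrable fun x : E n => g (Real.log ‖x‖) := by
  have h1 : Integrable g ((volume : Measure (E n)).map fun x => Real.log ‖x‖) := by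
    rw [map_log_norm hn]
    exact (integrable_expMeasure_iff.2 h).smul_measure sphereMeasure_univ_ne_top
  exact h1.comp_measurable (by fun_prop)

lemma integral_comp_log_norm (hn : 1 ≤ n) {g : ℝ → ℝ} (hg : Measurable g) :
    ∫ x : E n, g (Real.log ‖x‖) =
      (sphereMeasure n univ).toReal * ∫ s, Real.exp (n * s) * g s := by
  rw [← integral_map (μ := (volume : Measure (E n))) (φ := fun x => Real.log ‖x‖) (by fun_prop)
    hg.aestronglyMeasurable, map_log_norm hn, integral_smul_measure, integral_expMeasure,
    smul_eq_mul]

/-! ### Integration by parts and Green's identity against test functions. -/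

lemma integrable_mul_of_tsupport_subset {f ψ : E n → ℝ} {Ω : Set (E n)}
    (hf : LocallyIntegrableOn f Ω) (hψ : Continuous ψ) (hc : HasCompactSupport ψ)
    (hs : tsupport ψ ⊆ Ω) : Integrable fun x => f x * ψ x := by
  have h1 : IntegrableOn f (tsupport ψ) := hf.integrableOn_compact_subset hs hc
  have h2 : IntegrableOn (fun x => f x * ψ x) (tsupport ψ) :=
    h1.mul_continuousOn hψ.continuousOn hc
  refine (integrableOn_iff_integrable_of_support_subset fun x hx => ?_).1 h2
  exact subset_tsupport ψ fun h => hx (by simp [h])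

lemma locallyIntegrableOn_inner {G : E n → E n} {Ω : Set (E n)}
    (hG : LocallyIntegrableOn G Ω) (e : E n) :
    LocallyIntegrableOn (fun x => inner ℝ (G x) e) Ω := by
  intro x hx
  obtain ⟨S, hS, hi⟩ := hG x hx
  exact ⟨S, hS, Integrable.inner_const hi e⟩

lemma isOpen_compl_zero : IsOpen ({0}ᶜ : Set (E n)) := isOpen_compl_singleton

lemma _root_.ContinuousOn.locallyIntegrableOn_compl_zero {V : Type*} [NormedAddCommGroup V]
    {f : E n → V} (hf : ContinuousOn f {0}ᶜ) : LocallyIntegrableOn f {0}ᶜ :=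
  hf.locallyIntegrableOn (measurableSet_singleton 0).compl

/-- Integration by parts on an open set. -/
lemma integral_mul_fderiv_eq_neg {g ψ : E n → ℝ} {G : E n → E n} {Ω : Set (E n)}
    (hΩ : MeasurableSet Ω)
    (hg : ∀ x ∈ Ω, HasFDerivAt g (innerSL ℝ (G x)) x) (hG : ContinuousOn G Ω)
    (hψ : ContDiff ℝ 1 ψ) (hc : HasCompactSupport ψ) (hs : tsupport ψ ⊆ Ω) (e : E n) :
    ∫ x, g x * fderiv ℝ ψ x e = -∫ x, inner ℝ (G x) e * ψ x := by
  have hgc : ContinuousOn g Ω := fun x hx => (hg x hx).continuousAt.continuousWithinAt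
  have hgl : LocallyIntegrableOn g Ω := hgc.locallyIntegrableOn hΩ
  have hGl := locallyIntegrableOn_inner (hG.locallyIntegrableOn (μ := volume) hΩ) e
  have hd : Continuous fun x => fderiv ℝ ψ x e :=
    (hψ.continuous_fderiv (by norm_num)).clm_apply continuous_const
  have hdc : HasCompactSupport fun x => fderiv ℝ ψ x e := hc.fderiv_apply (𝕜 := ℝ) e
  have hds : tsupport (fun x => fderiv ℝ ψ x e) ⊆ Ω :=
    (tsupport_fderiv_apply_subset ℝ e).trans hs
  have e1 : ∀ x, fderiv ℝ g x e * ψ x = inner ℝ (G x) e * ψ x := fun x => by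
    by_cases hx : x ∈ tsupport ψ
    · rw [(hg x (hs hx)).fderiv]; simp
    · simp [image_eq_zero_of_notMem_tsupport hx]
  have i1 := integrable_mul_of_tsupport_subset hGl hψ.continuous hc hs
  rw [integral_mul_fderiv_eq_neg_fderiv_mul_of_integrable]
  · simp only [e1]
  · simpa only [e1] using i1
  · exact integrable_mul_of_tsupport_subset hgl hd hdc hds
  · exact integrable_mul_of_tsupport_subset hgl hψ.continuous hc hs
  · exact fun x hx => (hg x (hs hx)).differentiableAt
  · exact fun x _ => (hψ.differentiable (by norm_num)) x

lemma laplacian_eq_sum {ψ : E n → ℝ} (hψ : ContDiff ℝ 2 ψ) (x : E n) :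
    Δ ψ x = ∑ i, fderiv ℝ (fun z => fderiv ℝ ψ z (EuclideanSpace.basisFun (Fin n) ℝ i)) x
      (EuclideanSpace.basisFun (Fin n) ℝ i) := by
  rw [congrFun (InnerProductSpace.laplacian_eq_iteratedFDeriv_orthonormalBasis ψ
    (EuclideanSpace.basisFun (Fin n) ℝ)) x]
  refine Finset.sum_congr rfl fun i _ => ?_
  rw [iteratedFDeriv_two_apply]
  have hd : DifferentiableAt ℝ (fderiv ℝ ψ) x :=
    ((hψ.fderiv_right (m := 1) (by norm_num)).differentiable (by norm_num)) x
  rw [fderiv_clm_apply hd (differentiableAt_const _)]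
  simp

lemma continuous_laplacian {ψ : E n → ℝ} (hψ : ContDiff ℝ ∞ ψ) : Continuous (Δ ψ) := by
  have h2 : ContDiff ℝ 2 ψ := contDiff_infty.1 hψ 2
  rw [show Δ ψ = _ from funext (laplacian_eq_sum h2)]
  refine continuous_finsetSum _ fun i _ => ?_
  have h1 : ContDiff ℝ 1 (fun z => fderiv ℝ ψ z (EuclideanSpace.basisFun (Fin n) ℝ i)) :=
    (h2.fderiv_right (m := 1) (by norm_num)).clm_apply contDiff_const
  exact (h1.continuous_fderiv (by norm_num)).clm_apply continuous_const

lemma tsupport_laplacian_subset {ψ : E n → ℝ} : tsupport (Δ ψ) ⊆ tsupport ψ := by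
  refine closure_minimal (fun x hx => ?_) (isClosed_tsupport ψ)
  by_contra h
  have h1 : ψ =ᶠ[𝓝 x] fun _ => 0 := notMem_tsupport_iff_eventuallyEq.1 h
  have h2 := InnerProductSpace.laplacian_congr_nhds h1
  apply hx
  rw [h2.self_of_nhds]
  exact congrFun (InnerProductSpace.laplacian_const) x

lemma hasCompactSupport_laplacian {ψ : E n → ℝ} (hc : HasCompactSupport ψ) :
    HasCompactSupport (Δ ψ) :=
  hc.of_isClosed_subset (isClosed_tsupport _) tsupport_laplacian_subset

/-- Green's identity on an open set. -/
lemma integral_mul_laplacian_eq_neg {g ψ : E n → ℝ} {G : E n → E n} {Ω : Set (E n)}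
    (hΩ : MeasurableSet Ω)
    (hg : ∀ x ∈ Ω, HasFDerivAt g (innerSL ℝ (G x)) x) (hG : ContinuousOn G Ω)
    (hψ : ContDiff ℝ ∞ ψ) (hc : HasCompactSupport ψ) (hs : tsupport ψ ⊆ Ω) :
    ∫ x, g x * Δ ψ x = -∫ x, fderiv ℝ ψ x (G x) := by
  have h2 : ContDiff ℝ 2 ψ := contDiff_infty.1 hψ 2
  set b := EuclideanSpace.basisFun (Fin n) ℝ with hb
  have hgc : ContinuousOn g Ω := fun x hx => (hg x hx).continuousAt.continuousWithinAt
  have hgl : LocallyIntegrableOn g Ω := hgc.locallyIntegrableOn hΩ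
  have hD1 : ∀ i, ContDiff ℝ 1 (fun z => fderiv ℝ ψ z (b i)) := fun i =>
    (h2.fderiv_right (m := 1) (by norm_num)).clm_apply contDiff_const
  have hDc : ∀ i, HasCompactSupport (fun z => fderiv ℝ ψ z (b i)) := fun i =>
    hc.fderiv_apply (𝕜 := ℝ) (b i)
  have hDs : ∀ i, tsupport (fun z => fderiv ℝ ψ z (b i)) ⊆ Ω := fun i =>
    (tsupport_fderiv_apply_subset ℝ (b i)).trans hs
  have key := fun i => integral_mul_fderiv_eq_neg hΩ hg hG (hD1 i) (hDc i) (hDs i) (b i)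
  have e1 : ∀ x, g x * Δ ψ x =
      ∑ i, g x * fderiv ℝ (fun z => fderiv ℝ ψ z (b i)) x (b i) := fun x => by
    rw [laplacian_eq_sum h2, Finset.mul_sum]
  have e2 : ∀ x, fderiv ℝ ψ x (G x) = ∑ i, inner ℝ (G x) (b i) * fderiv ℝ ψ x (b i) := fun x => by
    conv_lhs => rw [← b.sum_repr' (G x)]
    rw [map_sum]
    refine Finset.sum_congr rfl fun i _ => ?_
    rw [map_smul, smul_eq_mul, real_inner_comm]
  simp only [e1, e2]
  rw [integral_finsetSum, integral_finsetSum]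
  · simp only [key, Finset.sum_neg_distrib]
  · exact fun i _ => integrable_mul_of_tsupport_subset
      (locallyIntegrableOn_inner (hG.locallyIntegrableOn (μ := volume) hΩ) (b i))
      (hD1 i).continuous (hDc i) (hDs i)
  · intro i _
    refine integrable_mul_of_tsupport_subset hgl
      (((hD1 i).continuous_fderiv (by norm_num)).clm_apply continuous_const)
      ((hDc i).fderiv_apply (𝕜 := ℝ) (b i))
      ((tsupport_fderiv_apply_subset ℝ (b i)).trans (hDs i))

/-! ### Radial functions in the variable `log |x|` and their distributional derivatives. -/

lemma hasFDerivAt_log_norm {x : E n} (hx : x ≠ 0) :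
    HasFDerivAt (fun x : E n => Real.log ‖x‖) ((‖x‖ ^ 2)⁻¹ • innerSL ℝ x) x := by
  have h1 := ((hasStrictFDerivAt_norm_sq x).hasFDerivAt.log
    (by simpa using hx)).const_mul (1 / 2 : ℝ)
  have e : (fun x : E n => Real.log ‖x‖) = fun x => (1 / 2 : ℝ) * Real.log (‖x‖ ^ 2) := by
    funext z; rw [Real.log_pow]; push_cast; ring
  rw [e]
  refine h1.congr_fderiv ?_
  ext v
  simp
  ring

lemma continuousOn_log_norm : ContinuousOn (fun x : E n => Real.log ‖x‖) {0}ᶜ :=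
  fun _ hx => (hasFDerivAt_log_norm hx).continuousAt.continuousWithinAt

lemma contDiffAt_log_norm {x : E n} (hx : x ≠ 0) :
    ContDiffAt ℝ ∞ (fun x : E n => Real.log ‖x‖) x :=
  (contDiffAt_norm ℝ hx).log (by simpa using hx)

lemma exists_log_norm_mem_Icc {K : Set (E n)} (hK : IsCompact K) (h0 : K ⊆ {0}ᶜ) :
    ∃ a b : ℝ, ∀ x ∈ K, Real.log ‖x‖ ∈ Icc a b := by
  have h1 : IsCompact ((fun x : E n => Real.log ‖x‖) '' K) :=
    hK.image_of_continuousOn (continuousOn_log_norm.mono h0)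
  obtain ⟨a, ha⟩ := h1.bddBelow
  obtain ⟨b, hb⟩ := h1.bddAbove
  exact ⟨a, b, fun x hx => ⟨ha (mem_image_of_mem _ hx), hb (mem_image_of_mem _ hx)⟩⟩

/-- The profile `w` of a radial function in the variable `s = log |x|`, with flux
`W = e^{(n-2)s} w'` and Laplacian `ℓ = e^{-ns} W'`. -/
structure RadialData (n : ℕ) (w W l : ℝ → ℝ) : Prop where
  measurable : Measurable l
  hasDerivAt : ∀ s, HasDerivAt w (Real.exp (-(n - 2) * s) * W s) s
  isPrim : IsPrim W fun s => Real.exp (n * s) * l s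

/-- The gradient of the radial function with flux `W`. -/
def radGrad (W : ℝ → ℝ) (x : E n) : E n :=
  (W (Real.log ‖x‖) * Real.exp (-n * Real.log ‖x‖)) • x

lemma continuousOn_radGrad {W : ℝ → ℝ} (hW : Continuous W) :
    ContinuousOn (radGrad W : E n → E n) {0}ᶜ := by
  unfold radGrad
  have h := continuousOn_log_norm (n := n)
  have h1 := hW.comp_continuousOn h
  fun_prop

lemma norm_sq_eq_exp {x : E n} (hx : x ≠ 0) : ‖x‖ ^ 2 = Real.exp (2 * Real.log ‖x‖) := by
  have h : 0 < ‖x‖ := norm_pos_iff.2 hx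
  rw [show (2 : ℝ) = (2 : ℕ) by norm_num, Real.exp_nat_mul, Real.exp_log h]

lemma RadialData.hasFDerivAt {w W l : ℝ → ℝ} (h : RadialData n w W l) {x : E n} (hx : x ≠ 0) :
    HasFDerivAt (fun x : E n => w (Real.log ‖x‖)) (innerSL ℝ (radGrad W x)) x := by
  have h1 := (h.hasDerivAt (Real.log ‖x‖)).comp_hasFDerivAt x (hasFDerivAt_log_norm hx)
  refine h1.congr_fderiv ?_
  ext v
  simp only [radGrad, map_smul, smul_apply, innerSL_apply_apply, smul_eq_mul]
  rw [norm_sq_eq_exp hx, ← Real.exp_neg]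
  rw [show -(n : ℝ) * Real.log ‖x‖ = -(n - 2) * Real.log ‖x‖ + -(2 * Real.log ‖x‖) by ring,
    Real.exp_add]
  ring

lemma RadialData.locallyIntegrable {w W l : ℝ → ℝ} (h : RadialData n w W l) :
    LocallyIntegrable l := by
  refine locallyIntegrable_of_intervalIntegrable fun a b => ?_
  have h1 := (h.isPrim.intervalIntegrable a b).continuousOn_mul
    (g := fun s => Real.exp (-(n * s))) (by fun_prop)
  refine h1.congr (fun s _ => ?_)
  rw [← mul_assoc, ← Real.exp_add]; simp

lemma locallyIntegrableOn_comp_log_norm (hn : 1 ≤ n) {l : ℝ → ℝ} (hl : LocallyIntegrable l) :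
    LocallyIntegrableOn (fun x : E n => l (Real.log ‖x‖)) {0}ᶜ := by
  rw [locallyIntegrableOn_iff isOpen_compl_zero.isLocallyClosed]
  intro K hK hKc
  obtain ⟨a, b, hab⟩ := exists_log_norm_mem_Icc hKc hK
  have h1 : Integrable fun s => Real.exp (n * s) * (Icc a b).indicator l s := by
    have : IntegrableOn (fun s => Real.exp (n * s) * l s) (Icc a b) :=
      (hl.integrableOn_isCompact isCompact_Icc).continuousOn_mul (by fun_prop) isCompact_Icc
    refine (this.integrable_indicator measurableSet_Icc).congr (Eventually.of_forall fun s => ?_)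
    by_cases hs : s ∈ Icc a b <;> simp [hs]
  have h2 := (integrable_comp_log_norm hn h1).integrableOn (s := K)
  refine h2.congr_fun (fun x hx => ?_) hKc.measurableSet
  simp [indicator_of_mem (hab x hx)]

lemma hasCompactSupport_slice {ψ : E n → ℝ} (hc : HasCompactSupport ψ)
    (hs : tsupport ψ ⊆ {0}ᶜ) (θ : Metric.sphere (0 : E n) 1) :
    HasCompactSupport fun s => ψ (polarMap n (θ, s)) := by
  obtain ⟨a, b, hab⟩ := exists_log_norm_mem_Icc hc hs
  refine HasCompactSupport.of_support_subset_isCompact (isCompact_Icc (a := a) (b := b))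
    fun s hs' => ?_
  have := hab _ (subset_tsupport ψ hs')
  rwa [log_norm_polarMap] at this

/-- A radial function has the expected distributional derivatives. -/
theorem RadialData.hasWeakGradient {w W l : ℝ → ℝ} (h : RadialData n w W l) :
    HasWeakGradient (fun x : E n => w (Real.log ‖x‖)) (radGrad W) := by
  have hG := continuousOn_radGrad (n := n) h.isPrim.continuous
  refine ⟨?_, hG.locallyIntegrableOn_compl_zero, fun ψ hψ hs e => ?_⟩
  · refine ContinuousOn.locallyIntegrableOn_compl_zero fun x hx => ?_
    exact (h.hasFDerivAt hx).continuousAt.continuousWithinAt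
  · exact integral_mul_fderiv_eq_neg isOpen_compl_zero.measurableSet
      (fun x hx => h.hasFDerivAt hx) hG (hψ.1.of_le (by exact_mod_cast le_top)) hψ.2 hs e

/-- The flux is only absolutely continuous, so one derivative is moved by Green's identity. On the
ray through `θ`, the density `e^{ns} ∇u·∇ψ` is `W` times the `s`-derivative of `ψ(e^s θ)`, and the
second derivative is moved by parts in `s`. -/
theorem RadialData.hasWeakLaplacian (hn : 1 ≤ n) {w W l : ℝ → ℝ} (h : RadialData n w W l) :
    HasWeakLaplacian (fun x : E n => w (Real.log ‖x‖)) (fun x => l (Real.log ‖x‖)) := by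
  have hG := continuousOn_radGrad (n := n) h.isPrim.continuous
  have hL := locallyIntegrableOn_comp_log_norm hn h.locallyIntegrable
  refine ⟨h.hasWeakGradient.1, hL, fun ψ hψ hs => ?_⟩
  rw [integral_mul_laplacian_eq_neg isOpen_compl_zero.measurableSet
      (fun x hx => h.hasFDerivAt hx) hG hψ.1 hψ.2 hs]
  have hd : Continuous (fderiv ℝ ψ) := hψ.1.continuous_fderiv (by simp)
  have i1 : Integrable fun x => fderiv ℝ ψ x (radGrad W x) := by
    have h1 : ContinuousOn (fun x => fderiv ℝ ψ x (radGrad W x)) {0}ᶜ :=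
      hd.continuousOn.clm_apply hG
    have h2 : IntegrableOn (fun x => fderiv ℝ ψ x (radGrad W x)) (tsupport ψ) :=
      (h1.mono hs).integrableOn_compact hψ.2
    refine (integrableOn_iff_integrable_of_support_subset fun x hx => ?_).1 h2
    by_contra hx'
    apply hx
    have : fderiv ℝ ψ x = 0 := image_eq_zero_of_notMem_tsupport
      fun hh => hx' (tsupport_fderiv_subset ℝ hh)
    simp [this]
  have i2 := integrable_mul_of_tsupport_subset hL hψ.1.continuous hψ.2 hs
  rw [integral_eq_polar' hn i1, integral_eq_polar' hn i2, ← integral_neg]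
  refine integral_congr_ae (Eventually.of_forall fun θ => ?_)
  simp only
  have hder : ∀ s, HasDerivAt (fun s => ψ (polarMap n (θ, s)))
      (fderiv ℝ ψ (polarMap n (θ, s)) (polarMap n (θ, s))) s := fun s => by
    have h1 : HasDerivAt (fun s => polarMap n (θ, s)) (polarMap n (θ, s)) s := by
      unfold polarMap
      exact (Real.hasDerivAt_exp s).smul_const (θ : E n)
    exact ((hψ.1.differentiable (by simp)) _).hasFDerivAt.comp_hasDerivAt s h1
  have hcp : Continuous fun s => polarMap n (θ, s) :=
    (continuous_polarMap n).comp (by fun_prop)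
  have hI := h.isPrim.integral_mul_deriv hder ((hd.comp hcp).clm_apply hcp)
    (hasCompactSupport_slice hψ.2 hs θ)
  have e1 : ∀ s, Real.exp (n * s) * fderiv ℝ ψ (polarMap n (θ, s)) (radGrad W (polarMap n (θ, s)))
      = W s * fderiv ℝ ψ (polarMap n (θ, s)) (polarMap n (θ, s)) := fun s => by
    unfold radGrad
    rw [log_norm_polarMap, map_smul, smul_eq_mul]
    have : Real.exp (n * s) * Real.exp (-n * s) = 1 := by rw [← Real.exp_add]; simp
    simp only
    calc _ = (Real.exp (n * s) * Real.exp (-n * s)) *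
        (W s * fderiv ℝ ψ (polarMap n (θ, s)) (polarMap n (θ, s))) := by ring
      _ = _ := by rw [this, one_mul]
  simp only [e1, hI, neg_neg, log_norm_polarMap]
  refine integral_congr_ae (Eventually.of_forall fun s => ?_)
  simp only; ring

/-! ### Uniqueness of weak derivatives, and radial test functions. -/

lemma ae_ne_zero (hn : 1 ≤ n) : ∀ᵐ x : E n, x ≠ 0 := by
  have : Nonempty (Fin n) := ⟨⟨0, hn⟩⟩
  have : Nontrivial (E n) := inferInstance
  simp [ae_iff]

lemma ae_eq_of_forall_integral_mul_eq (hn : 1 ≤ n) {f g : E n → ℝ}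
    (hf : LocallyIntegrableOn f {0}ᶜ) (hg : LocallyIntegrableOn g {0}ᶜ)
    (h : ∀ ψ : E n → ℝ, IsTest ψ → tsupport ψ ⊆ {0}ᶜ → ∫ x, f x * ψ x = ∫ x, g x * ψ x) :
    f =ᵐ[volume] g := by
  have key := isOpen_compl_zero.ae_eq_zero_of_integral_contDiff_smul_eq_zero (μ := volume)
    (hf.sub hg) (fun ψ h1 h2 h3 => by
      have e : ∀ x, ψ x • (f - g) x = f x * ψ x - g x * ψ x := fun x => by
        simp only [Pi.sub_apply, smul_eq_mul]; ring
      simp only [e]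
      rw [integral_sub (integrable_mul_of_tsupport_subset hf h1.continuous h2 h3)
        (integrable_mul_of_tsupport_subset hg h1.continuous h2 h3), h ψ ⟨h1, h2⟩ h3, sub_self])
  filter_upwards [key, ae_ne_zero hn] with x hx h0
  have := hx h0
  simp only [Pi.sub_apply] at this
  linarith

lemma HasWeakLaplacian.ae_eq (hn : 1 ≤ n) {u u' L L' : E n → ℝ} (h : HasWeakLaplacian u L)
    (h' : HasWeakLaplacian u' L') (hu : u =ᵐ[volume] u') : L =ᵐ[volume] L' := by
  refine ae_eq_of_forall_integral_mul_eq hn h.2.1 h'.2.1 fun ψ hψ hs => ?_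
  rw [← h.2.2 ψ hψ hs, ← h'.2.2 ψ hψ hs]
  exact integral_congr_ae (hu.mono fun x hx => by simp only [hx])

lemma HasWeakGradient.ae_eq (hn : 1 ≤ n) {u u' : E n → ℝ} {G G' : E n → E n}
    (h : HasWeakGradient u G)
    (h' : HasWeakGradient u' G') (hu : u =ᵐ[volume] u') : G =ᵐ[volume] G' := by
  have key : ∀ e : E n, (fun x => inner ℝ (G x) e) =ᵐ[volume] fun x => inner ℝ (G' x) e := by
    intro e
    refine ae_eq_of_forall_integral_mul_eq hn (locallyIntegrableOn_inner h.2.1 e)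
      (locallyIntegrableOn_inner h'.2.1 e) fun ψ hψ hs => ?_
    have h1 := h.2.2 ψ hψ hs e
    have h2 := h'.2.2 ψ hψ hs e
    have h3 : ∫ x, u x * fderiv ℝ ψ x e = ∫ x, u' x * fderiv ℝ ψ x e :=
      integral_congr_ae (hu.mono fun x hx => by simp only [hx])
    linarith
  have key2 : ∀ᵐ x, ∀ i, inner ℝ (G x) (EuclideanSpace.basisFun (Fin n) ℝ i) =
      inner ℝ (G' x) (EuclideanSpace.basisFun (Fin n) ℝ i) := ae_all_iff.2 fun i => key _
  filter_upwards [key2] with x hx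
  ext i
  simpa [EuclideanSpace.inner_single_right] using hx i

lemma hasFDerivAt_gradient {φ : E n → ℝ} (hφ : ContDiff ℝ ∞ φ) (x : E n) :
    HasFDerivAt φ (innerSL ℝ (∇ φ x)) x := by
  have h := ((hφ.differentiable (by simp)) x).hasGradientAt.hasFDerivAt
  exact h

lemma continuous_gradient {φ : E n → ℝ} (hφ : ContDiff ℝ ∞ φ) : Continuous (∇ φ) :=
  (InnerProductSpace.toDual ℝ (E n)).symm.continuous.comp (hφ.continuous_fderiv (by simp))

/-- Only one factor has compact support: the identity is later used with `Φ` a constant or `cutoff`.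
-/
lemma integral_mul_laplacian_test {Φ φ : E n → ℝ} (hΦ : ContDiff ℝ ∞ Φ) (hφ : IsTest φ) :
    ∫ x, Φ x * Δ φ x = -∫ x, inner ℝ (∇ Φ x) (∇ φ x) := by
  rw [integral_mul_laplacian_eq_neg (Ω := univ) MeasurableSet.univ
    (fun x _ => hasFDerivAt_gradient hΦ x) (continuous_gradient hΦ).continuousOn hφ.1 hφ.2
    (subset_univ _)]
  congr 1
  refine integral_congr_ae (Eventually.of_forall fun x => ?_)
  simp only
  rw [(hasFDerivAt_gradient hφ.1 x).fderiv, innerSL_apply_apply, real_inner_comm]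

lemma IsTest.hasWeakGradient {φ : E n → ℝ} (hφ : IsTest φ) : HasWeakGradient φ (∇ φ) := by
  refine ⟨hφ.1.continuous.continuousOn.locallyIntegrableOn_compl_zero,
    (continuous_gradient hφ.1).continuousOn.locallyIntegrableOn_compl_zero, fun ψ hψ _ e => ?_⟩
  exact integral_mul_fderiv_eq_neg (Ω := univ) MeasurableSet.univ
    (fun x _ => hasFDerivAt_gradient hφ.1 x) (continuous_gradient hφ.1).continuousOn
    (hψ.1.of_le (by exact_mod_cast le_top)) hψ.2 (subset_univ _) e

lemma IsTest.hasWeakLaplacian {φ : E n → ℝ} (hφ : IsTest φ) : HasWeakLaplacian φ (Δ φ) := by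
  refine ⟨hφ.1.continuous.continuousOn.locallyIntegrableOn_compl_zero,
    (continuous_laplacian hφ.1).continuousOn.locallyIntegrableOn_compl_zero, fun ψ hψ _ => ?_⟩
  have h1 := integral_mul_laplacian_test hφ.1 hψ
  have h2 := integral_mul_laplacian_test hψ.1 hφ
  simp only [real_inner_comm] at h1 h2
  rw [h1]
  simp only [mul_comm] at h2 ⊢
  rw [h2]

/-- The radial function with profile `η` in `log |x|` and value `c` at the origin. -/
def radExt (c : ℝ) (η : ℝ → ℝ) (x : E n) : ℝ :=
  open Classical in if x = 0 then c else η (Real.log ‖x‖)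

lemma radExt_ae_eq (hn : 1 ≤ n) (c : ℝ) (η : ℝ → ℝ) :
    (radExt c η : E n → ℝ) =ᵐ[volume] fun x => η (Real.log ‖x‖) := by
  filter_upwards [ae_ne_zero hn] with x hx
  simp [radExt, hx]

lemma radExt_eq_of_norm_lt {c a : ℝ} {η : ℝ → ℝ} (ha : ∀ s ≤ a, η s = c) {x : E n}
    (hx : ‖x‖ < Real.exp a) : radExt c η x = c := by
  unfold radExt
  split_ifs with h
  · rfl
  · exact ha _ ((Real.log_le_iff_le_exp (norm_pos_iff.2 h)).2 hx.le)

/-- A profile constant near `s = -∞` gives a function constant near the origin. The value at the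
origin has to be prescribed, since the convention `log 0 = 0` would put `η 0` there. -/
lemma contDiff_radExt {c a : ℝ} {η : ℝ → ℝ} (hη : ContDiff ℝ ∞ η) (ha : ∀ s ≤ a, η s = c) :
    ContDiff ℝ ∞ (radExt c η : E n → ℝ) := by
  rw [contDiff_iff_contDiffAt]
  intro x
  rcases eq_or_ne x 0 with rfl | hx
  · have : (radExt c η : E n → ℝ) =ᶠ[𝓝 0] fun _ => c := by
      filter_upwards [Metric.ball_mem_nhds (0 : E n) (Real.exp_pos a)] with z hz
      exact radExt_eq_of_norm_lt ha (by simpa using hz)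
    exact contDiffAt_const.congr_of_eventuallyEq this
  · have : (radExt c η : E n → ℝ) =ᶠ[𝓝 x] fun z => η (Real.log ‖z‖) := by
      filter_upwards [isOpen_compl_zero.mem_nhds (show x ∈ ({0}ᶜ : Set (E n)) from hx)] with z hz
      have hz' : z ≠ 0 := hz
      simp [radExt, hz']
    exact (hη.contDiffAt.comp x (contDiffAt_log_norm hx)).congr_of_eventuallyEq this

lemma isTest_radExt {c a b : ℝ} {η : ℝ → ℝ} (hη : ContDiff ℝ ∞ η) (ha : ∀ s ≤ a, η s = c)
    (hb : ∀ s, b ≤ s → η s = 0) : IsTest (radExt c η : E n → ℝ) := by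
  refine ⟨contDiff_radExt hη ha, ?_⟩
  refine HasCompactSupport.of_support_subset_isCompact
    (isCompact_closedBall (0 : E n) (Real.exp b)) fun x hx => ?_
  by_contra hcon
  apply hx
  simp only [Metric.mem_closedBall, dist_zero_right, not_le] at hcon
  have h0 : x ≠ 0 := by
    rintro rfl
    simp only [norm_zero] at hcon
    exact absurd hcon (Real.exp_pos b).not_gt
  simp only [radExt, h0, if_false]
  exact hb _ ((Real.le_log_iff_exp_le (norm_pos_iff.2 h0)).2 hcon.le)

lemma tsupport_radExt_subset {a : ℝ} {η : ℝ → ℝ} (ha : ∀ s ≤ a, η s = 0) :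
    tsupport (radExt 0 η : E n → ℝ) ⊆ {0}ᶜ := by
  intro x hx h0
  obtain rfl : x = 0 := h0
  refine notMem_tsupport_iff_eventuallyEq.2 ?_ hx
  filter_upwards [Metric.ball_mem_nhds (0 : E n) (Real.exp_pos a)] with z hz
  exact radExt_eq_of_norm_lt ha (by simpa using hz)

/-! ### Distributional solutions of a second order equation on the line. -/

lemma exists_bounds_of_hasCompactSupport {η : ℝ → ℝ} (h : HasCompactSupport η) :
    ∃ R, 0 < R ∧ (∀ s, s ≤ -R → η s = 0) ∧ ∀ s, R ≤ s → η s = 0 := by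
  obtain ⟨R, hR⟩ := h.isCompact.isBounded.subset_closedBall (0 : ℝ)
  have key : ∀ s, |R| + 1 ≤ |s| → η s = 0 := fun s hs => by
    refine image_eq_zero_of_notMem_tsupport fun hs' => ?_
    have := hR hs'
    simp only [Metric.mem_closedBall, dist_zero_right, Real.norm_eq_abs] at this
    linarith [le_abs_self R]
  refine ⟨|R| + 1, by positivity, fun s hs => key s ?_, fun s hs => key s ?_⟩
  · exact le_abs.2 (Or.inr (by linarith))
  · exact le_abs.2 (Or.inl hs)

lemma exists_primitive_test {θ : ℝ → ℝ} (hθ : ContDiff ℝ ∞ θ) (hc : HasCompactSupport θ)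
    (h0 : ∫ s, θ s = 0) :
    ∃ Θ : ℝ → ℝ, ContDiff ℝ ∞ Θ ∧ HasCompactSupport Θ ∧ ∀ s, HasDerivAt Θ (θ s) s := by
  obtain ⟨R, hR0, hR1, hR2⟩ := exists_bounds_of_hasCompactSupport hc
  have hder : ∀ s, HasDerivAt (fun s => ∫ r in (-R)..s, θ r) (θ s) s := fun s =>
    intervalIntegral.integral_hasDerivAt_right (hθ.continuous.intervalIntegrable _ _)
      (hθ.continuous.stronglyMeasurableAtFilter _ _) hθ.continuous.continuousAt
  refine ⟨fun s => ∫ r in (-R)..s, θ r, ?_, ?_, hder⟩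
  · rw [contDiff_infty_iff_deriv]
    refine ⟨fun s => (hder s).differentiableAt, ?_⟩
    rwa [show deriv (fun s => ∫ r in (-R)..s, θ r) = θ from funext fun s => (hder s).deriv]
  · refine HasCompactSupport.of_support_subset_isCompact (isCompact_Icc (a := -R) (b := R))
      fun s hs => ?_
    by_contra hcon
    apply hs
    rw [mem_Icc, not_and_or, not_le, not_le] at hcon
    rcases hcon with h | h
    · simp only
      rw [intervalIntegral.integral_congr (g := fun _ => 0)]
      · simp
      · intro r hr
        rw [uIcc_of_ge h.le] at hr
        exact hR1 r hr.2
    · simp only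
      rw [intervalIntegral.integral_of_le (by linarith), ← h0]
      refine setIntegral_eq_integral_of_forall_compl_eq_zero fun r hr => ?_
      rw [mem_Ioc, not_and_or, not_lt, not_le] at hr
      rcases hr with h' | h'
      · exact hR1 r h'
      · exact hR2 r (by linarith)

/-- The space of test functions on the line. -/
def testSpace : Submodule ℝ (ℝ → ℝ) where
  carrier := {θ | ContDiff ℝ ∞ θ ∧ HasCompactSupport θ}
  add_mem' ha hb := ⟨ha.1.add hb.1, ha.2.add hb.2⟩
  zero_mem' := ⟨contDiff_const, HasCompactSupport.zero⟩
  smul_mem' _ _ h := ⟨contDiff_const.smul h.1, h.2.smul_left⟩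

/-- Integration of test functions against a locally integrable function. -/
def testPairing (f : ℝ → ℝ) (hf : LocallyIntegrable f) : testSpace →ₗ[ℝ] ℝ where
  toFun θ := ∫ s, f s * (θ : ℝ → ℝ) s
  map_add' a b := by
    have h : ∀ θ : testSpace, Integrable fun s => f s * (θ : ℝ → ℝ) s := fun θ => by
      simpa using hf.integrable_smul_right_of_hasCompactSupport θ.2.1.continuous θ.2.2
    rw [← integral_add (h a) (h b)]
    simp [mul_add]
  map_smul' c a := by
    rw [RingHom.id_apply, smul_eq_mul, ← integral_const_mul]
    simp [mul_left_comm]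

/-- A distributional solution of `(e^{ps} w')' = λ` on the line is a classical one. -/
theorem exists_of_weak_ode {p : ℝ} {f lam : ℝ → ℝ} (hf : LocallyIntegrable f)
    (hlam : LocallyIntegrable lam)
    (h : ∀ η η' : ℝ → ℝ, ContDiff ℝ ∞ η → HasCompactSupport η → (∀ s, HasDerivAt η (η' s) s) →
      ∫ s, f s * deriv (fun s => Real.exp (p * s) * η' s) s = ∫ s, lam s * η s) :
    ∃ w W : ℝ → ℝ, IsPrim W lam ∧ (∀ s, HasDerivAt w (Real.exp (-p * s) * W s) s) ∧
      f =ᵐ[volume] w := by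
  set W₀ : ℝ → ℝ := fun s => ∫ r in (0 : ℝ)..s, lam r with hW₀
  have hii : ∀ a b, IntervalIntegrable lam volume a b := fun a b =>
    intervalIntegrable_of_locallyIntegrable hlam a b
  have hP₀ : IsPrim W₀ lam := ⟨hlam, fun a b => by
    rw [hW₀]; simp only
    rw [intervalIntegral.integral_interval_sub_left (hii _ _) (hii _ _)]⟩
  have hprim : ∀ g : ℝ → ℝ, Continuous g → ∀ s, HasDerivAt (fun s => ∫ r in (0 : ℝ)..s, g r) (g s) s :=
    fun g hg s => intervalIntegral.integral_hasDerivAt_right (hg.intervalIntegrable _ _)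
      (hg.stronglyMeasurableAtFilter _ _) hg.continuousAt
  have hW₀c := hP₀.continuous
  have hc0 : Continuous fun s => Real.exp (-p * s) * W₀ s := by fun_prop
  have hc1 : Continuous fun s => Real.exp (-p * s) := by fun_prop
  -- `w₀` is a particular solution; the constants and `w₁` span the solutions of the homogeneous
  -- equation.
  set w₀ : ℝ → ℝ := fun s => ∫ r in (0 : ℝ)..s, Real.exp (-p * r) * W₀ r
  set w₁ : ℝ → ℝ := fun s => ∫ r in (0 : ℝ)..s, Real.exp (-p * r)
  have hd0 : ∀ s, HasDerivAt w₀ (Real.exp (-p * s) * W₀ s) s := hprim _ hc0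
  have hd1 : ∀ s, HasDerivAt w₁ (Real.exp (-p * s)) s := hprim _ hc1
  have pr0 := IsPrim.of_hasDerivAt hd0 hc0
  have pr1 := IsPrim.of_hasDerivAt hd1 hc1
  have l0 : LocallyIntegrable (fun s => f s - w₀ s) :=
    hf.sub pr0.continuous.locallyIntegrable
  have l1 : LocallyIntegrable (fun _ : ℝ => (1 : ℝ)) := continuous_const.locallyIntegrable
  have l2 : LocallyIntegrable w₁ := pr1.continuous.locallyIntegrable
  -- A functional that vanishes on the common kernel of finitely many others is a combination of
  -- them. So it suffices that `f - w₀` annihilates every test function orthogonal to `1` and `w₁`.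
  have hker : ⨅ i : Fin 2, LinearMap.ker (![testPairing _ l1, testPairing _ l2] i) ≤
      LinearMap.ker (testPairing _ l0) := by
    intro θ hθ
    rw [Submodule.mem_iInf] at hθ
    have h1 : ∫ s, (θ : ℝ → ℝ) s = 0 := by simpa [testPairing] using hθ 0
    have h2 : ∫ s, w₁ s * (θ : ℝ → ℝ) s = 0 := by simpa [testPairing] using hθ 1
    -- The two orthogonality relations let `θ` be integrated twice within test functions: `Θ' = θ`
    -- and `η' = e^{-ps} Θ`. Thus `θ = (e^{ps} η')'`, and the hypothesis applies to `η`.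
    obtain ⟨Θ, hΘ1, hΘ2, hΘ3⟩ := exists_primitive_test θ.2.1 θ.2.2 h1
    have h3 : ∫ s, Real.exp (-p * s) * Θ s = 0 := by
      have := pr1.integral_mul_deriv hΘ3 θ.2.1.continuous hΘ2
      linarith
    obtain ⟨η, hη1, hη2, hη3⟩ := exists_primitive_test
      (θ := fun s => Real.exp (-p * s) * Θ s) (by fun_prop) hΘ2.mul_left h3
    have e1 : (fun s => Real.exp (p * s) * (Real.exp (-p * s) * Θ s)) = Θ := by
      funext s; rw [← mul_assoc, ← Real.exp_add]; simp
    have h4 := h η _ hη1 hη2 hη3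
    rw [e1, show deriv Θ = (θ : ℝ → ℝ) from funext fun s => (hΘ3 s).deriv] at h4
    have h5 := pr0.integral_mul_deriv hΘ3 θ.2.1.continuous hΘ2
    have h6 := hP₀.integral_mul_deriv hη3 (by have := hΘ1.continuous; fun_prop) hη2
    have h7 : ∫ s, Real.exp (-p * s) * W₀ s * Θ s = ∫ s, W₀ s * (Real.exp (-p * s) * Θ s) :=
      integral_congr_ae (Eventually.of_forall fun s => by simp only; ring)
    rw [LinearMap.mem_ker]
    change ∫ s, (f s - w₀ s) * (θ : ℝ → ℝ) s = 0
    have i1 : Integrable fun s => f s * (θ : ℝ → ℝ) s := by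
      simpa using hf.integrable_smul_right_of_hasCompactSupport θ.2.1.continuous θ.2.2
    have i2 : Integrable fun s => w₀ s * (θ : ℝ → ℝ) s := by
      simpa using pr0.continuous.locallyIntegrable.integrable_smul_right_of_hasCompactSupport
        θ.2.1.continuous θ.2.2
    simp only [sub_mul]
    rw [integral_sub i1 i2, h4, h5, h7, h6]
    ring
  obtain ⟨c, hc⟩ := (Submodule.mem_span_range_iff_exists_fun ℝ).1 (mem_span_of_iInf_ker_le_ker hker)
  rw [Fin.sum_univ_two] at hc
  simp only [Matrix.cons_val_zero, Matrix.cons_val_one] at hc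
  refine ⟨fun s => w₀ s + (c 0 + c 1 * w₁ s), fun s => W₀ s + c 1, ⟨hlam, fun a b => ?_⟩,
    fun s => ?_, ?_⟩
  · rw [hP₀.2]; ring
  · refine ((hd0 s).add (((hd1 s).const_mul (c 1)).const_add (c 0))).congr_deriv ?_
    ring
  · have l3 : LocallyIntegrable fun s => (f s - w₀ s) - (c 0 + c 1 * w₁ s) :=
      l0.sub (Continuous.locallyIntegrable (by have := pr1.continuous; fun_prop))
    have key := ae_eq_zero_of_integral_contDiff_smul_eq_zero l3 fun θ h1 h2 => by
      have hc' := LinearMap.congr_fun hc ⟨θ, h1, h2⟩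
      change c 0 • (∫ s, 1 * θ s) + c 1 • (∫ s, w₁ s * θ s) = ∫ s, (f s - w₀ s) * θ s at hc'
      have i0 : Integrable fun s => (f s - w₀ s) * θ s := by
        simpa using l0.integrable_smul_right_of_hasCompactSupport h1.continuous h2
      have i1 : Integrable fun s => 1 * θ s := by
        simpa using h1.continuous.integrable_of_hasCompactSupport h2
      have i2 : Integrable fun s => w₁ s * θ s := by
        simpa using l2.integrable_smul_right_of_hasCompactSupport h1.continuous h2
      have e : ∀ s, θ s • ((f s - w₀ s) - (c 0 + c 1 * w₁ s)) =
          (f s - w₀ s) * θ s - (c 0 * (1 * θ s) + c 1 * (w₁ s * θ s)) := fun s => by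
        rw [smul_eq_mul]; ring
      simp only [e]
      have i3 : Integrable fun s => c 0 * (1 * θ s) + c 1 * (w₁ s * θ s) :=
        (i1.const_mul _).add (i2.const_mul _)
      rw [integral_sub i0 i3, integral_add (i1.const_mul _) (i2.const_mul _),
        integral_const_mul (c 0), integral_const_mul (c 1)]
      simp only [smul_eq_mul] at hc'
      linarith
    filter_upwards [key] with s hs
    linarith

/-! ### Spherical means, and reduction of radial functions to the line. -/

lemma polarMap_ne_zero (p : Metric.sphere (0 : E n) 1 × ℝ) : polarMap n p ≠ 0 := by
  rw [← norm_pos_iff, norm_polarMap]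
  exact Real.exp_pos _

lemma isCompact_annulus (a b : ℝ) :
    IsCompact (polarMap n '' (univ ×ˢ Icc a b)) :=
  (isCompact_univ.prod isCompact_Icc).image (continuous_polarMap n)

lemma locallyIntegrable_sphere_integral (hn : 1 ≤ n) {F : E n → ℝ}
    (hF : LocallyIntegrableOn F {0}ᶜ) :
    LocallyIntegrable fun s => ∫ θ, F (polarMap n (θ, s)) ∂(sphereMeasure n) := by
  refine locallyIntegrable_of_intervalIntegrable fun a b => ?_
  wlog hab : a ≤ b generalizing a b
  · exact (this b a (le_of_not_ge hab)).symm
  set K := polarMap n '' (univ ×ˢ Icc a b) with hK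
  have hK0 : K ⊆ {0}ᶜ := by
    rintro _ ⟨p, _, rfl⟩
    exact polarMap_ne_zero p
  have h1 : Integrable (K.indicator F) :=
    (hF.integrableOn_compact_subset hK0 (isCompact_annulus a b)).integrable_indicator
      (isCompact_annulus a b).measurableSet
  have h2 := (integrable_sphere_integral hn h1).intervalIntegrable (a := a) (b := b)
  have h3 := h2.continuousOn_mul (g := fun s => Real.exp (-(n * s))) (by fun_prop)
  refine h3.congr fun s hs => ?_
  rw [uIoc_of_le hab] at hs
  have e : ∀ θ, K.indicator F (polarMap n (θ, s)) = F (polarMap n (θ, s)) := fun θ =>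
    indicator_of_mem (mem_image_of_mem (polarMap n)
      (show (θ, s) ∈ univ ×ˢ Icc a b from ⟨mem_univ _, hs.1.le, hs.2⟩)) _
  simp only [e]
  rw [← mul_assoc, ← Real.exp_add]
  simp

/-- The function in `IsRadial` is arbitrary, with no measurability. The spherical mean of `u` is
locally integrable, and by Fubini it agrees almost everywhere with that function. -/
lemma exists_profile_of_isRadial (hn : 1 ≤ n) {u : E n → ℝ} (hu : IsRadial u)
    (hl : LocallyIntegrableOn u {0}ᶜ) :
    ∃ f : ℝ → ℝ, Measurable f ∧ LocallyIntegrable f ∧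
      u =ᵐ[volume] fun x => f (Real.log ‖x‖) := by
  obtain ⟨g, hg⟩ := hu
  set c := (sphereMeasure n univ).toReal with hc
  have hc0 : c ≠ 0 :=
    ENNReal.toReal_ne_zero.2 ⟨sphereMeasure_univ_ne_zero hn, sphereMeasure_univ_ne_top⟩
  have h1 : LocallyIntegrable fun s => c⁻¹ * ∫ θ, u (polarMap n (θ, s)) ∂(sphereMeasure n) :=
    (locallyIntegrable_sphere_integral hn hl).smul c⁻¹
  have h2 : ∀ᵐ s, c⁻¹ * ∫ θ, u (polarMap n (θ, s)) ∂(sphereMeasure n) = g (Real.exp s) := by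
    have h3 : ∀ᵐ p ∂((sphereMeasure n).prod (expMeasure n)),
        u (polarMap n p) = g ‖polarMap n p‖ :=
      (measurePreserving_polarMap hn).quasiMeasurePreserving.ae hg
    have h4 : ∀ᵐ s ∂(expMeasure n), ∀ᵐ θ ∂(sphereMeasure n),
        u (polarMap n (θ, s)) = g ‖polarMap n (θ, s)‖ := by
      have := Measure.ae_ae_of_ae_prod
        (Measure.measurePreserving_swap (μ := expMeasure n) (ν := sphereMeasure n)
          |>.quasiMeasurePreserving.ae h3)
      exact this
    filter_upwards [(volume_absolutelyContinuous_expMeasure n).ae_le h4] with s hs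
    have : ∫ θ, u (polarMap n (θ, s)) ∂(sphereMeasure n) =
        ∫ _θ, g (Real.exp s) ∂(sphereMeasure n) := by
      refine integral_congr_ae (hs.mono fun θ hθ => ?_)
      simp only [hθ, norm_polarMap]
    rw [this, integral_const, smul_eq_mul, Measure.real, ← hc]
    field_simp
  set f₁ : ℝ → ℝ := fun s => c⁻¹ * ∫ θ, u (polarMap n (θ, s)) ∂(sphereMeasure n)
  have hm := h1.aestronglyMeasurable
  refine ⟨hm.mk f₁, hm.stronglyMeasurable_mk.measurable, h1.congr hm.ae_eq_mk, ?_⟩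
  filter_upwards [hg, ae_comp_log_norm hn (h2.and hm.ae_eq_mk), ae_ne_zero hn] with x hx h3 h4
  have h5 : f₁ (Real.log ‖x‖) = g (Real.exp (Real.log ‖x‖)) := h3.1
  rw [hx, ← h3.2, h5, Real.exp_log (norm_pos_iff.2 h4)]

/-- The radial data of a compactly supported smooth profile. -/
lemma radialData_of_contDiff {η η' : ℝ → ℝ} (hη : ContDiff ℝ ∞ η)
    (hd : ∀ s, HasDerivAt η (η' s) s) :
    RadialData n η (fun s => Real.exp ((n - 2) * s) * η' s)
      (fun s => Real.exp (-(n * s)) * deriv (fun s => Real.exp ((n - 2) * s) * η' s) s) := by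
  have h1 : ContDiff ℝ ∞ η' := by
    rw [← show deriv η = η' from funext fun s => (hd s).deriv]
    exact (contDiff_infty_iff_deriv.1 hη).2
  have h2 : ContDiff ℝ ∞ (fun s => Real.exp ((n - 2) * s) * η' s) := by fun_prop
  have h3 := contDiff_infty_iff_deriv.1 h2
  refine ⟨?_, fun s => ?_, ?_⟩
  · have := h3.2.continuous
    exact Continuous.measurable (by fun_prop)
  · refine (hd s).congr_deriv ?_
    rw [← mul_assoc, ← Real.exp_add, ← add_mul]; simp
  · refine (IsPrim.of_hasDerivAt (fun s => (h3.1 s).hasDerivAt) h3.2.continuous).congr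
      (Eventually.of_forall fun s => ?_)
    simp only
    rw [← mul_assoc, ← Real.exp_add]; simp

/-- A radial function with distributional Laplacian is given by radial data. -/
theorem exists_radialData (hn : 1 ≤ n) {u : E n → ℝ} {G : E n → E n} {L : E n → ℝ}
    (hu : IsRadial u) (hG : HasWeakGradient u G) (hL : HasWeakLaplacian u L) :
    ∃ w W l : ℝ → ℝ, RadialData n w W l ∧ (u =ᵐ[volume] fun x => w (Real.log ‖x‖)) ∧
      G =ᵐ[volume] radGrad W ∧ L =ᵐ[volume] fun x => l (Real.log ‖x‖) := by
  obtain ⟨f, hfm, hfl, huf⟩ := exists_profile_of_isRadial hn hu hL.1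
  set c := (sphereMeasure n univ).toReal with hc
  have hc0 : c ≠ 0 :=
    ENNReal.toReal_ne_zero.2 ⟨sphereMeasure_univ_ne_zero hn, sphereMeasure_univ_ne_top⟩
  -- `L` is not yet known to be radial, so its spherical mean takes its place; radial test functions
  -- see nothing else.
  set lb : ℝ → ℝ := fun s => ∫ θ, L (polarMap n (θ, s)) ∂(sphereMeasure n) with hlb
  have hlbl : LocallyIntegrable lb := locallyIntegrable_sphere_integral hn hL.2.1
  have hlb' : LocallyIntegrable fun s => c⁻¹ * lb s := hlbl.smul c⁻¹
  have hm := hlb'.aestronglyMeasurable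
  set l : ℝ → ℝ := hm.mk _ with hl
  have hlm : Measurable l := hm.stronglyMeasurable_mk.measurable
  have hll : LocallyIntegrable l := hlb'.congr hm.ae_eq_mk
  have hlam : LocallyIntegrable fun s => Real.exp (n * s) * l s :=
    locallyIntegrable_of_intervalIntegrable fun a b =>
      (intervalIntegrable_of_locallyIntegrable hll a b).continuousOn_mul (by fun_prop)
  -- Testing with radial functions yields the weak form of `(e^{(n-2)s} w')' = e^{ns} l`.
  obtain ⟨w, W, hW, hw, hfw⟩ := exists_of_weak_ode (p := n - 2) hfl hlam (by
    intro η η' h1 h2 h3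
    obtain ⟨R, _, hR1, hR2⟩ := exists_bounds_of_hasCompactSupport h2
    have hT : IsTest (radExt 0 η : E n → ℝ) := isTest_radExt h1 hR1 hR2
    have hs : tsupport (radExt 0 η : E n → ℝ) ⊆ {0}ᶜ := tsupport_radExt_subset hR1
    have hrd := radialData_of_contDiff (n := n) h1 h3
    have hΔ := hT.hasWeakLaplacian.ae_eq hn (hrd.hasWeakLaplacian hn) (radExt_ae_eq hn 0 η)
    have key := hL.2.2 _ hT hs
    set D := deriv (fun s => Real.exp ((n - 2) * s) * η' s) with hD
    have e1 : ∫ x, u x * Δ (radExt 0 η) x = c * ∫ s, f s * D s := by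
      have : ∫ x, u x * Δ (radExt 0 η) x =
          ∫ x : E n, (fun s => f s * (Real.exp (-(n * s)) * D s)) (Real.log ‖x‖) := by
        refine integral_congr_ae ?_
        filter_upwards [huf, hΔ] with x hx1 hx2
        rw [hx1, hx2]
      have hmm : Measurable fun s => f s * (Real.exp (-(n * s)) * D s) := hfm.mul hrd.measurable
      rw [this, integral_comp_log_norm hn hmm]
      congr 1
      refine integral_congr_ae (Eventually.of_forall fun s => ?_)
      simp only
      have : Real.exp (n * s) * Real.exp (-(n * s)) = 1 := by rw [← Real.exp_add]; simp
      calc _ = (Real.exp (n * s) * Real.exp (-(n * s))) * (f s * D s) := by ring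
        _ = _ := by rw [this, one_mul]
    have e2 : ∫ x, L x * radExt 0 η x = c * ∫ s, Real.exp (n * s) * l s * η s := by
      rw [integral_eq_polar hn
        (integrable_mul_of_tsupport_subset hL.2.1 hT.1.continuous hT.2 hs), ← integral_const_mul]
      refine integral_congr_ae ?_
      filter_upwards [hm.ae_eq_mk] with s hs
      have e3 : ∀ θ, L (polarMap n (θ, s)) * radExt 0 η (polarMap n (θ, s)) =
          L (polarMap n (θ, s)) * η s := fun θ => by
        simp only [radExt, polarMap_ne_zero, if_false, log_norm_polarMap]
      simp only [e3]
      have h4 : l s = c⁻¹ * lb s := hs.symm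
      rw [integral_mul_const, h4]
      field_simp
      exact mul_comm _ _
    rw [e1, e2] at key
    exact mul_left_cancel₀ hc0 key)
  have hrd : RadialData n w W l := ⟨hlm, hw, hW⟩
  have huw : u =ᵐ[volume] fun x => w (Real.log ‖x‖) := by
    filter_upwards [huf, ae_comp_log_norm hn hfw] with x h1 h2
    rw [h1, h2]
  -- Uniqueness of weak derivatives now identifies `G` and `L` with the radial expressions; in
  -- particular `L` is radial.
  exact ⟨w, W, l, hrd, huw, hG.ae_eq hn hrd.hasWeakGradient huw,
    hL.ae_eq hn (hrd.hasWeakLaplacian hn) huw⟩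

/-! ### Weighted integrals: radial formulas, finiteness and duality. -/

lemma wInt_congr_ae {V : Type*} [NormedAddCommGroup V] {p s : ℝ} {F F' : E n → V}
    (h : F =ᵐ[volume] F') : wInt p s F = wInt p s F' :=
  lintegral_congr_ae (h.mono fun x hx => by simp only [hx])

lemma norm_rpow_eq_exp {x : E n} (hx : x ≠ 0) (σ : ℝ) :
    ‖x‖ ^ σ = Real.exp (σ * Real.log ‖x‖) := by
  rw [Real.rpow_def_of_pos (norm_pos_iff.2 hx), mul_comm]

lemma enorm_rpow_eq_ofReal {V : Type*} [NormedAddCommGroup V] {p : ℝ} (hp : 0 ≤ p) (v : V) :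
    ‖v‖ₑ ^ p = ENNReal.ofReal (‖v‖ ^ p) := by
  rw [← ofReal_norm, ENNReal.ofReal_rpow_of_nonneg (norm_nonneg _) hp]

/-- Weighted integrals of functions with radial norm. -/
lemma wInt_eq_of_norm_eq (hn : 1 ≤ n) {V : Type*} [NormedAddCommGroup V] {p σ : ℝ} (hp : 0 ≤ p)
    {F : E n → V} {g : ℝ → ℝ} (hg : Measurable g)
    (h : ∀ᵐ x, ‖F x‖ = g (Real.log ‖x‖)) :
    wInt p σ F = sphereMeasure n univ *
      ∫⁻ s, ENNReal.ofReal (g s ^ p * Real.exp ((n - σ) * s)) := by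
  have h1 : wInt p σ F = ∫⁻ x : E n, (fun s => ENNReal.ofReal (g s ^ p) *
      ENNReal.ofReal (Real.exp (-σ * s))) (Real.log ‖x‖) := by
    refine lintegral_congr_ae ?_
    filter_upwards [h, ae_ne_zero hn] with x hx h0
    rw [enorm_rpow_eq_ofReal hp, hx, norm_rpow_eq_exp h0]
  have hgm : Measurable fun s => ENNReal.ofReal (g s ^ p) * ENNReal.ofReal (Real.exp (-σ * s)) := by
    fun_prop
  rw [h1, lintegral_log_norm hn hgm]
  congr 1
  refine lintegral_congr fun s => ?_
  rw [mul_assoc, ← ENNReal.ofReal_mul (Real.exp_pos _).le, ← Real.exp_add,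
    ENNReal.ofReal_mul' (Real.exp_pos _).le]
  congr 3
  ring

lemma wInt_comp_log_norm (hn : 1 ≤ n) {α : ℝ} {l : ℝ → ℝ} (hl : Measurable l) :
    wInt 2 (2 * α) (fun x : E n => l (Real.log ‖x‖)) = sphereMeasure n univ *
      ∫⁻ s, ENNReal.ofReal ((Real.exp ((n / 2 - α) * s) * l s) ^ 2) := by
  rw [wInt_eq_of_norm_eq hn (by norm_num) (g := fun s => |l s|)
    (by simpa using hl.norm) (Eventually.of_forall fun x => by simp)]
  congr 1
  refine lintegral_congr fun s => ?_
  congr 1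
  rw [Real.rpow_two, sq_abs, mul_pow, ← Real.exp_nat_mul, mul_comm]
  congr 2
  push_cast; ring

lemma norm_radGrad {W : ℝ → ℝ} {x : E n} (hx : x ≠ 0) :
    ‖(radGrad W x : E n)‖ = |W (Real.log ‖x‖)| * Real.exp ((1 - n) * Real.log ‖x‖) := by
  unfold radGrad
  rw [norm_smul, Real.norm_eq_abs, abs_mul, abs_of_pos (Real.exp_pos _), mul_assoc]
  congr 1
  nth_rewrite 2 [← Real.exp_log (norm_pos_iff.2 hx)]
  rw [← Real.exp_add]
  congr 1; ring

/-- The number `m` is a free normalisation of the flux, compensated in `k`. The choice `m = n/2 + α`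
produces `y`; where no normalisation is wanted, `m = 0` is used. -/
lemma wInt_radGrad (hn : 1 ≤ n) {p σ m k : ℝ} (hp : 0 ≤ p) {W : ℝ → ℝ} (hW : Measurable W)
    (hk : k = p * (m + 1 - n) + n - σ) :
    wInt p σ (radGrad W : E n → E n) = sphereMeasure n univ *
      ∫⁻ s, ENNReal.ofReal (|Real.exp (-m * s) * W s| ^ p * Real.exp (k * s)) := by
  have hW' : Measurable fun s => |W s| := by simpa using hW.norm
  rw [wInt_eq_of_norm_eq hn hp (g := fun s => |W s| * Real.exp ((1 - n) * s))
    (by fun_prop) ((ae_ne_zero hn).mono fun x hx => norm_radGrad hx)]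
  congr 1
  refine lintegral_congr fun s => ?_
  congr 1
  rw [abs_mul, abs_of_pos (Real.exp_pos _), mul_comm (Real.exp _) |W s|,
    Real.mul_rpow (abs_nonneg _) (Real.exp_pos _).le,
    Real.mul_rpow (abs_nonneg _) (Real.exp_pos _).le, ← Real.exp_mul, ← Real.exp_mul,
    mul_assoc (|W s| ^ p), mul_assoc (|W s| ^ p), ← Real.exp_add, ← Real.exp_add, hk]
  congr 2
  ring

/-- On a bounded set the density in `s` is `e^{(n-σ)s}`, integrable at `-∞` since `n > σ`. The
conditions `n - 2α > 0` and `n - β > 0` enter through this, as finiteness of the norm of test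
functions. -/
lemma wInt_lt_top_of_continuous (hn : 1 ≤ n) {V : Type*} [NormedAddCommGroup V] {p σ : ℝ}
    (hp : 0 < p) (hσ : 0 < (n : ℝ) - σ) {F : E n → V} (hF : Continuous F)
    (hc : HasCompactSupport F) : wInt p σ F < ⊤ := by
  obtain ⟨C, hC⟩ := hc.exists_bound_of_continuous hF
  obtain ⟨R, hR⟩ := hc.isCompact.isBounded.subset_closedBall (0 : E n)
  have hC0 : 0 ≤ C := (norm_nonneg _).trans (hC 0)
  set g : ℝ → ℝ≥0∞ := fun s => ENNReal.ofReal (C ^ p) *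
    (Iic (Real.log (|R| + 1))).indicator (fun s => ENNReal.ofReal (Real.exp (-σ * s))) s with hg
  have hgm : Measurable g :=
    (Measurable.indicator (by fun_prop) measurableSet_Iic).const_mul _
  have h1 : wInt p σ F ≤ ∫⁻ x : E n, g (Real.log ‖x‖) := by
    refine lintegral_mono_ae ?_
    filter_upwards [ae_ne_zero hn] with x h0
    by_cases hx : x ∈ tsupport F
    · have h2 : Real.log ‖x‖ ∈ Iic (Real.log (|R| + 1)) := by
        have := hR hx
        simp only [Metric.mem_closedBall, dist_zero_right] at this
        exact Real.log_le_log (norm_pos_iff.2 h0) (by linarith [le_abs_self R])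
      rw [hg]
      simp only
      rw [indicator_of_mem h2, norm_rpow_eq_exp h0, enorm_rpow_eq_ofReal hp.le]
      gcongr
      exact hC x
    · rw [image_eq_zero_of_notMem_tsupport hx]
      simp [ENNReal.zero_rpow_of_pos hp]
  refine h1.trans_lt ?_
  rw [lintegral_log_norm hn hgm]
  refine ENNReal.mul_lt_top (measure_lt_top _ _) ?_
  have h3 : ∀ s, g s * ENNReal.ofReal (Real.exp (n * s)) = ENNReal.ofReal (C ^ p) *
      (Iic (Real.log (|R| + 1))).indicator
        (fun s => ENNReal.ofReal (Real.exp ((n - σ) * s))) s := fun s => by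
    rw [hg]; simp only
    by_cases hs : s ∈ Iic (Real.log (|R| + 1))
    · rw [indicator_of_mem hs, indicator_of_mem hs, mul_assoc,
        ← ENNReal.ofReal_mul (Real.exp_pos _).le, ← Real.exp_add]
      congr 3; ring
    · rw [indicator_of_notMem hs, indicator_of_notMem hs]; simp
  simp only [h3]
  rw [lintegral_const_mul _ (Measurable.indicator (by fun_prop) measurableSet_Iic),
    lintegral_indicator measurableSet_Iic]
  refine ENNReal.mul_lt_top ENNReal.ofReal_lt_top ?_
  exact (integrableOn_exp_mul_Iic hσ (Real.log (|R| + 1))).lintegral_lt_top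

lemma wInt_lt_top_of_sub {V : Type*} [NormedAddCommGroup V] [MeasurableSpace V] [BorelSpace V]
    {p σ : ℝ} (hp : 1 ≤ p) {F F' : E n → V}
    (hF : AEMeasurable F) (h1 : wInt p σ F < ⊤)
    (h2 : wInt p σ (fun x => F x - F' x) < ⊤) : wInt p σ F' < ⊤ := by
  have key : wInt p σ F' ≤ 2 ^ (p - 1) * (wInt p σ F + wInt p σ fun x => F x - F' x) := by
    unfold wInt
    rw [← lintegral_add_left' (by fun_prop), ← lintegral_const_mul' _ _
      (ENNReal.rpow_ne_top_of_nonneg (by linarith) (by simp))]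
    refine lintegral_mono fun x => ?_
    rw [← add_mul, ← mul_assoc]
    gcongr
    calc ‖F' x‖ₑ ^ p = ‖F x - (F x - F' x)‖ₑ ^ p := by simp
      _ ≤ (‖F x‖ₑ + ‖F x - F' x‖ₑ) ^ p := by
          gcongr; exact enorm_sub_le
      _ ≤ _ := ENNReal.rpow_add_le_mul_rpow_add_rpow _ _ hp
  refine key.trans_lt (ENNReal.mul_lt_top ?_ (ENNReal.add_lt_top.2 ⟨h1, h2⟩))
  exact ENNReal.rpow_lt_top_of_nonneg (by linarith) (by simp)

/-- Weighted Hölder inequality. -/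
lemma lintegral_enorm_mul_le (hn : 1 ≤ n) {V : Type*} [NormedAddCommGroup V] {p p' σ : ℝ}
    (hpp : p.HolderConjugate p') {F H : E n → V} (hF : AEStronglyMeasurable F)
    (hH : AEStronglyMeasurable H) :
    ∫⁻ x, ‖F x‖ₑ * ‖H x‖ₑ ≤
      wInt p σ F ^ (1 / p) * wInt p' (-(σ * p' / p)) H ^ (1 / p') := by
  have hp0 := hpp.pos
  have hp0' := hpp.symm.pos
  have h1 := ENNReal.lintegral_mul_le_Lp_mul_Lq (volume : Measure (E n)) hpp
    (f := fun x => ‖F x‖ₑ * ENNReal.ofReal (‖x‖ ^ (-σ / p)))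
    (g := fun x => ‖H x‖ₑ * ENNReal.ofReal (‖x‖ ^ (σ / p)))
    (by fun_prop) (by fun_prop)
  have e1 : ∫⁻ x, ‖F x‖ₑ * ‖H x‖ₑ = ∫⁻ x, ((fun x => ‖F x‖ₑ * ENNReal.ofReal (‖x‖ ^ (-σ / p))) *
      fun x => ‖H x‖ₑ * ENNReal.ofReal (‖x‖ ^ (σ / p))) x := by
    refine lintegral_congr_ae ?_
    filter_upwards [ae_ne_zero hn] with x hx
    simp only [Pi.mul_apply]
    have : ENNReal.ofReal (‖x‖ ^ (-σ / p)) * ENNReal.ofReal (‖x‖ ^ (σ / p)) = 1 := by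
      rw [← ENNReal.ofReal_mul (by positivity), ← Real.rpow_add (norm_pos_iff.2 hx)]
      simp [neg_div]
    calc _ = ‖F x‖ₑ * ‖H x‖ₑ * 1 := by rw [mul_one]
      _ = _ := by rw [← this]; ring
  have e2 : wInt p σ F = ∫⁻ x, (‖F x‖ₑ * ENNReal.ofReal (‖x‖ ^ (-σ / p))) ^ p := by
    refine lintegral_congr fun x => ?_
    rw [ENNReal.mul_rpow_of_nonneg _ _ hp0.le,
      ENNReal.ofReal_rpow_of_nonneg (by positivity) hp0.le, ← Real.rpow_mul (norm_nonneg _)]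
    congr 3; field_simp
  have e3 : wInt p' (-(σ * p' / p)) H =
      ∫⁻ x, (‖H x‖ₑ * ENNReal.ofReal (‖x‖ ^ (σ / p))) ^ p' := by
    refine lintegral_congr fun x => ?_
    rw [ENNReal.mul_rpow_of_nonneg _ _ hp0'.le,
      ENNReal.ofReal_rpow_of_nonneg (by positivity) hp0'.le, ← Real.rpow_mul (norm_nonneg _)]
    congr 3; field_simp
  rw [e1, e2, e3]
  exact h1

/-- Convergence of pairings along a sequence that converges in a weighted space. -/
lemma tendsto_integral_inner (hn : 1 ≤ n) {V : Type*} [NormedAddCommGroup V]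
    [InnerProductSpace ℝ V] [MeasurableSpace V] [BorelSpace V] [SecondCountableTopology V]
    {p p' σ : ℝ}
    (hpp : p.HolderConjugate p') {F H : E n → V} {Fk : ℕ → E n → V} (hF : AEStronglyMeasurable F)
    (hH : Continuous H) (hFk : ∀ k, Continuous (Fk k)) (hFc : ∀ k, HasCompactSupport (Fk k))
    (hHi : wInt p' (-(σ * p' / p)) H < ⊤)
    (hlim : Tendsto (fun k => wInt p σ fun x => Fk k x - F x) atTop (𝓝 0)) :
    Tendsto (fun k => ∫ x, inner ℝ (H x) (Fk k x)) atTop (𝓝 (∫ x, inner ℝ (H x) (F x))) := by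
  have hp0 := hpp.pos
  have hp0' := hpp.symm.pos
  have hb : ∀ k, ∫⁻ x, ‖inner ℝ (H x) (Fk k x) - inner ℝ (H x) (F x)‖ₑ ≤
      wInt p σ (fun x => Fk k x - F x) ^ (1 / p) * wInt p' (-(σ * p' / p)) H ^ (1 / p') := by
    intro k
    refine le_trans (lintegral_mono fun x => ?_) (lintegral_enorm_mul_le hn hpp
      ((hFk k).aestronglyMeasurable.sub hF) hH.aestronglyMeasurable)
    rw [← inner_sub_right, mul_comm]
    rw [← ofReal_norm, ← ofReal_norm, ← ofReal_norm,
      ← ENNReal.ofReal_mul (norm_nonneg _)]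
    exact ENNReal.ofReal_le_ofReal (norm_inner_le_norm _ _)
  have hz : Tendsto (fun k => wInt p σ (fun x => Fk k x - F x) ^ (1 / p) *
      wInt p' (-(σ * p' / p)) H ^ (1 / p')) atTop (𝓝 0) := by
    have h1 : Tendsto (fun k => wInt p σ (fun x => Fk k x - F x) ^ (1 / p)) atTop (𝓝 0) := by
      have := (ENNReal.continuous_rpow_const (y := 1 / p)).tendsto 0 |>.comp hlim
      rwa [ENNReal.zero_rpow_of_pos (by positivity)] at this
    have h2 := ENNReal.Tendsto.mul_const h1
      (Or.inr (ENNReal.rpow_lt_top_of_nonneg (y := 1 / p') (by positivity) hHi.ne).ne)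
    rwa [zero_mul] at h2
  have hL1 := tendsto_of_tendsto_of_tendsto_of_le_of_le tendsto_const_nhds hz
    (fun _ => zero_le) hb
  have hik : ∀ k, Integrable fun x => inner ℝ (H x) (Fk k x) := fun k => by
    refine (hH.inner (hFk k)).integrable_of_hasCompactSupport ((hFc k).mono fun x hx h0 => hx ?_)
    simp [h0]
  have hi : Integrable fun x => inner ℝ (H x) (F x) := by
    have h1 : ∀ᶠ k in atTop, ∫⁻ x, ‖inner ℝ (H x) (Fk k x) - inner ℝ (H x) (F x)‖ₑ < 1 :=
      hL1.eventually (gt_mem_nhds one_pos)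
    obtain ⟨k, hk⟩ := h1.exists
    have h2 : Integrable fun x => inner ℝ (H x) (Fk k x) - inner ℝ (H x) (F x) := by
      refine ⟨(hik k).1.sub (hH.aestronglyMeasurable.inner hF), ?_⟩
      exact hk.trans ENNReal.one_lt_top
    refine ((hik k).sub h2).congr (Eventually.of_forall fun x => ?_)
    simp
  exact tendsto_integral_of_L1 _ hi.1 (Eventually.of_forall hik) hL1

/-! ### Vanishing of the flux for elements of the completion. -/

/-- A smooth function that vanishes in the unit ball and is `1` near infinity. -/
def cutoff : E n → ℝ := radExt 0 Real.smoothTransition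

lemma contDiff_smoothTransition : ContDiff ℝ ∞ Real.smoothTransition :=
  Real.smoothTransition.contDiff (n := ⊤)

lemma contDiff_cutoff : ContDiff ℝ ∞ (cutoff : E n → ℝ) :=
  contDiff_radExt contDiff_smoothTransition (a := 0)
    fun _ hs => Real.smoothTransition.zero_of_nonpos hs

lemma deriv_smoothTransition_eq_zero {s : ℝ} (h : s ∉ Icc (0 : ℝ) 1) :
    deriv Real.smoothTransition s = 0 := by
  rw [mem_Icc, not_and_or, not_le, not_le] at h
  rcases h with h | h
  · have : Real.smoothTransition =ᶠ[𝓝 s] fun _ => 0 := by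
      filter_upwards [Iio_mem_nhds h] with r hr
      exact Real.smoothTransition.zero_of_nonpos (le_of_lt hr)
    rw [this.deriv_eq]; simp
  · have : Real.smoothTransition =ᶠ[𝓝 s] fun _ => 1 := by
      filter_upwards [Ioi_mem_nhds h] with r hr
      exact Real.smoothTransition.one_of_one_le (le_of_lt hr)
    rw [this.deriv_eq]; simp

lemma hasCompactSupport_deriv_smoothTransition :
    HasCompactSupport (deriv Real.smoothTransition) :=
  HasCompactSupport.of_support_subset_isCompact (isCompact_Icc (a := (0 : ℝ)) (b := 1))
    fun _ hs => by_contra fun h => hs (deriv_smoothTransition_eq_zero h)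

lemma hasDerivAt_smoothTransition (s : ℝ) :
    HasDerivAt Real.smoothTransition (deriv Real.smoothTransition s) s :=
  (contDiff_smoothTransition.differentiable (by simp) s).hasDerivAt

lemma continuous_deriv_smoothTransition : Continuous (deriv Real.smoothTransition) :=
  contDiff_smoothTransition.continuous_deriv (by simp)

lemma gradient_cutoff {x : E n} (hx : x ≠ 0) :
    ∇ (cutoff : E n → ℝ) x =
      radGrad (fun s => Real.exp ((n - 2) * s) * deriv Real.smoothTransition s) x := by
  have h1 := (radialData_of_contDiff (n := n) contDiff_smoothTransition
    hasDerivAt_smoothTransition).hasFDerivAt hx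
  have h2 : (cutoff : E n → ℝ) =ᶠ[𝓝 x] fun z => Real.smoothTransition (Real.log ‖z‖) := by
    filter_upwards [isOpen_compl_zero.mem_nhds (show x ∈ ({0}ᶜ : Set (E n)) from hx)] with z hz
    have hz' : z ≠ 0 := hz
    simp [cutoff, radExt, hz']
  have h3 := (h1.congr_of_eventuallyEq h2).fderiv
  unfold gradient
  rw [h3]
  exact (InnerProductSpace.toDual ℝ (E n)).symm_apply_apply _

/-- The gradient lives on the annulus `1 ≤ |x| ≤ e`, where every power weight is harmless. -/
lemma wInt_gradient_cutoff_lt_top (hn : 1 ≤ n) {p σ : ℝ} (hp : 0 < p) :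
    wInt p σ (∇ (cutoff : E n → ℝ)) < ⊤ := by
  set W : ℝ → ℝ := fun s => Real.exp ((n - 2) * s) * deriv Real.smoothTransition s with hW
  have hc : Continuous W := by
    have := continuous_deriv_smoothTransition
    fun_prop
  have h1 : ∇ (cutoff : E n → ℝ) =ᵐ[volume] radGrad W :=
    (ae_ne_zero hn).mono fun x hx => gradient_cutoff hx
  rw [wInt_congr_ae h1, wInt_radGrad hn hp.le hc.measurable (m := 0) rfl]
  refine ENNReal.mul_lt_top (measure_lt_top _ _) ?_
  refine Integrable.lintegral_lt_top ?_
  refine Continuous.integrable_of_hasCompactSupport ?_ ?_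
  · have : Continuous fun s => |Real.exp (-0 * s) * W s| ^ p :=
      Continuous.rpow_const (by fun_prop) fun s => Or.inr hp.le
    fun_prop
  · refine hasCompactSupport_deriv_smoothTransition.mono fun s hs h0 => hs ?_
    simp [hW, h0, Real.zero_rpow hp.ne']

lemma integral_inner_gradient_cutoff (hn : 1 ≤ n) {W : ℝ → ℝ} (hW : Continuous W) :
    ∫ x : E n, inner ℝ (∇ (cutoff : E n → ℝ) x) (radGrad W x) =
      (sphereMeasure n univ).toReal * ∫ s, W s * deriv Real.smoothTransition s := by
  have e1 : ∫ x : E n, inner ℝ (∇ (cutoff : E n → ℝ) x) (radGrad W x) =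
      ∫ x : E n, (fun s => Real.exp (-(n * s)) * (W s * deriv Real.smoothTransition s))
        (Real.log ‖x‖) := by
    refine integral_congr_ae ?_
    filter_upwards [ae_ne_zero hn] with x hx
    rw [gradient_cutoff hx]
    unfold radGrad
    rw [real_inner_smul_left, real_inner_smul_right, real_inner_self_eq_norm_sq,
      norm_sq_eq_exp hx]
    generalize Real.log ‖x‖ = s
    have : Real.exp (-(n * s)) = Real.exp ((n - 2) * s) * Real.exp (-n * s) *
        (Real.exp (-n * s) * Real.exp (2 * s)) := by
      rw [← Real.exp_add, ← Real.exp_add, ← Real.exp_add]; congr 1; ring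
    rw [this]; ring
  have hm : Measurable fun s => Real.exp (-(n * s)) * (W s * deriv Real.smoothTransition s) := by
    have := continuous_deriv_smoothTransition
    exact Continuous.measurable (by fun_prop)
  rw [e1, integral_comp_log_norm hn hm]
  congr 1
  refine integral_congr_ae (Eventually.of_forall fun s => ?_)
  simp only
  rw [← mul_assoc, ← Real.exp_add]; simp

lemma isTest_continuous_gradient {φ : E n → ℝ} (hφ : IsTest φ) :
    Continuous (∇ φ) ∧ HasCompactSupport (∇ φ) := by
  refine ⟨continuous_gradient hφ.1, (hφ.2.fderiv (𝕜 := ℝ)).mono fun x hx h0 => hx ?_⟩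
  unfold gradient
  rw [h0]; simp

lemma aestronglyMeasurable_radGrad (hn : 1 ≤ n) {W : ℝ → ℝ} (hW : Continuous W) :
    AEStronglyMeasurable (radGrad W : E n → E n) := by
  have h1 := (continuousOn_radGrad (n := n) hW).aestronglyMeasurable (μ := volume)
    (measurableSet_singleton (0 : E n)).compl
  have h2 : ∀ᵐ x : E n, x ∈ ({0}ᶜ : Set (E n)) := ae_ne_zero hn
  rwa [Measure.restrict_eq_self_of_ae_mem h2] at h1

/-- Let `m = n/2 + α > 0` and `χ = cutoff`. Then `1 - χ` has finite norm in the dual weighted `L²`,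
so Green's identity for `1 - χ` and the approximating test functions passes to the limit.
Integrating by parts in `s` for the limit itself yields the same identity plus the limit of `W` at
`-∞`, which is therefore zero. For `m < 0` the same is done with `χ` at `+∞`. -/
lemma MemH2.fluxZero (hn : 1 ≤ n) {q α β : ℝ} (hq : 1 < q) {u : E n → ℝ} {G : E n → E n}
    {L : E n → ℝ} (h : MemH2 q α β u G L) {w W l : ℝ → ℝ} (hd : RadialData n w W l)
    (hG : G =ᵐ[volume] radGrad W) (hL : L =ᵐ[volume] fun x => l (Real.log ‖x‖))
    (ha : Integrable fun s => (Real.exp ((n / 2 - α) * s) * l s) ^ 2) :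
    FluxZero ((n : ℝ) / 2 + α) W := by
  obtain ⟨φ, hφ, hφL, hφG⟩ := h.approx
  set c := (sphereMeasure n univ).toReal with hc
  have hc0 : c ≠ 0 :=
    ENNReal.toReal_ne_zero.2 ⟨sphereMeasure_univ_ne_zero hn, sphereMeasure_univ_ne_top⟩
  have hWc := hd.isPrim.continuous
  have hGm : AEStronglyMeasurable G :=
    (aestronglyMeasurable_congr hG).2 (aestronglyMeasurable_radGrad hn hWc)
  have hLm : AEStronglyMeasurable L :=
    (aestronglyMeasurable_congr hL).2 ((hd.measurable.comp (by fun_prop)).aestronglyMeasurable)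
  have hgrad : Tendsto (fun k => ∫ x, inner ℝ (∇ (cutoff : E n → ℝ) x) (∇ (φ k) x)) atTop
      (𝓝 (c * ∫ s, W s * deriv Real.smoothTransition s)) := by
    have h1 := tendsto_integral_inner hn (Real.HolderConjugate.conjExponent hq)
      (H := ∇ (cutoff : E n → ℝ)) hGm (continuous_gradient contDiff_cutoff)
      (fun k => (isTest_continuous_gradient (hφ k)).1)
      (fun k => (isTest_continuous_gradient (hφ k)).2)
      (wInt_gradient_cutoff_lt_top hn (Real.HolderConjugate.conjExponent hq).symm.pos) hφG
    have h2 : ∫ x, inner ℝ (∇ (cutoff : E n → ℝ) x) (G x) =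
        c * ∫ s, W s * deriv Real.smoothTransition s := by
      rw [← integral_inner_gradient_cutoff hn hWc]
      exact integral_congr_ae (hG.mono fun x hx => by simp only [hx])
    rwa [h2] at h1
  have hlap : ∀ η : ℝ → ℝ, Continuous η → ∀ H : E n → ℝ, Continuous H →
      (H =ᵐ[volume] fun x => η (Real.log ‖x‖)) →
      (∫⁻ s, ENNReal.ofReal ((Real.exp ((n / 2 + α) * s) * η s) ^ 2) < ⊤) →
      Tendsto (fun k => ∫ x, H x * Δ (φ k) x) atTop
        (𝓝 (c * ∫ s, Real.exp (n * s) * l s * η s)) := by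
    intro η hη H hH hHη hfin
    -- The dual weight is `|x|^{2α}`, so the formula for the Laplacian integral applies with `-α` in
    -- place of `α`.
    have hfin' : wInt 2 (-(2 * α * 2 / 2)) H < ⊤ := by
      rw [wInt_congr_ae hHη, show -(2 * α * 2 / 2) = 2 * (-α) by ring,
        wInt_comp_log_norm hn hη.measurable]
      refine ENNReal.mul_lt_top (measure_lt_top _ _) ?_
      simpa [sub_neg_eq_add] using hfin
    have h1 := tendsto_integral_inner hn Real.HolderConjugate.two_two hLm hH
      (fun k => continuous_laplacian (hφ k).1) (fun k => hasCompactSupport_laplacian (hφ k).2)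
      hfin' hφL
    have h2 : ∫ x, inner ℝ (H x) (L x) = c * ∫ s, Real.exp (n * s) * l s * η s := by
      have e : ∫ x, inner ℝ (H x) (L x) =
          ∫ x : E n, (fun s => l s * η s) (Real.log ‖x‖) := by
        refine integral_congr_ae ?_
        filter_upwards [hHη, hL] with x h3 h4
        rw [h3, h4]
        simp
      have hm : Measurable fun s => l s * η s := hd.measurable.mul hη.measurable
      rw [e, integral_comp_log_norm hn hm]
      simp only [mul_assoc, hc]
    rw [h2] at h1
    refine h1.congr fun k => integral_congr_ae (Eventually.of_forall fun x => ?_)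
    simp [mul_comm]
  have hgreen : ∀ k, ∫ x, cutoff x * Δ (φ k) x =
      -∫ x, inner ℝ (∇ (cutoff : E n → ℝ) x) (∇ (φ k) x) := fun k =>
    integral_mul_laplacian_test contDiff_cutoff (hφ k)
  -- Replacing `cutoff` by `1 - cutoff` changes only the sign, because the Laplacian of a test
  -- function has integral zero.
  have hgreen1 : ∀ k, ∫ x, (1 - cutoff x) * Δ (φ k) x =
      ∫ x, inner ℝ (∇ (cutoff : E n → ℝ) x) (∇ (φ k) x) := fun k => by
    have h0 : ∫ x, (fun _ => (1 : ℝ)) x * Δ (φ k) x = 0 := by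
      rw [integral_mul_laplacian_test contDiff_const (hφ k)]
      simp [gradient]
    have i1 : ∀ f : E n → ℝ, Continuous f → Integrable fun x => f x * Δ (φ k) x := fun f hf =>
      (hf.mul (continuous_laplacian (hφ k).1)).integrable_of_hasCompactSupport
        (hasCompactSupport_laplacian (hφ k).2).mul_left
    have e : ∀ x, (1 - cutoff x) * Δ (φ k) x = (fun _ => (1 : ℝ)) x * Δ (φ k) x -
      cutoff x * Δ (φ k) x := fun x => by ring
    simp only [e]
    rw [integral_sub (i1 _ continuous_const) (i1 _ contDiff_cutoff.continuous), h0, hgreen]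
    ring
  have hal : ∀ s, Real.exp ((n / 2 + α) * s) * (Real.exp ((n / 2 - α) * s) * l s) =
      Real.exp (n * s) * l s := fun s => by
    rw [← mul_assoc, ← Real.exp_add]; congr 2; ring
  have hη' := continuous_deriv_smoothTransition
  have hηc := Real.smoothTransition.continuous
  have iW : Integrable fun s => W s * deriv Real.smoothTransition s :=
    (hWc.mul hη').integrable_of_hasCompactSupport
      hasCompactSupport_deriv_smoothTransition.mul_left
  have hPη := IsPrim.of_hasDerivAt hasDerivAt_smoothTransition hη'
  have hPη1 : IsPrim (fun s => 1 - Real.smoothTransition s)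
      (fun s => -deriv Real.smoothTransition s) :=
    IsPrim.of_hasDerivAt (fun s => (hasDerivAt_smoothTransition s).const_sub 1) hη'.neg
  have haL : MemLp (fun s => Real.exp ((n / 2 - α) * s) * l s) 2 := by
    have hm : Measurable fun s => Real.exp ((n / 2 - α) * s) * l s :=
      Measurable.mul (by fun_prop) hd.measurable
    exact (memLp_two_iff_integrable_sq hm.aestronglyMeasurable).2 ha
  have hint : ∀ η : ℝ → ℝ, Continuous η →
      Integrable (fun s => (Real.exp ((n / 2 + α) * s) * η s) ^ 2) →
      Integrable fun s => Real.exp (n * s) * l s * η s := by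
    intro η hη h2
    have hm : Continuous fun s => Real.exp ((n / 2 + α) * s) * η s := by fun_prop
    have h3 := (memLp_two_iff_integrable_sq hm.aestronglyMeasurable).2 h2
    refine (h3.integrable_mul haL).congr (Eventually.of_forall fun s => ?_)
    simp only [Pi.mul_apply]
    rw [← hal]; ring
  constructor
  · intro hm
    have h2 : Integrable fun s =>
        (Real.exp ((n / 2 + α) * s) * (1 - Real.smoothTransition s)) ^ 2 := by
      have h3 : Integrable ((Iic (1 : ℝ)).indicator fun s => Real.exp (2 * (n / 2 + α) * s)) :=
        (integrableOn_exp_mul_Iic (by linarith) 1).integrable_indicator measurableSet_Iic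
      refine h3.mono' (Continuous.aestronglyMeasurable (by fun_prop))
        (Eventually.of_forall fun s => ?_)
      rw [Real.norm_eq_abs, abs_of_nonneg (sq_nonneg _)]
      by_cases hs : s ∈ Iic (1 : ℝ)
      · rw [indicator_of_mem hs, mul_pow, ← Real.exp_nat_mul]
        have h4 := Real.smoothTransition.nonneg s
        have h5 := Real.smoothTransition.le_one s
        have h6 : (1 - Real.smoothTransition s) ^ 2 ≤ 1 := by nlinarith
        calc _ ≤ Real.exp (((2 : ℕ) : ℝ) * ((n / 2 + α) * s)) * 1 := by gcongr
          _ = _ := by rw [mul_one]; congr 1; push_cast; ring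
      · rw [indicator_of_notMem hs]
        have : Real.smoothTransition s = 1 :=
          Real.smoothTransition.one_of_one_le (le_of_not_ge hs)
        simp [this]
    have hlim := hlap (fun s => 1 - Real.smoothTransition s) (by fun_prop)
      (fun x => 1 - cutoff x) (continuous_const.sub contDiff_cutoff.continuous)
      ((radExt_ae_eq hn 0 Real.smoothTransition).mono fun x hx => by
        simp only [cutoff, hx]) h2.lintegral_lt_top
    simp only [hgreen1] at hlim
    have hkey := mul_left_cancel₀ hc0 (tendsto_nhds_unique hlim hgrad)
    have i1 := hint _ (by fun_prop) h2
    have hP := hd.isPrim.mul hPη1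
    have hI : ∫ s, (Real.exp (n * s) * l s * (1 - Real.smoothTransition s) +
        W s * -deriv Real.smoothTransition s) = 0 := by
      have : ∀ s, Real.exp (n * s) * l s * (1 - Real.smoothTransition s) +
        W s * -deriv Real.smoothTransition s = Real.exp (n * s) * l s *
          (1 - Real.smoothTransition s) - W s * deriv Real.smoothTransition s := fun s => by ring
      simp only [this]
      rw [integral_sub i1 iW, hkey, sub_self]
    have iP : Integrable fun s => Real.exp (n * s) * l s * (1 - Real.smoothTransition s) +
        W s * -deriv Real.smoothTransition s := by
      refine (i1.sub iW).congr (Eventually.of_forall fun s => ?_)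
      simp only [Pi.sub_apply]; ring
    have ht := intervalIntegral_tendsto_integral iP tendsto_neg_atTop_atBot tendsto_id
    rw [hI] at ht
    simp only [hP.2, id] at ht
    -- For `r ≥ 1` the factor `1 - smoothTransition` is `0` at `r` and `1` at `-r`, so only the
    -- boundary value `W (-r)` is left.
    have ht2 : Tendsto (fun r : ℝ => W (-r)) atTop (𝓝 (-0)) := by
      refine ht.neg.congr' ?_
      filter_upwards [eventually_ge_atTop 1] with r hr
      rw [Real.smoothTransition.one_of_one_le hr,
        Real.smoothTransition.zero_of_nonpos (by linarith)]
      ring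
    rw [neg_zero] at ht2
    have := ht2.comp tendsto_neg_atBot_atTop
    simpa [Function.comp_def] using this
  · intro hm
    have h2 : Integrable fun s =>
        (Real.exp ((n / 2 + α) * s) * Real.smoothTransition s) ^ 2 := by
      have h3 : Integrable ((Ioi (0 : ℝ)).indicator fun s => Real.exp (2 * (n / 2 + α) * s)) :=
        (integrableOn_exp_mul_Ioi (by linarith) 0).integrable_indicator measurableSet_Ioi
      refine h3.mono' (Continuous.aestronglyMeasurable (by fun_prop))
        (Eventually.of_forall fun s => ?_)
      rw [Real.norm_eq_abs, abs_of_nonneg (sq_nonneg _)]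
      by_cases hs : s ∈ Ioi (0 : ℝ)
      · rw [indicator_of_mem hs, mul_pow, ← Real.exp_nat_mul]
        have h4 := Real.smoothTransition.nonneg s
        have h5 := Real.smoothTransition.le_one s
        have h6 : Real.smoothTransition s ^ 2 ≤ 1 := by nlinarith
        calc _ ≤ Real.exp (((2 : ℕ) : ℝ) * ((n / 2 + α) * s)) * 1 := by gcongr
          _ = _ := by rw [mul_one]; congr 1; push_cast; ring
      · rw [indicator_of_notMem hs]
        have : Real.smoothTransition s = 0 :=
          Real.smoothTransition.zero_of_nonpos (not_lt.1 hs)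
        simp [this]
    have hlim := hlap Real.smoothTransition hηc cutoff contDiff_cutoff.continuous
      (radExt_ae_eq hn 0 Real.smoothTransition) h2.lintegral_lt_top
    simp only [hgreen] at hlim
    have hkey := tendsto_nhds_unique hlim hgrad.neg
    rw [← mul_neg] at hkey
    replace hkey := mul_left_cancel₀ hc0 hkey
    have i1 := hint _ hηc h2
    have hP := hd.isPrim.mul hPη
    have hI : ∫ s, (Real.exp (n * s) * l s * Real.smoothTransition s +
        W s * deriv Real.smoothTransition s) = 0 := by
      rw [integral_add i1 iW, hkey]; ring
    have ht := intervalIntegral_tendsto_integral (i1.add iW) tendsto_neg_atTop_atBot tendsto_id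
    simp only [Pi.add_apply] at ht
    rw [hI] at ht
    simp only [hP.2, id] at ht
    refine ht.congr' ?_
    filter_upwards [eventually_ge_atTop 1] with r hr
    rw [Real.smoothTransition.one_of_one_le hr,
        Real.smoothTransition.zero_of_nonpos (by linarith)]
    ring

/-! ### The inequality for radial elements of the completion. -/

lemma lintegral_exp_mul_eq_top (k : ℝ) : ∫⁻ s, ENNReal.ofReal (Real.exp (k * s)) = ⊤ := by
  by_contra hcon
  have hi : Integrable fun s => Real.exp (k * s) := by
    refine ⟨Continuous.aestronglyMeasurable (by fun_prop), ?_⟩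
    rw [hasFiniteIntegral_iff_ofReal (Eventually.of_forall fun s => (Real.exp_pos _).le)]
    exact lt_top_iff_ne_top.2 hcon
  have h1 := hi.measure_norm_ge_lt_top (ε := 1) one_pos
  have h2 : ∀ s, 0 ≤ k * s → s ∈ {x | (1 : ℝ) ≤ ‖Real.exp (k * x)‖} := fun s hs => by
    rw [mem_ofPred_eq, Real.norm_eq_abs, abs_of_pos (Real.exp_pos _)]
    exact Real.one_le_exp hs
  -- Whatever the sign of `k`, the integrand is at least `1` on a half-line.
  rcases le_total 0 k with hk | hk
  · refine h1.ne (measure_mono_top (s₁ := Ici 0) (fun s hs => h2 s ?_) Real.volume_Ici)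
    exact mul_nonneg hk hs
  · refine h1.ne (measure_mono_top (s₁ := Iic 0) (fun s hs => h2 s ?_) Real.volume_Iic)
    exact mul_nonneg_of_nonpos_of_nonpos hk hs

lemma integrable_of_lintegral_ofReal_lt_top {f : ℝ → ℝ} (hf : AEStronglyMeasurable f)
    (h0 : ∀ s, 0 ≤ f s) (h : ∫⁻ s, ENNReal.ofReal (f s) < ⊤) : Integrable f :=
  ⟨hf, by rwa [hasFiniteIntegral_iff_ofReal (Eventually.of_forall h0)]⟩

lemma lt_top_of_sphereMeasure_mul_lt_top (hn : 1 ≤ n) {a : ℝ≥0∞}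
    (h : sphereMeasure n univ * a < ⊤) : a < ⊤ := by
  refine lt_top_iff_ne_top.2 fun ha => ?_
  rw [ha, ENNReal.mul_top (sphereMeasure_univ_ne_zero hn)] at h
  exact lt_irrefl _ h

/-- The analytic content of membership in the completion for a radial function. -/
structure RadialMem (n : ℕ) (q α β : ℝ) (w W l : ℝ → ℝ) : Prop where
  data : RadialData n w W l
  integrable_sq : Integrable fun s => (Real.exp ((n / 2 - α) * s) * l s) ^ 2
  flux : FluxZero ((n : ℝ) / 2 + α) W
  wInt_lt_top : wInt q β (radGrad W : E n → E n) < ⊤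

theorem MemH2.exists_radialMem (hn : 1 ≤ n) {q α β : ℝ} (hq : 1 < q)
    (hα : 0 < (n : ℝ) - 2 * α) (hβ : 0 < (n : ℝ) - β) {u : E n → ℝ} {G : E n → E n}
    {L : E n → ℝ} (h : MemH2 q α β u G L) (hu : IsRadial u) :
    ∃ w W l : ℝ → ℝ, RadialMem n q α β w W l ∧ (u =ᵐ[volume] fun x => w (Real.log ‖x‖)) ∧
      G =ᵐ[volume] radGrad W ∧ L =ᵐ[volume] fun x => l (Real.log ‖x‖) := by
  obtain ⟨w, W, l, hd, huw, hG, hL⟩ := exists_radialData hn hu h.weakGradient h.weakLaplacian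
  obtain ⟨φ, hφ, hφL, hφG⟩ := h.approx
  have hLfin : wInt 2 (2 * α) L < ⊤ := by
    obtain ⟨k, hk⟩ := (hφL.eventually (gt_mem_nhds one_pos)).exists
    exact wInt_lt_top_of_sub (by norm_num) (continuous_laplacian (hφ k).1).aemeasurable
      (wInt_lt_top_of_continuous hn (by norm_num) hα (continuous_laplacian (hφ k).1)
        (hasCompactSupport_laplacian (hφ k).2)) (hk.trans ENNReal.one_lt_top)
  have hGfin : wInt q β G < ⊤ := by
    obtain ⟨k, hk⟩ := (hφG.eventually (gt_mem_nhds one_pos)).exists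
    exact wInt_lt_top_of_sub hq.le (isTest_continuous_gradient (hφ k)).1.aemeasurable
      (wInt_lt_top_of_continuous hn (by linarith) hβ (isTest_continuous_gradient (hφ k)).1
        (isTest_continuous_gradient (hφ k)).2) (hk.trans ENNReal.one_lt_top)
  rw [wInt_congr_ae hL, wInt_comp_log_norm hn hd.measurable] at hLfin
  rw [wInt_congr_ae hG] at hGfin
  have hm : Measurable fun s => (Real.exp ((n / 2 - α) * s) * l s) ^ 2 := by
    have := hd.measurable
    fun_prop
  have ha := integrable_of_lintegral_ofReal_lt_top hm.aestronglyMeasurable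
    (fun s => sq_nonneg _) (lt_top_of_sphereMeasure_mul_lt_top hn hLfin)
  exact ⟨w, W, l, ⟨hd, ha, h.fluxZero hn hq hd hG hL ha, hGfin⟩, huw, hG, hL⟩

/-- The exponent `κ` of the one dimensional problem. -/
def kap (n : ℕ) (t α β : ℝ) : ℝ := (n - β - (t - 1) * (n - 2 - 2 * α)) / 2

lemma sharpConst_eq {t α β γ : ℝ} (ht : 2 ≤ t) (hbal : γ = (1 + α) / t + β / (2 * t)) :
    sharpConst n t α γ = ((kap n t α β + t * (n / 2 + α)) / t) ^ 2 := by
  have ht0 : t ≠ 0 := by linarith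
  unfold sharpConst kap
  rw [hbal]
  congr 1
  field_simp
  ring

lemma RadialData.isPrim_exp {w W l : ℝ → ℝ} (h : RadialData n w W l) (α : ℝ) :
    IsPrim W fun s => Real.exp (((n : ℝ) / 2 + α) * s) * (Real.exp ((n / 2 - α) * s) * l s) := by
  refine h.isPrim.congr (Eventually.of_forall fun s => ?_)
  simp only
  rw [← mul_assoc, ← Real.exp_add]; congr 2; ring

section

variable {t α β γ : ℝ} {w W l : ℝ → ℝ}

lemma wInt_lap_eq (hn : 1 ≤ n) (hl : Measurable l)
    (ha : Integrable fun s => (Real.exp ((n / 2 - α) * s) * l s) ^ 2) :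
    wInt 2 (2 * α) (fun x : E n => l (Real.log ‖x‖)) = sphereMeasure n univ *
      ENNReal.ofReal (∫ s, (Real.exp ((n / 2 - α) * s) * l s) ^ 2) := by
  rw [wInt_comp_log_norm hn hl, ofReal_integral_eq_lintegral_ofReal ha
    (Eventually.of_forall fun s => sq_nonneg _)]

lemma wInt_grad_dual (hn : 1 ≤ n) (ht : 2 ≤ t) (hW : Measurable W) :
    wInt (2 * (t - 1)) β (radGrad W : E n → E n) = sphereMeasure n univ *
      ∫⁻ s, ENNReal.ofReal (|Real.exp (-(n / 2 + α) * s) * W s| ^ (2 * (t - 1)) *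
        Real.exp (2 * kap n t α β * s)) :=
  wInt_radGrad hn (by linarith) hW (by unfold kap; ring)

/-- The balance condition on `γ` makes the exponent exactly `κ`, half of the one in the dual
integral, as Cauchy–Schwarz requires. -/
lemma wInt_grad_mid (hn : 1 ≤ n) (ht : 2 ≤ t) (hbal : γ = (1 + α) / t + β / (2 * t))
    (hW : Measurable W) :
    wInt t (t * γ) (radGrad W : E n → E n) = sphereMeasure n univ *
      ∫⁻ s, ENNReal.ofReal (|Real.exp (-(n / 2 + α) * s) * W s| ^ t *
        Real.exp (kap n t α β * s)) :=
  wInt_radGrad hn (by linarith) hW (by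
    have ht0 : t ≠ 0 := by linarith
    unfold kap; rw [hbal]; field_simp; ring)

lemma integrable_dual_of_wInt_lt_top (hn : 1 ≤ n) (ht : 2 ≤ t) (hW : Continuous W)
    (h : wInt (2 * (t - 1)) β (radGrad W : E n → E n) < ⊤) :
    Integrable fun s => |Real.exp (-(n / 2 + α) * s) * W s| ^ (2 * (t - 1)) *
        Real.exp (2 * kap n t α β * s) := by
  rw [wInt_grad_dual (α := α) hn ht hW.measurable] at h
  refine integrable_of_lintegral_ofReal_lt_top ?_ (fun s => by positivity)
    (lt_top_of_sphereMeasure_mul_lt_top hn h)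
  have : Continuous fun s => |Real.exp (-(n / 2 + α) * s) * W s| ^ (2 * (t - 1)) :=
    Continuous.rpow_const (by fun_prop) fun s => Or.inr (by linarith)
  exact Continuous.aestronglyMeasurable (by fun_prop)

/-- A vanishing Laplacian forces a vanishing flux. -/
lemma RadialMem.flux_eq_zero (hn : 1 ≤ n) {q : ℝ} (hq : 1 < q) (h : RadialMem n q α β w W l)
    (h0 : wInt 2 (2 * α) (fun x : E n => l (Real.log ‖x‖)) = 0) : W = 0 := by
  rw [wInt_comp_log_norm hn h.data.measurable] at h0
  have h1 := (mul_eq_zero.1 h0).resolve_left (sphereMeasure_univ_ne_zero hn)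
  have hl := h.data.measurable
  rw [lintegral_eq_zero_iff (by fun_prop)] at h1
  have hP : IsPrim W fun _ => 0 := by
    refine h.data.isPrim.congr ?_
    filter_upwards [h1] with s hs
    have h2 : (Real.exp ((n / 2 - α) * s) * l s) ^ 2 ≤ 0 := by simpa using hs
    have h3 : Real.exp ((n / 2 - α) * s) * l s = 0 := by
      nlinarith [sq_nonneg (Real.exp ((n / 2 - α) * s) * l s),
        pow_eq_zero_iff (two_ne_zero) |>.1 (le_antisymm h2 (sq_nonneg _))]
    have h4 : l s = 0 := (mul_eq_zero.1 h3).resolve_left (Real.exp_pos _).ne'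
    simp [h4]
  have hconst : W = fun _ => W 0 := by
    funext s
    have := hP.2 0 s
    simp only [intervalIntegral.integral_zero] at this
    linarith
  suffices W 0 = 0 by rw [hconst, this]; rfl
  rcases lt_trichotomy ((n : ℝ) / 2 + α) 0 with hm | hm | hm
  · have := h.flux.2 hm
    rw [hconst] at this
    exact tendsto_nhds_unique tendsto_const_nhds this
  -- For `m = 0` the condition `FluxZero` is void. A nonzero constant flux is excluded by the finite
  -- gradient norm, whose integrand would be a pure exponential.
  · by_contra hne
    have hfin := h.wInt_lt_top
    rw [wInt_radGrad hn (by linarith) h.data.isPrim.continuous.measurable (m := 0) rfl] at hfin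
    replace hfin := lt_top_of_sphereMeasure_mul_lt_top hn hfin
    rw [hconst] at hfin
    have e : ∀ s, ENNReal.ofReal (|Real.exp (-0 * s) * W 0| ^ q *
        Real.exp ((q * (0 + 1 - n) + n - β) * s)) = ENNReal.ofReal (|W 0| ^ q) *
        ENNReal.ofReal (Real.exp ((q * (0 + 1 - n) + n - β) * s)) := fun s => by
      rw [ENNReal.ofReal_mul (by positivity)]; simp
    simp only [e] at hfin
    rw [lintegral_const_mul _ (by fun_prop), lintegral_exp_mul_eq_top, ENNReal.mul_top] at hfin
    · exact lt_irrefl _ hfin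
    · simp only [ne_eq, ENNReal.ofReal_eq_zero, not_le]
      exact Real.rpow_pos_of_pos (abs_pos.2 hne) _
  · have := h.flux.1 hm
    rw [hconst] at this
    exact tendsto_nhds_unique tendsto_const_nhds this

lemma wInt_radGrad_zero {p σ : ℝ} (hp : 0 < p) : wInt p σ (radGrad 0 : E n → E n) = 0 := by
  simp [wInt, radGrad, ENNReal.zero_rpow_of_pos hp]

lemma wInt_grad_mid_eq (hn : 1 ≤ n) (ht : 2 ≤ t) (hbal : γ = (1 + α) / t + β / (2 * t))
    (hW : Measurable W) (h : Integrable fun s =>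
      |Real.exp (-(n / 2 + α) * s) * W s| ^ t * Real.exp (kap n t α β * s)) :
    wInt t (t * γ) (radGrad W : E n → E n) = sphereMeasure n univ *
      ENNReal.ofReal (∫ s, |Real.exp (-(n / 2 + α) * s) * W s| ^ t *
        Real.exp (kap n t α β * s)) := by
  rw [wInt_grad_mid hn ht hbal hW, ofReal_integral_eq_lintegral_ofReal h
    (Eventually.of_forall fun s => by positivity)]

lemma wInt_grad_dual_eq (hn : 1 ≤ n) (ht : 2 ≤ t)
    (hW : Measurable W) (h : Integrable fun s =>
      |Real.exp (-(n / 2 + α) * s) * W s| ^ (2 * (t - 1)) * Real.exp (2 * kap n t α β * s)) :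
    wInt (2 * (t - 1)) β (radGrad W : E n → E n) = sphereMeasure n univ *
      ENNReal.ofReal (∫ s, |Real.exp (-(n / 2 + α) * s) * W s| ^ (2 * (t - 1)) *
        Real.exp (2 * kap n t α β * s)) := by
  rw [wInt_grad_dual hn ht hW, ofReal_integral_eq_lintegral_ofReal h
    (Eventually.of_forall fun s => by positivity)]

/-- The inequality for radial data. -/
theorem RadialMem.inequality (hn : 1 ≤ n) (ht : 2 ≤ t)
    (hbal : γ = (1 + α) / t + β / (2 * t)) {q : ℝ} (hq : 1 < q) (h : RadialMem n q α β w W l) :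
    ENNReal.ofReal (sharpConst n t α γ) * wInt t (t * γ) (radGrad W : E n → E n) ^ 2 ≤
      wInt 2 (2 * α) (fun x : E n => l (Real.log ‖x‖)) *
        wInt (2 * (t - 1)) β (radGrad W : E n → E n) := by
  have hWc := h.data.isPrim.continuous
  -- With `0 · ∞ = 0`, a vanishing Laplacian integral makes the right side zero even if the other
  -- factor is infinite, so the left side must be shown to vanish too.
  rcases eq_or_ne (wInt 2 (2 * α) (fun x : E n => l (Real.log ‖x‖))) 0 with hA | hA
  · rw [h.flux_eq_zero hn hq hA, wInt_radGrad_zero (by linarith)]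
    simp
  rcases eq_or_ne (wInt (2 * (t - 1)) β (radGrad W : E n → E n)) ⊤ with hB | hB
  · rw [hB, ENNReal.mul_top hA]
    exact le_top
  have hb := integrable_dual_of_wInt_lt_top (α := α) hn ht hWc (lt_top_iff_ne_top.2 hB)
  by_cases hmκ : (n : ℝ) / 2 + α ≠ 0 ∨ kap n t α β ≠ 0
  · have core := (h.data.isPrim_exp α).coreIdentities ht hmκ h.flux h.integrable_sq hb
    have h1 := core.sq_le ht
    rw [wInt_grad_mid_eq hn ht hbal hWc.measurable core.integrable,
      wInt_lap_eq hn h.data.measurable h.integrable_sq,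
      wInt_grad_dual_eq hn ht hWc.measurable hb, sharpConst_eq ht hbal]
    have h2 := ENNReal.ofReal_le_ofReal h1
    rw [ENNReal.ofReal_mul (sq_nonneg _), ENNReal.ofReal_mul (integral_nonneg fun s => sq_nonneg _),
      ENNReal.ofReal_pow (integral_nonneg fun s => by positivity)] at h2
    calc _ = sphereMeasure n univ ^ 2 * (ENNReal.ofReal
          (((kap n t α β + t * (n / 2 + α)) / t) ^ 2) * ENNReal.ofReal
          (∫ s, |Real.exp (-(n / 2 + α) * s) * W s| ^ t * Real.exp (kap n t α β * s)) ^ 2) := by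
          ring
      _ ≤ sphereMeasure n univ ^ 2 * (ENNReal.ofReal
          (∫ s, (Real.exp ((n / 2 - α) * s) * l s) ^ 2) * ENNReal.ofReal
          (∫ s, |Real.exp (-(n / 2 + α) * s) * W s| ^ (2 * (t - 1)) *
            Real.exp (2 * kap n t α β * s))) := by gcongr
      _ = _ := by ring
  -- If `m = κ = 0`, the constant is zero.
  · push Not at hmκ
    rw [sharpConst_eq ht hbal, hmκ.1, hmκ.2]
    simp

end

/-! ### Approximation by test functions through truncated fluxes. -/

/-- A smooth cutoff on the line, equal to `1` on `[-1, 1]` and supported in `[-2, 2]`. -/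
def lineCutoff (s : ℝ) : ℝ := Real.smoothTransition (2 - s) * Real.smoothTransition (2 + s)

lemma contDiff_lineCutoff : ContDiff ℝ ∞ lineCutoff :=
  (contDiff_smoothTransition.comp (contDiff_const.sub contDiff_id)).mul
    (contDiff_smoothTransition.comp (contDiff_const.add contDiff_id))

lemma lineCutoff_nonneg (s : ℝ) : 0 ≤ lineCutoff s :=
  mul_nonneg (Real.smoothTransition.nonneg _) (Real.smoothTransition.nonneg _)

lemma lineCutoff_le_one (s : ℝ) : lineCutoff s ≤ 1 :=
  mul_le_one₀ (Real.smoothTransition.le_one _) (Real.smoothTransition.nonneg _)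
    (Real.smoothTransition.le_one _)

lemma lineCutoff_eq_one {s : ℝ} (h : |s| ≤ 1) : lineCutoff s = 1 := by
  rw [abs_le] at h
  rw [lineCutoff, Real.smoothTransition.one_of_one_le (by linarith),
    Real.smoothTransition.one_of_one_le (by linarith), one_mul]

lemma lineCutoff_eq_zero {s : ℝ} (h : 2 ≤ |s|) : lineCutoff s = 0 := by
  rcases le_abs.1 h with h | h
  · rw [lineCutoff, Real.smoothTransition.zero_of_nonpos (by linarith), zero_mul]
  · rw [lineCutoff, Real.smoothTransition.zero_of_nonpos (x := 2 + s) (by linarith), mul_zero]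

lemma exists_abs_deriv_lineCutoff_le : ∃ M, 0 ≤ M ∧ ∀ s, |deriv lineCutoff s| ≤ M := by
  have hc : HasCompactSupport lineCutoff :=
    HasCompactSupport.of_support_subset_isCompact (isCompact_Icc (a := -2) (b := 2)) fun s hs => by
      rw [mem_Icc, ← abs_le]
      by_contra h
      exact hs (lineCutoff_eq_zero (not_le.1 h).le)
  obtain ⟨M, hM⟩ := (contDiff_lineCutoff.continuous_deriv (by simp)).bounded_above_of_compact_support
    hc.deriv
  exact ⟨M, (norm_nonneg _).trans (hM 0), hM⟩

/-- The flux `W`, truncated to `|s| ≤ 2 (k + 1)`. -/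
def truncFlux (W : ℝ → ℝ) (k : ℕ) (s : ℝ) : ℝ := lineCutoff (s / (k + 1)) * W s

lemma contDiff_truncFlux {W : ℝ → ℝ} (hW : ContDiff ℝ ∞ W) (k : ℕ) :
    ContDiff ℝ ∞ (truncFlux W k) :=
  (contDiff_lineCutoff.comp (contDiff_id.div_const _)).mul hW

lemma truncFlux_eq {W : ℝ → ℝ} {k : ℕ} {s : ℝ} (h : |s| ≤ k + 1) : truncFlux W k s = W s := by
  have hk : (0 : ℝ) < k + 1 := by positivity
  rw [truncFlux, lineCutoff_eq_one, one_mul]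
  rwa [abs_div, abs_of_pos hk, div_le_one hk]

lemma truncFlux_eq_zero {W : ℝ → ℝ} {k : ℕ} {s : ℝ} (h : 2 * ((k : ℝ) + 1) ≤ |s|) :
    truncFlux W k s = 0 := by
  have hk : (0 : ℝ) < k + 1 := by positivity
  rw [truncFlux, lineCutoff_eq_zero, zero_mul]
  rwa [abs_div, abs_of_pos hk, le_div_iff₀ hk]

lemma deriv_truncFlux_eq {W : ℝ → ℝ} {k : ℕ} {s : ℝ} (h : |s| < k + 1) :
    deriv (truncFlux W k) s = deriv W s := by
  refine Filter.EventuallyEq.deriv_eq ?_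
  filter_upwards [continuous_abs.continuousAt.eventually (gt_mem_nhds h)] with x hx
  exact truncFlux_eq hx.le

lemma eventually_abs_lt_add_one (s : ℝ) : ∀ᶠ k : ℕ in atTop, |s| < k + 1 := by
  filter_upwards [(tendsto_natCast_atTop_atTop (R := ℝ)).eventually_gt_atTop |s|] with k hk
  linarith

/-- The rescaled cutoff has derivative at most `M/(k+1) ≤ M`, so the bound is uniform in `k` and
serves for dominated convergence. -/
lemma abs_deriv_truncFlux_le {M : ℝ} (hM : ∀ s, |deriv lineCutoff s| ≤ M) {W : ℝ → ℝ}
    (hW : ContDiff ℝ ∞ W) (k : ℕ) (s : ℝ) :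
    |deriv (truncFlux W k) s| ≤ |deriv W s| + M * |W s| := by
  have hk : (0 : ℝ) < k + 1 := by positivity
  have h1 : HasDerivAt (fun s : ℝ => lineCutoff (s / (k + 1)))
      (deriv lineCutoff (s / (k + 1)) * (1 / (k + 1))) s :=
    ((contDiff_lineCutoff.differentiable (by simp)) _).hasDerivAt.comp s
      ((hasDerivAt_id s).div_const _)
  have h2 := h1.mul ((hW.differentiable (by simp)) s).hasDerivAt
  have h3 : deriv (truncFlux W k) s = _ := h2.deriv
  rw [h3]
  refine (abs_add_le _ _).trans ?_
  rw [abs_mul, abs_mul, abs_mul, add_comm]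
  have e1 : |lineCutoff (s / (k + 1))| ≤ 1 := by
    rw [abs_of_nonneg (lineCutoff_nonneg _)]; exact lineCutoff_le_one _
  have e2 : |1 / ((k : ℝ) + 1)| ≤ 1 := by
    rw [abs_of_pos (by positivity), div_le_one hk]
    linarith [Nat.cast_nonneg (α := ℝ) k]
  have e3 := hM (s / (k + 1))
  have e4 : |deriv lineCutoff (s / (k + 1))| * |1 / ((k : ℝ) + 1)| ≤ M := by
    calc _ ≤ M * 1 := mul_le_mul e3 e2 (abs_nonneg _) ((abs_nonneg _).trans e3)
      _ = M := mul_one M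
  refine add_le_add ?_ (mul_le_mul_of_nonneg_right e4 (abs_nonneg _))
  exact mul_le_of_le_one_left (abs_nonneg _) e1

/-- The Laplacian, in the variable `s`, of a radial function with flux `W`. -/
def radLap (n : ℕ) (W : ℝ → ℝ) (s : ℝ) : ℝ := Real.exp (-(n * s)) * deriv W s

lemma continuous_radLap {W : ℝ → ℝ} (hW : ContDiff ℝ ∞ W) : Continuous (radLap n W) := by
  have := hW.continuous_deriv (by simp)
  unfold radLap
  fun_prop

lemma radialData_of_contDiff_flux {w W : ℝ → ℝ} (hW : ContDiff ℝ ∞ W)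
    (hw : ∀ s, HasDerivAt w (Real.exp (-(n - 2) * s) * W s) s) :
    RadialData n w W (radLap n W) := by
  refine ⟨(continuous_radLap hW).measurable, hw, ?_⟩
  have hc := hW.continuous_deriv (by simp)
  refine (IsPrim.of_hasDerivAt (fun s => ((hW.differentiable (by simp)) s).hasDerivAt) hc).congr
    (Eventually.of_forall fun s => ?_)
  simp only [radLap]
  rw [← mul_assoc, ← Real.exp_add]
  simp

/-- It is the flux that is truncated, not the function: integrating it back from the outer radius
gives a profile that is zero beyond that radius and constant near the origin, hence a test function.
-/
lemma exists_isTest_truncFlux (hn : 1 ≤ n) {W : ℝ → ℝ} (hW : ContDiff ℝ ∞ W) (k : ℕ) :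
    ∃ φ : E n → ℝ, IsTest φ ∧ IsRadial φ ∧ ∇ φ =ᵐ[volume] radGrad (truncFlux W k) ∧
      Δ φ =ᵐ[volume] fun x => radLap n (truncFlux W k) (Real.log ‖x‖) := by
  set R : ℝ := 2 * ((k : ℝ) + 1) with hR
  have hR0 : 0 < R := by positivity
  set θ : ℝ → ℝ := fun s => Real.exp (-(n - 2) * s) * truncFlux W k s with hθ
  have hθd : ContDiff ℝ ∞ θ :=
    (Real.contDiff_exp.comp (contDiff_const.mul contDiff_id)).mul (contDiff_truncFlux hW k)
  have hθ0 : ∀ s, R ≤ |s| → θ s = 0 := fun s hs => by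
    simp only [hθ, truncFlux_eq_zero hs, mul_zero]
  set w : ℝ → ℝ := fun s => ∫ x in R..s, θ x with hw
  have hwd : ∀ s, HasDerivAt w (θ s) s := fun s =>
    intervalIntegral.integral_hasDerivAt_right (hθd.continuous.intervalIntegrable _ _)
      (hθd.continuous.stronglyMeasurableAtFilter _ _) hθd.continuous.continuousAt
  have hwc : ContDiff ℝ ∞ w := by
    rw [contDiff_infty_iff_deriv]
    refine ⟨fun s => (hwd s).differentiableAt, ?_⟩
    rwa [show deriv w = θ from funext fun s => (hwd s).deriv]
  have hb : ∀ s, R ≤ s → w s = 0 := fun s hs => by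
    refine intervalIntegral.integral_zero_ae (Eventually.of_forall fun x hx => hθ0 x ?_)
    rw [uIoc_of_le hs] at hx
    exact hx.1.le.trans (le_abs_self _)
  have ha : ∀ s ≤ -R, w s = w (-R) := fun s hs => by
    have h1 := intervalIntegral.integral_add_adjacent_intervals
      (hθd.continuous.intervalIntegrable R (-R) (μ := volume))
      (hθd.continuous.intervalIntegrable (-R) s)
    have h2 : ∫ x in (-R)..s, θ x = 0 := by
      refine intervalIntegral.integral_zero_ae (Eventually.of_forall fun x hx => hθ0 x ?_)
      rw [uIoc_of_ge hs] at hx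
      rw [abs_of_nonpos (by linarith [hx.2])]
      linarith [hx.2]
    rw [h2, add_zero] at h1
    exact h1.symm
  have hφ := isTest_radExt (n := n) hwc ha hb
  have hae := radExt_ae_eq hn (w (-R)) w
  have hd := radialData_of_contDiff_flux (n := n) (contDiff_truncFlux hW k) hwd
  exact ⟨_, hφ, ⟨fun r => w (Real.log r), hae⟩,
    hφ.hasWeakGradient.ae_eq hn hd.hasWeakGradient hae,
    hφ.hasWeakLaplacian.ae_eq hn (hd.hasWeakLaplacian hn) hae⟩

lemma radGrad_truncFlux (W : ℝ → ℝ) (k : ℕ) (x : E n) :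
    radGrad (truncFlux W k) x = lineCutoff (Real.log ‖x‖ / (k + 1)) • radGrad W x := by
  simp only [radGrad, truncFlux, smul_smul, mul_assoc]

lemma tendsto_wInt_radGrad_truncFlux_sub (hn : 1 ≤ n) {W : ℝ → ℝ} (hW : ContDiff ℝ ∞ W) {p σ : ℝ}
    (hp : 0 < p) (h : wInt p σ (radGrad W : E n → E n) < ⊤) :
    Tendsto (fun k => wInt p σ fun x : E n => radGrad (truncFlux W k) x - radGrad W x)
      atTop (𝓝 0) := by
  have hm : ∀ k, AEStronglyMeasurable (radGrad (truncFlux W k) : E n → E n) := fun k =>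
    aestronglyMeasurable_radGrad hn (contDiff_truncFlux hW k).continuous
  have hm' : AEStronglyMeasurable (radGrad W : E n → E n) :=
    aestronglyMeasurable_radGrad hn hW.continuous
  have := tendsto_lintegral_of_dominated_convergence' (μ := volume)
    (F := fun (k : ℕ) (x : E n) => ‖radGrad (truncFlux W k) x - radGrad W x‖ₑ ^ p *
      ENNReal.ofReal (‖x‖ ^ (-σ))) (f := fun _ => 0)
    (fun x => ‖(radGrad W x : E n)‖ₑ ^ p * ENNReal.ofReal (‖x‖ ^ (-σ)))
    (fun k => ((((hm k).sub hm').enorm).pow_const p).mul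
      (by fun_prop : Measurable fun x : E n => ENNReal.ofReal (‖x‖ ^ (-σ))).aemeasurable)
    (fun k => Eventually.of_forall fun x => ?_) h.ne (Eventually.of_forall fun x => ?_)
  · simpa [wInt] using this
  · beta_reduce
    gcongr
    rw [radGrad_truncFlux, show ∀ (c : ℝ) (v : E n), c • v - v = (c - 1) • v from fun c v => by
      rw [sub_smul, one_smul], enorm_smul]
    refine mul_le_of_le_one_left' ?_
    rw [← ofReal_norm, ENNReal.ofReal_le_one, Real.norm_eq_abs, abs_le]
    constructor <;> linarith [lineCutoff_nonneg (Real.log ‖x‖ / (k + 1)),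
      lineCutoff_le_one (Real.log ‖x‖ / (k + 1))]
  · refine tendsto_const_nhds.congr' ?_
    filter_upwards [eventually_abs_lt_add_one (Real.log ‖x‖)] with k hk
    simp [radGrad, truncFlux_eq hk.le, ENNReal.zero_rpow_of_pos hp]

lemma tendsto_wInt_radGrad_truncFlux (hn : 1 ≤ n) {W : ℝ → ℝ} (hW : ContDiff ℝ ∞ W) {p σ : ℝ}
    (hp : 0 < p) (h : wInt p σ (radGrad W : E n → E n) < ⊤) :
    Tendsto (fun k => wInt p σ (radGrad (truncFlux W k) : E n → E n))
      atTop (𝓝 (wInt p σ (radGrad W : E n → E n))) := by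
  have hm : ∀ k, AEStronglyMeasurable (radGrad (truncFlux W k) : E n → E n) := fun k =>
    aestronglyMeasurable_radGrad hn (contDiff_truncFlux hW k).continuous
  refine tendsto_lintegral_of_dominated_convergence' (μ := volume)
    (F := fun (k : ℕ) (x : E n) => ‖(radGrad (truncFlux W k) x : E n)‖ₑ ^ p *
      ENNReal.ofReal (‖x‖ ^ (-σ)))
    (fun x => ‖(radGrad W x : E n)‖ₑ ^ p * ENNReal.ofReal (‖x‖ ^ (-σ)))
    (fun k => (((hm k).enorm).pow_const p).mul
      (by fun_prop : Measurable fun x : E n => ENNReal.ofReal (‖x‖ ^ (-σ))).aemeasurable)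
    (fun k => Eventually.of_forall fun x => ?_) h.ne (Eventually.of_forall fun x => ?_)
  · beta_reduce
    gcongr
    rw [radGrad_truncFlux, enorm_smul]
    refine mul_le_of_le_one_left' ?_
    rw [← ofReal_norm, ENNReal.ofReal_le_one, Real.norm_eq_abs, abs_le]
    constructor <;> linarith [lineCutoff_nonneg (Real.log ‖x‖ / (k + 1)),
      lineCutoff_le_one (Real.log ‖x‖ / (k + 1))]
  · refine tendsto_const_nhds.congr' ?_
    filter_upwards [eventually_abs_lt_add_one (Real.log ‖x‖)] with k hk
    simp [radGrad, truncFlux_eq hk.le]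

section

variable {α : ℝ} {W : ℝ → ℝ}

lemma exp_mul_radLap (α : ℝ) (V : ℝ → ℝ) (s : ℝ) :
    Real.exp ((n / 2 - α) * s) * radLap n V s = Real.exp (-(n / 2 + α) * s) * deriv V s := by
  rw [radLap, ← mul_assoc, ← Real.exp_add]
  congr 2
  ring

lemma abs_radLap_truncFlux_le {M : ℝ} (hM : ∀ s, |deriv lineCutoff s| ≤ M)
    (hW : ContDiff ℝ ∞ W) (k : ℕ) (s : ℝ) :
    |Real.exp ((n / 2 - α) * s) * radLap n (truncFlux W k) s| ≤
      |Real.exp ((n / 2 - α) * s) * radLap n W s| + M * |Real.exp (-(n / 2 + α) * s) * W s| := by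
  rw [exp_mul_radLap, exp_mul_radLap, abs_mul, abs_mul, abs_mul, Real.abs_exp]
  nlinarith [mul_le_mul_of_nonneg_left (abs_deriv_truncFlux_le hM hW k s)
    (Real.exp_pos (-(n / 2 + α) * s)).le]

lemma radLap_truncFlux_eq {k : ℕ} {s : ℝ} (h : |s| < k + 1) :
    radLap n (truncFlux W k) s = radLap n W s := by
  rw [radLap, radLap, deriv_truncFlux_eq h]

lemma tendsto_wInt_radLap_truncFlux_sub (hn : 1 ≤ n) (hW : ContDiff ℝ ∞ W)
    (ha : Integrable fun s => (Real.exp ((n / 2 - α) * s) * radLap n W s) ^ 2)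
    (hy : Integrable fun s => (Real.exp (-(n / 2 + α) * s) * W s) ^ 2) :
    Tendsto (fun k => wInt 2 (2 * α) fun x : E n => radLap n (truncFlux W k) (Real.log ‖x‖) -
      radLap n W (Real.log ‖x‖)) atTop (𝓝 0) := by
  obtain ⟨M, hM0, hM⟩ := exists_abs_deriv_lineCutoff_le
  have hl := continuous_radLap (n := n) hW
  have hlk := fun k => continuous_radLap (n := n) (contDiff_truncFlux hW k)
  have e : ∀ k, (wInt 2 (2 * α) fun x : E n => radLap n (truncFlux W k) (Real.log ‖x‖) -
      radLap n W (Real.log ‖x‖)) = _ := fun k =>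
    wInt_comp_log_norm hn (l := fun s => radLap n (truncFlux W k) s - radLap n W s)
      ((hlk k).sub hl).measurable
  simp only [e]
  rw [← mul_zero (sphereMeasure n univ)]
  refine ENNReal.Tendsto.const_mul ?_ (Or.inr (sphereMeasure_univ_ne_top))
  -- The derivative of the cutoff falls on `W`, which is why `y` must be in `L²`. The `8` comes from
  -- `(2|B| + M|Y|)² ≤ 2 (2|B|)² + 2 (M|Y|)²`.
  have hbd : Integrable fun s => 8 * (Real.exp ((n / 2 - α) * s) * radLap n W s) ^ 2 +
    2 * M ^ 2 * (Real.exp (-(n / 2 + α) * s) * W s) ^ 2 := (ha.const_mul 8).add (hy.const_mul _)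
  have := tendsto_lintegral_of_dominated_convergence (μ := volume)
    (F := fun (k : ℕ) s => ENNReal.ofReal ((Real.exp ((n / 2 - α) * s) *
      (radLap n (truncFlux W k) s - radLap n W s)) ^ 2)) (f := fun _ => 0)
    (fun s => ENNReal.ofReal (8 * (Real.exp ((n / 2 - α) * s) * radLap n W s) ^ 2 +
      2 * M ^ 2 * (Real.exp (-(n / 2 + α) * s) * W s) ^ 2))
    (fun k => by have := hlk k; exact (Continuous.measurable (by fun_prop)).ennreal_ofReal)
    (fun k => Eventually.of_forall fun s => ?_) hbd.lintegral_lt_top.ne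
    (Eventually.of_forall fun s => ?_)
  · simpa using this
  · refine ENNReal.ofReal_le_ofReal ?_
    have h1 := abs_radLap_truncFlux_le (n := n) (α := α) hM hW k s
    rw [mul_sub]
    set A := Real.exp ((n / 2 - α) * s) * radLap n (truncFlux W k) s
    set B := Real.exp ((n / 2 - α) * s) * radLap n W s
    set Y := Real.exp (-(n / 2 + α) * s) * W s
    have h2 : |A - B| ≤ 2 * |B| + M * |Y| := by linarith [abs_sub A B]
    calc (A - B) ^ 2 = |A - B| ^ 2 := (sq_abs _).symm
      _ ≤ (2 * |B| + M * |Y|) ^ 2 := by gcongr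
      _ ≤ 8 * |B| ^ 2 + 2 * M ^ 2 * |Y| ^ 2 := by nlinarith [sq_nonneg (2 * |B| - M * |Y|)]
      _ = _ := by rw [sq_abs, sq_abs]
  · refine tendsto_const_nhds.congr' ?_
    filter_upwards [eventually_abs_lt_add_one s] with k hk
    simp [radLap_truncFlux_eq hk]

lemma tendsto_wInt_radLap_truncFlux (hn : 1 ≤ n) (hW : ContDiff ℝ ∞ W)
    (ha : Integrable fun s => (Real.exp ((n / 2 - α) * s) * radLap n W s) ^ 2)
    (hy : Integrable fun s => (Real.exp (-(n / 2 + α) * s) * W s) ^ 2) :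
    Tendsto (fun k => wInt 2 (2 * α) fun x : E n => radLap n (truncFlux W k) (Real.log ‖x‖))
      atTop (𝓝 (wInt 2 (2 * α) fun x : E n => radLap n W (Real.log ‖x‖))) := by
  obtain ⟨M, hM0, hM⟩ := exists_abs_deriv_lineCutoff_le
  have hl := continuous_radLap (n := n) hW
  have hlk := fun k => continuous_radLap (n := n) (contDiff_truncFlux hW k)
  rw [wInt_comp_log_norm hn hl.measurable]
  simp only [fun k => wInt_comp_log_norm (α := α) hn (hlk k).measurable]
  refine ENNReal.Tendsto.const_mul ?_ (Or.inr (sphereMeasure_univ_ne_top))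
  have hbd : Integrable fun s => 2 * (Real.exp ((n / 2 - α) * s) * radLap n W s) ^ 2 +
    2 * M ^ 2 * (Real.exp (-(n / 2 + α) * s) * W s) ^ 2 := (ha.const_mul 2).add (hy.const_mul _)
  refine tendsto_lintegral_of_dominated_convergence (μ := volume)
    (F := fun (k : ℕ) s => ENNReal.ofReal ((Real.exp ((n / 2 - α) * s) *
      (radLap n (truncFlux W k) s)) ^ 2))
    (fun s => ENNReal.ofReal (2 * (Real.exp ((n / 2 - α) * s) * radLap n W s) ^ 2 +
      2 * M ^ 2 * (Real.exp (-(n / 2 + α) * s) * W s) ^ 2))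
    (fun k => by have := hlk k; exact (Continuous.measurable (by fun_prop)).ennreal_ofReal)
    (fun k => Eventually.of_forall fun s => ?_) hbd.lintegral_lt_top.ne
    (Eventually.of_forall fun s => ?_)
  · refine ENNReal.ofReal_le_ofReal ?_
    have h1 := abs_radLap_truncFlux_le (n := n) (α := α) hM hW k s
    set A := Real.exp ((n / 2 - α) * s) * radLap n (truncFlux W k) s
    set B := Real.exp ((n / 2 - α) * s) * radLap n W s
    set Y := Real.exp (-(n / 2 + α) * s) * W s
    calc A ^ 2 = |A| ^ 2 := (sq_abs _).symm
      _ ≤ (|B| + M * |Y|) ^ 2 := by gcongr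
      _ ≤ 2 * |B| ^ 2 + 2 * M ^ 2 * |Y| ^ 2 := by nlinarith [sq_nonneg (|B| - M * |Y|)]
      _ = _ := by rw [sq_abs, sq_abs]
  · refine tendsto_const_nhds.congr' ?_
    filter_upwards [eventually_abs_lt_add_one s] with k hk
    simp [radLap_truncFlux_eq hk]

/-- Radial functions with a smooth flux belong to the completion as soon as the integrals
are finite. -/
theorem memH2_of_contDiff_flux (hn : 1 ≤ n) {w : ℝ → ℝ} (hW : ContDiff ℝ ∞ W)
    (hw : ∀ s, HasDerivAt w (Real.exp (-(n - 2) * s) * W s) s)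
    (ha : Integrable fun s => (Real.exp ((n / 2 - α) * s) * radLap n W s) ^ 2)
    (hy : Integrable fun s => (Real.exp (-(n / 2 + α) * s) * W s) ^ 2) {q β : ℝ} (hq : 0 < q)
    (h : wInt q β (radGrad W : E n → E n) < ⊤) :
    MemH2 q α β (fun x : E n => w (Real.log ‖x‖)) (radGrad W)
      fun x => radLap n W (Real.log ‖x‖) := by
  have hd := radialData_of_contDiff_flux (n := n) hW hw
  choose φ hφ _ hG hL using exists_isTest_truncFlux (n := n) hn hW
  refine ⟨hd.hasWeakGradient, hd.hasWeakLaplacian hn, φ, hφ, ?_, ?_⟩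
  · refine (tendsto_wInt_radLap_truncFlux_sub hn hW ha hy).congr fun k => wInt_congr_ae ?_
    filter_upwards [hL k] with x hx
    rw [hx]
  · refine (tendsto_wInt_radGrad_truncFlux_sub hn hW hq h).congr fun k => wInt_congr_ae ?_
    filter_upwards [hG k] with x hx
    rw [hx]

lemma IsTest.memH2 {φ : E n → ℝ} (hφ : IsTest φ) {q β : ℝ} (hq : 0 < q) :
    MemH2 q α β φ (∇ φ) (Δ φ) := by
  refine ⟨hφ.hasWeakGradient, hφ.hasWeakLaplacian, fun _ => φ, fun _ => hφ, ?_, ?_⟩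
  · simp [wInt]
  · simp [wInt, ENNReal.zero_rpow_of_pos hq]

/-- A lower bound for the functional on radial test functions passes to smooth fluxes with finite
integrals. -/
theorem le_of_forall_isTest (hn : 1 ≤ n) (hW : ContDiff ℝ ∞ W)
    (ha : Integrable fun s => (Real.exp ((n / 2 - α) * s) * radLap n W s) ^ 2)
    (hy : Integrable fun s => (Real.exp (-(n / 2 + α) * s) * W s) ^ 2)
    {p σ p' β : ℝ} (hp : 0 < p) (hp' : 0 < p') (hD : wInt p σ (radGrad W : E n → E n) < ⊤)
    (hB : wInt p' β (radGrad W : E n → E n) < ⊤) {C : ℝ}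
    (h : ∀ φ : E n → ℝ, IsTest φ → IsRadial φ →
      ENNReal.ofReal C * wInt p σ (∇ φ) ^ 2 ≤ wInt 2 (2 * α) (Δ φ) * wInt p' β (∇ φ)) :
    ENNReal.ofReal C * wInt p σ (radGrad W : E n → E n) ^ 2 ≤
      wInt 2 (2 * α) (fun x : E n => radLap n W (Real.log ‖x‖)) *
        wInt p' β (radGrad W : E n → E n) := by
  choose φ hφ hr hG hL using exists_isTest_truncFlux (n := n) hn hW
  have hA : wInt 2 (2 * α) (fun x : E n => radLap n W (Real.log ‖x‖)) ≠ ⊤ := by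
    rw [wInt_lap_eq hn (continuous_radLap hW).measurable ha]
    exact ENNReal.mul_ne_top (sphereMeasure_univ_ne_top) ENNReal.ofReal_ne_top
  have hl := ENNReal.Tendsto.const_mul (a := ENNReal.ofReal C)
    (((ENNReal.continuous_pow 2).tendsto _).comp (tendsto_wInt_radGrad_truncFlux hn hW hp hD))
    (Or.inr ENNReal.ofReal_ne_top)
  have hr' := ENNReal.Tendsto.mul (tendsto_wInt_radLap_truncFlux hn hW ha hy) (Or.inr hB.ne)
    (tendsto_wInt_radGrad_truncFlux hn hW hp' hB) (Or.inr hA)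
  refine le_of_tendsto_of_tendsto' hl hr' fun k => ?_
  have := h (φ k) (hφ k) (hr k)
  rwa [wInt_congr_ae (hG k), wInt_congr_ae (hG k), wInt_congr_ae (hL k)] at this

end

/-! ### The one-dimensional profile and its decay. -/

section

variable {t σ θ : ℝ}

open Classical in
/-- The solution of `Z' = -Z ^ (t - 1) e ^ (σ s)` that tends to `1` at `-∞`. -/
def zProf (t σ s : ℝ) : ℝ :=
  if t = 2 then Real.exp (-(Real.exp (σ * s) / σ))
  else (1 + (t - 2) * (Real.exp (σ * s) / σ)) ^ (1 / (2 - t))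

lemma zProf_two (σ s : ℝ) : zProf 2 σ s = Real.exp (-(Real.exp (σ * s) / σ)) := if_pos rfl

lemma zProf_of_lt (ht : 2 < t) (σ s : ℝ) :
    zProf t σ s = (1 + (t - 2) * (Real.exp (σ * s) / σ)) ^ (1 / (2 - t)) := if_neg ht.ne'

lemma one_le_zProf_base (ht : 2 ≤ t) (hσ : 0 < σ) (s : ℝ) :
    1 ≤ 1 + (t - 2) * (Real.exp (σ * s) / σ) := by
  have : 0 ≤ (t - 2) * (Real.exp (σ * s) / σ) := mul_nonneg (by linarith) (by positivity)
  linarith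

lemma zProf_pos (ht : 2 ≤ t) (hσ : 0 < σ) (s : ℝ) : 0 < zProf t σ s := by
  rcases ht.eq_or_lt with rfl | h
  · rw [zProf_two]; exact Real.exp_pos _
  · rw [zProf_of_lt h]
    exact Real.rpow_pos_of_pos (zero_lt_one.trans_le (one_le_zProf_base ht hσ s)) _

lemma zProf_le_one (ht : 2 ≤ t) (hσ : 0 < σ) (s : ℝ) : zProf t σ s ≤ 1 := by
  rcases ht.eq_or_lt with rfl | h
  · rw [zProf_two, Real.exp_le_one_iff, neg_nonpos]; positivity
  · rw [zProf_of_lt h]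
    refine Real.rpow_le_one_of_one_le_of_nonpos (one_le_zProf_base ht hσ s) ?_
    exact div_nonpos_of_nonneg_of_nonpos zero_le_one (by linarith)

lemma contDiff_zProf (ht : 2 ≤ t) (hσ : 0 < σ) : ContDiff ℝ ∞ (zProf t σ) := by
  have he : ContDiff ℝ ∞ fun s => Real.exp (σ * s) / σ :=
    (Real.contDiff_exp.comp (contDiff_const.mul contDiff_id)).div_const _
  rcases ht.eq_or_lt with rfl | h
  · rw [show zProf 2 σ = _ from funext (zProf_two σ)]
    exact Real.contDiff_exp.comp he.neg
  · rw [show zProf t σ = _ from funext (zProf_of_lt h σ)]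
    exact (contDiff_const.add (contDiff_const.mul he)).rpow_const_of_ne
      fun s => (zero_lt_one.trans_le (one_le_zProf_base ht hσ s)).ne'

lemma hasDerivAt_exp_mul_div (hσ : σ ≠ 0) (s : ℝ) :
    HasDerivAt (fun s => Real.exp (σ * s) / σ) (Real.exp (σ * s)) s := by
  have h : HasDerivAt (fun s => σ * s) σ s := by simpa using (hasDerivAt_id s).const_mul σ
  simpa [hσ] using h.exp.div_const σ

lemma hasDerivAt_zProf (ht : 2 ≤ t) (hσ : 0 < σ) (s : ℝ) :
    HasDerivAt (zProf t σ) (-(zProf t σ s ^ (t - 1) * Real.exp (σ * s))) s := by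
  have he := hasDerivAt_exp_mul_div hσ.ne' s
  rcases ht.eq_or_lt with rfl | h
  · rw [show zProf 2 σ = _ from funext (zProf_two σ)]
    refine he.neg.exp.congr_deriv ?_
    rw [show (2 : ℝ) - 1 = 1 by norm_num, Real.rpow_one, Pi.neg_apply]; ring
  · rw [show zProf t σ = _ from funext (zProf_of_lt h σ)]
    have hb := zero_lt_one.trans_le (one_le_zProf_base ht hσ s)
    convert ((he.const_mul (t - 2)).const_add 1).rpow_const (p := 1 / (2 - t)) (Or.inl hb.ne') using 1
    have h1 : 2 - t ≠ 0 := by linarith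
    rw [← Real.rpow_mul hb.le, show 1 / (2 - t) * (t - 1) = 1 / (2 - t) - 1 by field_simp; ring]
    field_simp
    ring

/-- Decay of the profile at `+∞`. -/
lemma exists_zProf_le (ht : 2 ≤ t) (hσ : 0 < σ) (hθ0 : 0 ≤ θ) (hθ : θ * (t - 2) ≤ σ) :
    ∃ C, 0 ≤ C ∧ ∀ s, zProf t σ s ≤ C * Real.exp (-θ * s) ∧
      zProf t σ s ^ (t - 1) * Real.exp (σ * s) ≤ C * Real.exp (-θ * s) := by
  rcases ht.eq_or_lt with rfl | h
  -- The inequality `x ≤ e^x` at `x = e^{σs}/(σp)`, raised to the power `p`.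
  · have key : ∀ p : ℝ, 0 < p → ∀ s, Real.exp (-(Real.exp (σ * s) / σ)) ≤
        (σ * p) ^ p * Real.exp (-(σ * p) * s) := fun p hp s => by
      have h1 : Real.exp (σ * s) / (σ * p) ≤ Real.exp (Real.exp (σ * s) / (σ * p)) := by
        linarith [Real.add_one_le_exp (Real.exp (σ * s) / (σ * p))]
      have h2 := Real.rpow_le_rpow (by positivity) h1 hp.le
      rw [← Real.exp_mul, Real.div_rpow (Real.exp_pos _).le (by positivity), ← Real.exp_mul,
        div_le_iff₀ (by positivity),
        show Real.exp (σ * s) / (σ * p) * p = Real.exp (σ * s) / σ by field_simp] at h2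
      rw [Real.exp_neg, inv_le_iff_one_le_mul₀ (Real.exp_pos _),
        show -(σ * p) * s = -(σ * s * p) by ring, Real.exp_neg]
      rw [show σ * s * p = σ * p * s by ring] at h2
      rw [show σ * s * p = σ * p * s by ring]
      field_simp
      linarith
    -- This makes `σ p = θ + σ`; the surplus `e^{-σs}` absorbs the factor `e^{σs}` of the second
    -- bound.
    set p := θ / σ + 1 with hp
    have hp0 : 0 < p := by positivity
    have hσp : σ * p = θ + σ := by rw [hp]; field_simp
    refine ⟨max 1 ((σ * p) ^ p), by positivity, fun s => ?_⟩
    rw [show (2 : ℝ) - 1 = 1 by norm_num, Real.rpow_one, zProf_two]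
    constructor
    · rcases le_total s 0 with hs | hs
      · calc Real.exp (-(Real.exp (σ * s) / σ)) ≤ 1 * 1 := by
              rw [mul_one, Real.exp_le_one_iff, neg_nonpos]; positivity
          _ ≤ _ := mul_le_mul (le_max_left _ _) (Real.one_le_exp (by nlinarith)) zero_le_one
            (by positivity)
      · refine (key p hp0 s).trans (mul_le_mul (le_max_right _ _) (Real.exp_le_exp.2 ?_)
          (Real.exp_pos _).le (by positivity))
        rw [hσp]; nlinarith
    · calc _ ≤ (σ * p) ^ p * Real.exp (-(σ * p) * s) * Real.exp (σ * s) :=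
            mul_le_mul_of_nonneg_right (key p hp0 s) (Real.exp_pos _).le
        _ = (σ * p) ^ p * Real.exp (-θ * s) := by
            rw [mul_assoc, ← Real.exp_add, hσp]; ring_nf
        _ ≤ _ := mul_le_mul_of_nonneg_right (le_max_right _ _) (Real.exp_pos _).le
  · have ht2 : 0 < t - 2 := by linarith
    set C₀ := ((t - 2) / σ) ^ (1 / (2 - t)) with hC₀
    have hC₀0 : 0 < C₀ := by positivity
    have h1 : ∀ s, zProf t σ s ≤ max 1 C₀ * Real.exp (-θ * s) := fun s => by
      rcases le_total s 0 with hs | hs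
      · calc zProf t σ s ≤ 1 * 1 := by rw [mul_one]; exact zProf_le_one ht hσ s
          _ ≤ _ := mul_le_mul (le_max_left _ _) (Real.one_le_exp (by nlinarith)) zero_le_one
            (by positivity)
      · calc zProf t σ s ≤ ((t - 2) / σ * Real.exp (σ * s)) ^ (1 / (2 - t)) := by
              rw [zProf_of_lt h]
              refine Real.rpow_le_rpow_of_nonpos (by positivity) ?_
                (div_nonpos_of_nonneg_of_nonpos zero_le_one (by linarith))
              rw [div_mul_eq_mul_div, mul_div_assoc]; linarith
          _ = C₀ * Real.exp (-(σ / (t - 2)) * s) := by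
              rw [Real.mul_rpow (by positivity) (Real.exp_pos _).le, ← Real.exp_mul]
              congr 2
              have : 2 - t ≠ 0 := by linarith
              field_simp
              ring
          _ ≤ _ := by
              refine mul_le_mul (le_max_right _ _) (Real.exp_le_exp.2 ?_) (Real.exp_pos _).le
                (by positivity)
              have : θ ≤ σ / (t - 2) := (le_div_iff₀ ht2).2 hθ
              nlinarith
    -- The power `z^{t-2}` is the inverse of the base, at most `σ e^{-σs}/(t-2)`, so the second
    -- bound reduces to the first.
    have h2 : ∀ s, zProf t σ s ^ (t - 1) * Real.exp (σ * s) ≤ σ / (t - 2) * zProf t σ s :=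
      fun s => by
        have hz := zProf_pos ht hσ s
        have hb := zero_lt_one.trans_le (one_le_zProf_base ht hσ s)
        have e : zProf t σ s ^ (t - 1) =
            (1 + (t - 2) * (Real.exp (σ * s) / σ))⁻¹ * zProf t σ s := by
          rw [show t - 1 = (t - 2) + 1 by ring, Real.rpow_add hz, Real.rpow_one]
          congr 1
          rw [zProf_of_lt h, ← Real.rpow_mul hb.le, ← Real.rpow_neg_one]
          congr 1
          have : 2 - t ≠ 0 := by linarith
          field_simp
          ring
        rw [e, mul_right_comm]
        refine mul_le_mul_of_nonneg_right ?_ hz.le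
        rw [inv_mul_le_iff₀ hb]
        have : σ / (t - 2) * ((t - 2) * (Real.exp (σ * s) / σ)) = Real.exp (σ * s) := by
          field_simp
        have h3 : 0 < σ / (t - 2) := by positivity
        nlinarith
    refine ⟨max 1 (σ / (t - 2)) * max 1 C₀, by positivity, fun s => ⟨?_, ?_⟩⟩
    · refine (h1 s).trans ?_
      rw [mul_assoc]
      exact le_mul_of_one_le_left (by positivity) (le_max_left _ _)
    · refine (h2 s).trans ?_
      rw [mul_assoc]
      exact mul_le_mul (le_max_right _ _) (h1 s) (zProf_pos ht hσ s).le (by positivity)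

end

/-! ### The profile in log coordinates: extremal equation and integrability. -/

/-- A continuous function that decays exponentially at both ends is integrable. -/
lemma integrable_of_le_exp {f : ℝ → ℝ} (hf : Continuous f) {a b C : ℝ} (ha : 0 < a) (hb : 0 < b)
    (h1 : ∀ s, |f s| ≤ C * Real.exp (a * s)) (h2 : ∀ s, |f s| ≤ C * Real.exp (-b * s)) :
    Integrable f := by
  rw [← integrableOn_univ, ← Iic_union_Ioi (a := (0 : ℝ))]
  refine IntegrableOn.union ?_ ?_
  · exact Integrable.mono' ((integrableOn_exp_mul_Iic ha 0).const_mul C)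
      hf.aestronglyMeasurable (Eventually.of_forall h1)
  · exact Integrable.mono' ((integrableOn_exp_mul_Ioi (neg_lt_zero.2 hb) 0).const_mul C)
      hf.aestronglyMeasurable (Eventually.of_forall h2)

lemma hasDerivAt_integral_Ioi {f : ℝ → ℝ} (hf : Continuous f) (h : ∀ s, IntegrableOn f (Ioi s))
    (s : ℝ) : HasDerivAt (fun s => ∫ x in Ioi s, f x) (-f s) s := by
  have h1 : (fun s => ∫ x in Ioi s, f x) =
      fun s => (∫ x in Ioi 0, f x) - ∫ x in (0 : ℝ)..s, f x := by
    funext s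
    rw [← intervalIntegral.integral_interval_add_Ioi (h 0) (h s)]
    ring
  rw [h1]
  exact (intervalIntegral.integral_hasDerivAt_right (hf.intervalIntegrable _ _)
    (hf.stronglyMeasurableAtFilter _ _) hf.continuousAt).const_sub _

/-- The exponent `σ` of the profile. -/
def sig (t α β : ℝ) : ℝ := (1 + 2 * α) * (t - 2) + 1 + α - β / 2

/-- The profile in the variable `s = log |x|`. -/
def profLog (t α β s : ℝ) : ℝ :=
  ∫ x in Ioi s, Real.exp ((2 + 2 * α) * x) * zProf t (sig t α β) x

/-- The flux of the profile. -/
def profFlux (n : ℕ) (t α β s : ℝ) : ℝ :=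
  -(Real.exp ((n + 2 * α) * s) * zProf t (sig t α β) s)

lemma profile_eq_profLog (t α β : ℝ) {x : E n} (hx : x ≠ 0) :
    profile t α β x = profLog t α β (Real.log ‖x‖) := by
  have hx0 : 0 < ‖x‖ := norm_pos_iff.2 hx
  have hr : ∀ p s : ℝ, Real.exp s ^ p = Real.exp (p * s) := fun p s => by
    rw [← Real.exp_mul, mul_comm]
  unfold profile profLog
  split_ifs with h
  · subst h
    rw [U₁, ← Real.exp_log hx0, ← integral_comp_exp_Ioi, Real.log_exp]
    refine setIntegral_congr_fun measurableSet_Ioi fun s _ => ?_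
    simp only [zProf_two, hr, smul_eq_mul, sig, sub_self, mul_zero, zero_add]
    rw [← mul_assoc, ← Real.exp_add]
    ring_nf
  · rw [U₂, ← Real.exp_log hx0, ← integral_comp_exp_Ioi, Real.log_exp]
    refine setIntegral_congr_fun measurableSet_Ioi fun s _ => ?_
    simp only [zProf, if_neg h, hr, smul_eq_mul, sig]
    rw [← mul_assoc, ← Real.exp_add]
    ring_nf

/-- Under proportionality the two identities express both other integrals through the dual one, so
equality is mere algebra. -/
lemma CoreIdentities.mul_eq {t κ m c : ℝ} {y a : ℝ → ℝ} (ht : 2 ≤ t)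
    (h : CoreIdentities t κ m y a) (hc : ∀ s, a s - 2 * m * y s = c * dualPow t κ y s) :
    (∫ s, a s ^ 2 = c ^ 2 * ∫ s, |y s| ^ (2 * (t - 1)) * Real.exp (2 * κ * s)) ∧
    (∫ s, a s ^ 2) * (∫ s, |y s| ^ (2 * (t - 1)) * Real.exp (2 * κ * s)) =
      ((κ + t * m) / t) ^ 2 * (∫ s, |y s| ^ t * Real.exp (κ * s)) ^ 2 := by
  have h1 := h.integral_sq
  have h2 := h.integral_mul
  have e : ∀ s, (a s - 2 * m * y s) * dualPow t κ y s =
      c * (|y s| ^ (2 * (t - 1)) * Real.exp (2 * κ * s)) := fun s => by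
    rw [hc, ← dualPow_sq ht]; ring
  simp only [e] at h2
  simp only [hc, mul_pow, dualPow_sq ht] at h1
  rw [integral_const_mul] at h1 h2
  refine ⟨h1.symm, ?_⟩
  rw [← h1, div_pow]
  have ht0 : t ≠ 0 := by linarith
  field_simp
  linear_combination (t * (c * ∫ s, |y s| ^ (2 * (t - 1)) * Real.exp (2 * κ * s)) -
    (κ + t * m) * ∫ s, |y s| ^ t * Real.exp (κ * s)) * h2

/-- Inserting `y = e^{ms} z` in the extremal equation replaces `κ` by this exponent, from which `n`
cancels. -/
lemma sig_eq (n : ℕ) (t α β : ℝ) : sig t α β = kap n t α β + (t - 2) * (n / 2 + α) := by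
  unfold sig kap; ring

section

variable {t α β γ : ℝ}

lemma contDiff_profFlux (ht : 2 ≤ t) (hσ : 0 < sig t α β) : ContDiff ℝ ∞ (profFlux n t α β) :=
  ((Real.contDiff_exp.comp (contDiff_const.mul contDiff_id)).mul (contDiff_zProf ht hσ)).neg

lemma hasDerivAt_exp_const_mul (k s : ℝ) :
    HasDerivAt (fun s => Real.exp (k * s)) (k * Real.exp (k * s)) s := by
  have h : HasDerivAt (fun s => k * s) k s := by simpa using (hasDerivAt_id s).const_mul k
  simpa [mul_comm] using h.exp

lemma exp_mul_profFlux (s : ℝ) : Real.exp (-(n / 2 + α) * s) * profFlux n t α β s =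
    -(Real.exp ((n / 2 + α) * s) * zProf t (sig t α β) s) := by
  rw [profFlux, mul_neg, ← mul_assoc, ← Real.exp_add]
  ring_nf

lemma exp_mul_radLap_profFlux (ht : 2 ≤ t) (hσ : 0 < sig t α β) (s : ℝ) :
    Real.exp ((n / 2 - α) * s) * radLap n (profFlux n t α β) s =
      Real.exp ((n / 2 + α) * s) *
        (zProf t (sig t α β) s ^ (t - 1) * Real.exp (sig t α β * s)) -
      2 * (n / 2 + α) * (Real.exp ((n / 2 + α) * s) * zProf t (sig t α β) s) := by
  have h : deriv (profFlux n t α β) s = _ := ((hasDerivAt_exp_const_mul (n + 2 * α) s).mul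
    (hasDerivAt_zProf ht hσ s)).neg.deriv
  have e : Real.exp ((n + 2 * α) * s) =
      Real.exp ((n / 2 + α) * s) * Real.exp ((n / 2 + α) * s) := by
    rw [← Real.exp_add]; ring_nf
  have e' : Real.exp (-(n / 2 + α) * s) * Real.exp ((n / 2 + α) * s) = 1 := by
    rw [← Real.exp_add, ← add_mul]; simp
  rw [exp_mul_radLap, h, e]
  linear_combination (Real.exp ((n / 2 + α) * s) *
        (zProf t (sig t α β) s ^ (t - 1) * Real.exp (sig t α β * s)) -
      2 * (n / 2 + α) * (Real.exp ((n / 2 + α) * s) * zProf t (sig t α β) s)) * e'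

lemma dualPow_profFlux (ht : 2 ≤ t) (hσ : 0 < sig t α β) (s : ℝ) :
    dualPow t (kap n t α β) (fun s => Real.exp (-(n / 2 + α) * s) * profFlux n t α β s) s =
      -(Real.exp ((n / 2 + α) * s) *
        (zProf t (sig t α β) s ^ (t - 1) * Real.exp (sig t α β * s))) := by
  have hz := zProf_pos ht hσ s
  simp only [dualPow, exp_mul_profFlux]
  rw [abs_neg, abs_of_pos (by positivity), Real.mul_rpow (Real.exp_pos _).le hz.le,
    ← Real.exp_mul, show t - 1 = (t - 2) + 1 by ring, Real.rpow_add hz, Real.rpow_one,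
    show sig t α β * s = (n / 2 + α) * s * (t - 2) + kap n t α β * s by rw [sig_eq n]; ring,
    Real.exp_add ((n / 2 + α) * s * (t - 2))]
  ring

/-- This is the proportionality of the equality case in Cauchy–Schwarz; it encodes the differential
equation of `zProf`. -/
lemma profFlux_sub_eq (ht : 2 ≤ t) (hσ : 0 < sig t α β) (s : ℝ) :
    Real.exp ((n / 2 - α) * s) * radLap n (profFlux n t α β) s -
      2 * (n / 2 + α) * (Real.exp (-(n / 2 + α) * s) * profFlux n t α β s) =
    -1 * dualPow t (kap n t α β)
      (fun s => Real.exp (-(n / 2 + α) * s) * profFlux n t α β s) s := by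
  rw [dualPow_profFlux ht hσ, exp_mul_radLap_profFlux ht hσ, exp_mul_profFlux]
  ring

/-- The admissible decay rates of the profile. -/
lemma exists_decay_rate (ht : 2 ≤ t) (hσ : 0 < sig t α β) (h2 : t < 3 + α - β / 2)
    (h4 : 2 < t → (n : ℝ) - β < 2 * (t - 1) / (t - 2) * (1 + α - β / 2)) :
    ∃ θ : ℝ, 0 ≤ θ ∧ θ * (t - 2) ≤ sig t α β ∧ (n : ℝ) / 2 + α < θ ∧ 2 + 2 * α < θ ∧
      (((n : ℝ) - β) * (t - 2) < 2 * (1 + α - β / 2) →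
        (n : ℝ) / 2 + α + (1 + α - β / 2) < θ) := by
  rcases ht.eq_or_lt with rfl | h
  -- For `t = 2` the decay is faster than any exponential and the constraint `θ (t - 2) ≤ σ` is
  -- void, so any large rate will do.
  · refine ⟨max 0 (max (n / 2 + α) (max (2 + 2 * α) (n / 2 + α + (1 + α - β / 2)))) + 1,
      by positivity, ?_, ?_, ?_, fun _ => ?_⟩
    · rw [sub_self, mul_zero]; exact hσ.le
    · exact lt_add_of_le_of_pos ((le_max_left _ _).trans (le_max_right _ _)) one_pos
    · exact lt_add_of_le_of_pos ((le_max_left _ _).trans ((le_max_right _ _).trans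
        (le_max_right _ _))) one_pos
    · exact lt_add_of_le_of_pos ((le_max_right _ _).trans ((le_max_right _ _).trans
        (le_max_right _ _))) one_pos
  · have hp : 0 < t - 2 := by linarith
    have h4' := h4 h
    rw [div_mul_eq_mul_div, lt_div_iff₀ hp] at h4'
    -- This is the largest rate allowed. After multiplication by `t - 2`, the three lower bounds are
    -- exactly `h4'`, `h2` and `h5`. They serve, in this order, the square integrability of `y`, the
    -- convergence of the integral defining the profile, and the gradient norm with exponent `2`.
    refine ⟨sig t α β / (t - 2), by positivity, (div_mul_cancel₀ _ hp.ne').le, ?_, ?_,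
      fun h5 => ?_⟩
    all_goals rw [lt_div_iff₀ hp]; unfold sig; nlinarith

/-- What is needed about the flux of the profile. -/
structure ProfBounds (n : ℕ) (t α β : ℝ) : Prop where
  hasDerivAt : ∀ s, HasDerivAt (profLog t α β)
    (Real.exp (-(n - 2) * s) * profFlux n t α β s) s
  integrable_sq : Integrable fun s => (Real.exp (-(n / 2 + α) * s) * profFlux n t α β s) ^ 2
  integrable_lap : Integrable fun s =>
    (Real.exp ((n / 2 - α) * s) * radLap n (profFlux n t α β) s) ^ 2
  integrable_dual : Integrable fun s =>
    |Real.exp (-(n / 2 + α) * s) * profFlux n t α β s| ^ (2 * (t - 1)) *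
      Real.exp (2 * kap n t α β * s)
  integrable_two : ((n : ℝ) - β) * (t - 2) < 2 * (1 + α - β / 2) → Integrable fun s =>
    |Real.exp (-(n / 2 + α) * s) * profFlux n t α β s| ^ (2 : ℝ) *
      Real.exp ((2 * (n / 2 + α + 1 - n) + n - β) * s)

theorem profBounds (ht : 2 ≤ t) (hσ : 0 < sig t α β) (h2 : t < 3 + α - β / 2)
    (h3 : 0 < (n : ℝ) + 2 * α)
    (h4 : 2 < t → (n : ℝ) - β < 2 * (t - 1) / (t - 2) * (1 + α - β / 2)) :
    ProfBounds n t α β := by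
  obtain ⟨θ, hθ0, hθ, hθ1, hθ2, hθ3⟩ := exists_decay_rate (n := n) ht hσ h2 h4
  obtain ⟨C, hC0, hC⟩ := exists_zProf_le ht hσ hθ0 hθ
  set σ := sig t α β with hσdef
  have hZ := (contDiff_zProf ht hσ).continuous
  have hZ0 := zProf_pos ht hσ
  have hZ1 := zProf_le_one ht hσ
  -- Decay at `-∞` comes from the exponential weights, because `zProf` tends to `1` there.
  have hm : 0 < (n : ℝ) / 2 + α := by linarith
  have hZp : Continuous fun s => zProf t σ s ^ (t - 1) := hZ.rpow_const fun s => Or.inl (hZ0 s).ne'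
  have sq_exp : ∀ k s : ℝ, Real.exp (k * s) ^ 2 = Real.exp (2 * k * s) := fun k s => by
    rw [← Real.exp_nat_mul]; push_cast; ring_nf
  -- a squared exponential weight against a function with the decay of the profile
  have key : ∀ (k j : ℝ) (f : ℝ → ℝ), Continuous f → (∀ s, 0 ≤ f s) → 0 ≤ j → 0 < k → k < θ →
      (∀ s, f s ≤ Real.exp (j * s)) → (∀ s, f s ≤ C * Real.exp (-θ * s)) →
      Integrable fun s => (Real.exp (k * s) * f s) ^ 2 := by
    intro k j f hf hf0 hj hk hkθ hf1 hf2
    refine integrable_of_le_exp (a := 2 * (k + j)) (b := 2 * (θ - k)) (C := max 1 (C ^ 2))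
      (by fun_prop) (by linarith) (by linarith) (fun s => ?_) (fun s => ?_)
    · rw [abs_of_nonneg (sq_nonneg _)]
      calc (Real.exp (k * s) * f s) ^ 2 ≤ (Real.exp (k * s) * Real.exp (j * s)) ^ 2 := by
            have := hf0 s
            have := hf1 s
            gcongr
        _ = 1 * Real.exp (2 * (k + j) * s) := by
            rw [← Real.exp_add, ← add_mul, sq_exp, one_mul]
        _ ≤ _ := mul_le_mul_of_nonneg_right (le_max_left _ _) (Real.exp_pos _).le
    · rw [abs_of_nonneg (sq_nonneg _)]
      calc (Real.exp (k * s) * f s) ^ 2 ≤ (Real.exp (k * s) * (C * Real.exp (-θ * s))) ^ 2 := by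
            have := hf0 s
            have := hf2 s
            gcongr
        _ = C ^ 2 * Real.exp (-(2 * (θ - k)) * s) := by
            rw [mul_left_comm, mul_pow, ← Real.exp_add, ← add_mul, sq_exp]; ring_nf
        _ ≤ _ := mul_le_mul_of_nonneg_right (le_max_right _ _) (Real.exp_pos _).le
  have hZ1' : ∀ s, zProf t σ s ≤ Real.exp (0 * s) := fun s => by simpa using hZ1 s
  have hy : Integrable fun s => (Real.exp (-(n / 2 + α) * s) * profFlux n t α β s) ^ 2 := by
    simp only [exp_mul_profFlux, neg_sq]
    exact key _ 0 _ hZ (fun s => (hZ0 s).le) le_rfl hm hθ1 hZ1' fun s => (hC s).1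
  have hP : Integrable fun s => (Real.exp (((n : ℝ) / 2 + α) * s) *
      (zProf t σ s ^ (t - 1) * Real.exp (σ * s))) ^ 2 := by
    refine key _ σ _ (by fun_prop) (fun s => by have := hZ0 s; positivity) hσ.le hm hθ1
      (fun s => ?_) fun s => (hC s).2
    exact mul_le_of_le_one_left (Real.exp_pos _).le
      (Real.rpow_le_one (hZ0 s).le (hZ1 s) (by linarith))
  refine ⟨fun s => ?_, hy, ?_, ?_, fun h5 => ?_⟩
  · have hi : ∀ s, IntegrableOn (fun x => Real.exp ((2 + 2 * α) * x) * zProf t σ x) (Ioi s) :=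
      fun s => by
        refine Integrable.mono' ((integrableOn_exp_mul_Ioi
          (a := 2 + 2 * α - θ) (by linarith) s).const_mul C)
          (Continuous.aestronglyMeasurable (by fun_prop)) (Eventually.of_forall fun x => ?_)
        rw [Real.norm_eq_abs, abs_of_pos (mul_pos (Real.exp_pos _) (hZ0 x)), sub_mul, sub_eq_add_neg,
          Real.exp_add, mul_left_comm, ← neg_mul]
        exact mul_le_mul_of_nonneg_left (hC x).1 (Real.exp_pos _).le
    refine (hasDerivAt_integral_Ioi (by fun_prop) hi s).congr_deriv ?_
    rw [profFlux, mul_neg, ← mul_assoc, ← Real.exp_add, ← hσdef]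
    ring_nf
  · simp only [exp_mul_radLap_profFlux ht hσ]
    refine Integrable.mono' ((hP.const_mul 2).add (hy.const_mul (8 * (n / 2 + α) ^ 2)))
      (Continuous.aestronglyMeasurable (by fun_prop)) (Eventually.of_forall fun s => ?_)
    simp only [Pi.add_apply, exp_mul_profFlux]
    rw [Real.norm_eq_abs, abs_of_nonneg (sq_nonneg _)]
    nlinarith [sq_nonneg (Real.exp (((n : ℝ) / 2 + α) * s) *
      (zProf t σ s ^ (t - 1) * Real.exp (σ * s)) +
      2 * (n / 2 + α) * (Real.exp ((n / 2 + α) * s) * zProf t σ s))]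
  · refine hP.congr (Eventually.of_forall fun s => ?_)
    simp only
    rw [← dualPow_sq (y := fun s => Real.exp (-(n / 2 + α) * s) * profFlux n t α β s) ht,
      dualPow_profFlux ht hσ, neg_sq]
  · refine (key (n / 2 + α + (1 + α - β / 2)) 0 _ hZ (fun s => (hZ0 s).le) le_rfl (by linarith)
      (hθ3 h5) hZ1' fun s => (hC s).1).congr (Eventually.of_forall fun s => ?_)
    simp only [exp_mul_profFlux]
    rw [Real.rpow_two, sq_abs, neg_sq, mul_pow, mul_pow, sq_exp, sq_exp,
      mul_right_comm (Real.exp _), ← Real.exp_add, ← hσdef]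
    ring_nf

end

/-! ### The profile attains the constant; sharpness and dilations. -/

lemma HasWeakGradient.congr {u u' : E n → ℝ} {G : E n → E n} (h : HasWeakGradient u G)
    (hu : u =ᵐ[volume] u') : HasWeakGradient u' G := by
  refine ⟨h.1.congr (ae_restrict_of_ae hu), h.2.1, fun ψ hψ hs e => ?_⟩
  rw [← h.2.2 ψ hψ hs e]
  refine integral_congr_ae ?_
  filter_upwards [hu] with x hx
  rw [hx]

lemma HasWeakLaplacian.congr {u u' L : E n → ℝ} (h : HasWeakLaplacian u L)
    (hu : u =ᵐ[volume] u') : HasWeakLaplacian u' L := by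
  refine ⟨h.1.congr (ae_restrict_of_ae hu), h.2.1, fun ψ hψ hs => ?_⟩
  rw [← h.2.2 ψ hψ hs]
  refine integral_congr_ae ?_
  filter_upwards [hu] with x hx
  rw [hx]

lemma MemH2.congr {q α β : ℝ} {u u' L : E n → ℝ} {G : E n → E n} (h : MemH2 q α β u G L)
    (hu : u =ᵐ[volume] u') : MemH2 q α β u' G L :=
  ⟨h.weakGradient.congr hu, h.weakLaplacian.congr hu, h.approx⟩

section

variable {t α β γ : ℝ}

lemma profLog_ae_eq (hn : 1 ≤ n) (t α β : ℝ) :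
    (fun x : E n => profLog t α β (Real.log ‖x‖)) =ᵐ[volume] profile t α β := by
  filter_upwards [ae_ne_zero hn] with x hx
  exact (profile_eq_profLog t α β hx).symm

lemma integral_pos_of_pos {f : ℝ → ℝ} (hi : Integrable f)
    (h0 : ∀ s, 0 < f s) : 0 < ∫ s, f s := by
  refine (integral_pos_iff_support_of_nonneg (fun s => (h0 s).le) hi).2 ?_
  rw [show Function.support f = univ from eq_univ_of_forall fun s => (h0 s).ne']
  simp

/-- The three integrals of the profile. -/
theorem ProfBounds.exists_values (hn : 1 ≤ n) (ht : 2 ≤ t) (hσ : 0 < sig t α β)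
    (hbal : γ = (1 + α) / t + β / (2 * t)) (h : ProfBounds n t α β) :
    ∃ b d : ℝ, 0 < b ∧ 0 < d ∧ b ^ 2 = sharpConst n t α γ * d ^ 2 ∧
      wInt 2 (2 * α) (fun x : E n => radLap n (profFlux n t α β) (Real.log ‖x‖)) =
        sphereMeasure n univ * ENNReal.ofReal b ∧
      wInt (2 * (t - 1)) β (radGrad (profFlux n t α β) : E n → E n) =
        sphereMeasure n univ * ENNReal.ofReal b ∧
      wInt t (t * γ) (radGrad (profFlux n t α β) : E n → E n) =
        sphereMeasure n univ * ENNReal.ofReal d := by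
  have hW := contDiff_profFlux (n := n) ht hσ
  have hd := radialData_of_contDiff_flux (n := n) hW h.hasDerivAt
  have core := (hd.isPrim_exp α).expWeighted.coreIdentities_of_integrable_sq ht
    h.integrable_lap h.integrable_sq h.integrable_dual
  obtain ⟨e1, e2⟩ := core.mul_eq ht (profFlux_sub_eq ht hσ)
  -- The proportionality factor is `-1`, so the Laplacian and dual integrals have the same value
  -- `b`.
  rw [neg_one_sq, one_mul] at e1
  rw [e1] at e2
  have hy : ∀ s, 0 < |Real.exp (-(n / 2 + α) * s) * profFlux n t α β s| := fun s => by
    rw [exp_mul_profFlux, abs_neg]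
    exact abs_pos.2 (mul_pos (Real.exp_pos _) (zProf_pos ht hσ s)).ne'
  refine ⟨_, _, integral_pos_of_pos h.integrable_dual
    fun s => mul_pos (Real.rpow_pos_of_pos (hy s) _) (Real.exp_pos _),
    integral_pos_of_pos core.integrable
    fun s => mul_pos (Real.rpow_pos_of_pos (hy s) _) (Real.exp_pos _), ?_, ?_,
    wInt_grad_dual_eq hn ht hW.continuous.measurable h.integrable_dual,
    wInt_grad_mid_eq hn ht hbal hW.continuous.measurable core.integrable⟩
  · rw [sq, e2, sharpConst_eq ht hbal]
  · rw [wInt_lap_eq hn hd.measurable h.integrable_lap, e1]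

lemma ofReal_mul_sq_eq {c : ℝ≥0∞} {C b d : ℝ} (hC : 0 ≤ C) (hb : 0 < b) (hd : 0 < d)
    (h : b ^ 2 = C * d ^ 2) : c * ENNReal.ofReal b * (c * ENNReal.ofReal b) =
      ENNReal.ofReal C * (c * ENNReal.ofReal d) ^ 2 := by
  have h1 : ENNReal.ofReal b ^ 2 = ENNReal.ofReal C * ENNReal.ofReal d ^ 2 := by
    rw [← ENNReal.ofReal_pow hb.le, h, ENNReal.ofReal_mul hC, ENNReal.ofReal_pow hd.le]
  calc _ = c ^ 2 * ENNReal.ofReal b ^ 2 := by ring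
    _ = _ := by rw [h1]; ring

lemma sharpConst_nonneg (n : ℕ) (t α γ : ℝ) : 0 ≤ sharpConst n t α γ := sq_nonneg _

/-- The constant cannot be improved on radial test functions. -/
theorem ProfBounds.le_sharpConst (hn : 1 ≤ n) (ht : 2 ≤ t) (hσ : 0 < sig t α β)
    (hbal : γ = (1 + α) / t + β / (2 * t)) (h : ProfBounds n t α β) {C : ℝ}
    (hC : ∀ φ : E n → ℝ, IsTest φ → IsRadial φ →
      ENNReal.ofReal C * wInt t (t * γ) (∇ φ) ^ 2 ≤
        wInt 2 (2 * α) (Δ φ) * wInt (2 * (t - 1)) β (∇ φ)) :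
    C ≤ sharpConst n t α γ := by
  obtain ⟨b, d, hb, hd, hbd, eA, eB, eD⟩ := h.exists_values hn ht hσ hbal
  have hfin : ∀ r : ℝ, sphereMeasure n univ * ENNReal.ofReal r < ⊤ := fun r =>
    ENNReal.mul_lt_top (lt_top_iff_ne_top.2 sphereMeasure_univ_ne_top) ENNReal.ofReal_lt_top
  -- The lower bound passes from truncations to the profile, which need not itself belong to the
  -- space for the given `q`. There equality holds, with a finite nonzero factor to cancel.
  have key := le_of_forall_isTest hn (contDiff_profFlux ht hσ) h.integrable_lap h.integrable_sq
    (p := t) (σ := t * γ) (p' := 2 * (t - 1)) (β := β) (by linarith) (by linarith)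
    (eD ▸ hfin d) (eB ▸ hfin b) hC
  rw [eA, eB, eD, ofReal_mul_sq_eq (sharpConst_nonneg n t α γ) hb hd hbd] at key
  have h0 : (sphereMeasure n univ * ENNReal.ofReal d) ^ 2 ≠ 0 := by
    refine pow_ne_zero 2 (mul_ne_zero (sphereMeasure_univ_ne_zero hn) ?_)
    simpa using hd
  have h1 : (sphereMeasure n univ * ENNReal.ofReal d) ^ 2 ≠ ⊤ := ENNReal.pow_ne_top (hfin d).ne
  exact (ENNReal.ofReal_le_ofReal_iff (sharpConst_nonneg n t α γ)).1
    ((ENNReal.mul_le_mul_iff_left h0 h1).1 key)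

/-- The profile attains the constant. -/
theorem ProfBounds.attained (hn : 1 ≤ n) (ht : 2 ≤ t) (hσ : 0 < sig t α β)
    (hbal : γ = (1 + α) / t + β / (2 * t)) (h : ProfBounds n t α β) :
    ∃ (G : E n → E n) (L : E n → ℝ),
      HasWeakGradient (profile t α β) G ∧ HasWeakLaplacian (profile t α β) L ∧
      (0 < wInt 2 (2 * α) L ∧ wInt 2 (2 * α) L < ⊤) ∧
      (0 < wInt (2 * (t - 1)) β G ∧ wInt (2 * (t - 1)) β G < ⊤) ∧
      (0 < wInt t (t * γ) G ∧ wInt t (t * γ) G < ⊤) ∧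
      wInt 2 (2 * α) L * wInt (2 * (t - 1)) β G =
        ENNReal.ofReal (sharpConst n t α γ) * wInt t (t * γ) G ^ 2 ∧
      MemH2 (2 * (t - 1)) α β (profile t α β) G L ∧
      (((n : ℝ) - β) * (t - 2) < 2 * (1 + α - β / 2) → MemH2 2 α β (profile t α β) G L) := by
  obtain ⟨b, d, hb, hd, hbd, eA, eB, eD⟩ := h.exists_values hn ht hσ hbal
  have hW := contDiff_profFlux (n := n) ht hσ
  have hfin : ∀ r : ℝ, sphereMeasure n univ * ENNReal.ofReal r < ⊤ := fun r =>
    ENNReal.mul_lt_top (lt_top_iff_ne_top.2 sphereMeasure_univ_ne_top) ENNReal.ofReal_lt_top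
  have hpos : ∀ r : ℝ, 0 < r → 0 < sphereMeasure n univ * ENNReal.ofReal r := fun r hr =>
    pos_iff_ne_zero.2 (mul_ne_zero (sphereMeasure_univ_ne_zero hn) (by simpa using hr))
  have hmem := (memH2_of_contDiff_flux hn hW h.hasDerivAt h.integrable_lap h.integrable_sq
    (q := 2 * (t - 1)) (β := β) (by linarith) (eB ▸ hfin b)).congr (profLog_ae_eq hn t α β)
  refine ⟨_, _, hmem.weakGradient, hmem.weakLaplacian, ?_, ?_, ?_, ?_, hmem, fun h5 => ?_⟩
  · rw [eA]; exact ⟨hpos b hb, hfin b⟩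
  · rw [eB]; exact ⟨hpos b hb, hfin b⟩
  · rw [eD]; exact ⟨hpos d hd, hfin d⟩
  · rw [eA, eB, eD]
    exact ofReal_mul_sq_eq (sharpConst_nonneg n t α γ) hb hd hbd
  · refine (memH2_of_contDiff_flux hn hW h.hasDerivAt h.integrable_lap h.integrable_sq
      (by norm_num) ?_).congr (profLog_ae_eq hn t α β)
    rw [wInt_radGrad (m := n / 2 + α) hn (by norm_num) hW.continuous.measurable rfl]
    exact ENNReal.mul_lt_top (lt_top_iff_ne_top.2 sphereMeasure_univ_ne_top)
      (h.integrable_two h5).lintegral_lt_top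

/-- A dilation by `e^τ` in `x` is a translation by `τ` in `s`, and Lebesgue measure on the line is
translation invariant. -/
lemma wInt_radGrad_shift (hn : 1 ≤ n) {p σ m k : ℝ} (hp : 0 ≤ p) {W : ℝ → ℝ} (hW : Measurable W)
    (hk : k = p * (m + 1 - n) + n - σ) (C τ : ℝ) :
    wInt p σ (radGrad (fun s => C * W (s + τ)) : E n → E n) =
      ENNReal.ofReal ((|C| * Real.exp (m * τ)) ^ p * Real.exp (-(k * τ))) *
        wInt p σ (radGrad W : E n → E n) := by
  rw [wInt_radGrad (m := m) hn hp (by fun_prop) hk, wInt_radGrad hn hp hW hk,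
    mul_left_comm]
  congr 1
  rw [← lintegral_const_mul _ (by fun_prop)]
  refine Eq.trans (lintegral_congr fun s => ?_) (lintegral_add_right_eq_self _ τ)
  rw [← ENNReal.ofReal_mul (by positivity)]
  congr 1
  have e1 : |Real.exp (-m * s) * (C * W (s + τ))| =
      |C| * Real.exp (m * τ) * |Real.exp (-m * (s + τ)) * W (s + τ)| := by
    rw [abs_mul, abs_mul, abs_mul, Real.abs_exp, Real.abs_exp,
      show -m * s = m * τ + -m * (s + τ) by ring, Real.exp_add]
    ring
  have e2 : Real.exp (k * s) = Real.exp (-(k * τ)) * Real.exp (k * (s + τ)) := by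
    rw [← Real.exp_add]; ring_nf
  rw [e1, e2, Real.mul_rpow (by positivity) (by positivity)]
  ring

lemma wInt_radLap_shift (hn : 1 ≤ n) {W : ℝ → ℝ} (hW : ContDiff ℝ ∞ W) (C τ : ℝ) :
    wInt 2 (2 * α) (fun x : E n => radLap n (fun s => C * W (s + τ)) (Real.log ‖x‖)) =
      ENNReal.ofReal ((|C| * Real.exp ((n / 2 + α) * τ)) ^ 2) *
        wInt 2 (2 * α) (fun x : E n => radLap n W (Real.log ‖x‖)) := by
  have hl := (continuous_radLap (n := n) hW).measurable
  have hs : ContDiff ℝ ∞ fun s => C * W (s + τ) :=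
    contDiff_const.mul (hW.comp (contDiff_id.add contDiff_const))
  rw [wInt_comp_log_norm hn (continuous_radLap hs).measurable, wInt_comp_log_norm hn hl,
    mul_left_comm]
  congr 1
  rw [← lintegral_const_mul _ (by fun_prop)]
  refine Eq.trans (lintegral_congr fun s => ?_) (lintegral_add_right_eq_self _ τ)
  rw [← ENNReal.ofReal_mul (by positivity)]
  congr 1
  have hd : deriv (fun s => C * W (s + τ)) s = C * deriv W (s + τ) := by
    rw [deriv_const_mul_field, deriv_comp_add_const]
  rw [exp_mul_radLap, exp_mul_radLap, hd, ← mul_pow, ← sq_abs, ← sq_abs (_ * _)]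
  congr 1
  rw [abs_mul, abs_mul, abs_mul, abs_mul, abs_mul, Real.abs_exp, Real.abs_exp, Real.abs_exp, abs_abs,
    show -(n / 2 + α) * s = (n / 2 + α) * τ + -(n / 2 + α) * (s + τ) by ring, Real.exp_add]
  ring

/-- Multiples of dilations of the profile satisfy the equality. -/
theorem ProfBounds.eq_of_ae_eq (hn : 1 ≤ n) (ht : 2 ≤ t) (hσ : 0 < sig t α β)
    (hbal : γ = (1 + α) / t + β / (2 * t)) (h : ProfBounds n t α β) {u L : E n → ℝ}
    {G : E n → E n} (hG : HasWeakGradient u G) (hL : HasWeakLaplacian u L) {c d lam : ℝ}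
    (hlam : 0 < lam) (hu : u =ᵐ[volume] fun x => c * profile t α β (lam • x) + d) :
    wInt (2 * (t - 1)) β G < ⊤ ∧ wInt 2 (2 * α) L * wInt (2 * (t - 1)) β G =
      ENNReal.ofReal (sharpConst n t α γ) * wInt t (t * γ) G ^ 2 := by
  set τ := Real.log lam with hτ
  -- The flux is `e^{(n-2)s} w'`, so translating the profile by `τ` leaves this factor in front of
  -- the translated flux.
  set C := c * Real.exp (-(n - 2) * τ) with hC
  have hW := contDiff_profFlux (n := n) ht hσ
  have hs : ContDiff ℝ ∞ fun s => C * profFlux n t α β (s + τ) :=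
    contDiff_const.mul (hW.comp (contDiff_id.add contDiff_const))
  have hd := radialData_of_contDiff_flux (n := n) (w := fun s => c * profLog t α β (s + τ) + d) hs
    fun s => by
      refine ((((h.hasDerivAt (s + τ)).comp_add_const s τ).const_mul c).add_const d).congr_deriv ?_
      rw [hC, show -((n : ℝ) - 2) * (s + τ) = -(n - 2) * s + -(n - 2) * τ by ring, Real.exp_add]
      ring
  have hu' : u =ᵐ[volume] fun x => c * profLog t α β (Real.log ‖x‖ + τ) + d := by
    filter_upwards [hu, ae_ne_zero hn] with x hx hx0
    rw [hx, profile_eq_profLog t α β (smul_ne_zero hlam.ne' hx0), norm_smul, Real.norm_eq_abs,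
      abs_of_pos hlam, Real.log_mul hlam.ne' (norm_ne_zero_iff.2 hx0), add_comm τ]
  have eG := hG.ae_eq hn hd.hasWeakGradient hu'
  have eL := hL.ae_eq hn (hd.hasWeakLaplacian hn) hu'
  obtain ⟨b, d', hb, hd', hbd, eA, eB, eD⟩ := h.exists_values hn ht hσ hbal
  rw [wInt_congr_ae eG, wInt_congr_ae eG, wInt_congr_ae eL, wInt_radLap_shift hn hW,
    wInt_radGrad_shift (m := n / 2 + α) (k := 2 * kap n t α β) hn (by linarith)
      hW.continuous.measurable (by unfold kap; ring),
    wInt_radGrad_shift (m := n / 2 + α) (k := kap n t α β) hn (by linarith)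
      hW.continuous.measurable (by
        have ht0 : t ≠ 0 := by linarith
        unfold kap; rw [hbal]; field_simp; ring), eA, eB, eD]
  constructor
  · exact ENNReal.mul_lt_top ENNReal.ofReal_lt_top
      (ENNReal.mul_lt_top (lt_top_iff_ne_top.2 sphereMeasure_univ_ne_top) ENNReal.ofReal_lt_top)
  set C₁ := |C| * Real.exp ((n / 2 + α) * τ) with hC₁
  have hC₁0 : 0 ≤ C₁ := by positivity
  -- Both sides scale alike: the powers of `C₁` add up to `2t`, and the exponentials to `e^{-2κτ}`.
  have e : C₁ ^ 2 * (C₁ ^ (2 * (t - 1)) * Real.exp (-(2 * kap n t α β * τ))) =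
      (C₁ ^ t * Real.exp (-(kap n t α β * τ))) ^ 2 := by
    have e1 : C₁ ^ 2 * C₁ ^ (2 * (t - 1)) = (C₁ ^ t) ^ 2 := by
      rw [← Real.rpow_two, ← Real.rpow_two, ← Real.rpow_mul hC₁0,
        ← Real.rpow_add_of_nonneg hC₁0 (by norm_num) (by linarith)]
      ring_nf
    have e2 : Real.exp (-(2 * kap n t α β * τ)) = Real.exp (-(kap n t α β * τ)) ^ 2 := by
      rw [← Real.exp_nat_mul]; push_cast; ring_nf
    rw [e2, mul_pow (C₁ ^ t), ← e1]; ring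
  have e' : ENNReal.ofReal (C₁ ^ 2) *
      ENNReal.ofReal (C₁ ^ (2 * (t - 1)) * Real.exp (-(2 * kap n t α β * τ))) =
      ENNReal.ofReal (C₁ ^ t * Real.exp (-(kap n t α β * τ))) ^ 2 := by
    rw [← ENNReal.ofReal_mul (by positivity), e, ENNReal.ofReal_pow (by positivity)]
  have e'' := ofReal_mul_sq_eq (c := sphereMeasure n univ) (sharpConst_nonneg n t α γ) hb hd' hbd
  calc _ = (ENNReal.ofReal (C₁ ^ 2) *
      ENNReal.ofReal (C₁ ^ (2 * (t - 1)) * Real.exp (-(2 * kap n t α β * τ)))) *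
      (sphereMeasure n univ * ENNReal.ofReal b * (sphereMeasure n univ * ENNReal.ofReal b)) := by
        ring
    _ = _ := by rw [e', e'']; ring

end

/-! ### The equality case. -/

/-- A positive integral from a continuous nonnegative integrand that does not vanish. -/
lemma integral_pos_of_exists {f : ℝ → ℝ} (hf : Continuous f) (h0 : ∀ s, 0 ≤ f s)
    (hi : Integrable f) (h : ∃ s, f s ≠ 0) : 0 < ∫ s, f s :=
  (integral_pos_iff_support_of_nonneg h0 hi).2 (hf.isOpen_support.measure_pos volume h)

/-- A solution of a linear equation `z' = g z` is an exponential. -/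
lemma eq_mul_exp_of_hasDerivAt {z g : ℝ → ℝ} (hg : Continuous g)
    (h : ∀ s, HasDerivAt z (g s * z s) s) (s : ℝ) :
    z s = z 0 * Real.exp (∫ x in (0 : ℝ)..s, g x) := by
  set J : ℝ → ℝ := fun s => ∫ x in (0 : ℝ)..s, g x with hJ
  have hJd : ∀ s, HasDerivAt J (g s) s := fun s =>
    intervalIntegral.integral_hasDerivAt_right (hg.intervalIntegrable _ _)
      (hg.stronglyMeasurableAtFilter _ _) hg.continuousAt
  have hd : ∀ s, HasDerivAt (fun s => z s * Real.exp (-J s)) 0 s := fun s => by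
    refine ((h s).mul (hJd s).fun_neg.exp).congr_deriv ?_
    ring
  have hc := is_const_of_deriv_eq_zero (fun s => (hd s).differentiableAt)
    (fun s => (hd s).deriv) s 0
  simp only [hJ, intervalIntegral.integral_same, neg_zero, Real.exp_zero, mul_one] at hc
  rw [← hc, mul_assoc, ← Real.exp_add]
  simp

/-- The solutions of the equation satisfied by extremals. -/
theorem eq_zProf_of_hasDerivAt {t σ c m : ℝ} (ht : 2 ≤ t) (hσ : 0 < σ) (hc : 0 < c) {z : ℝ → ℝ}
    (hz : ∃ s, z s ≠ 0)
    (h : ∀ s, HasDerivAt z (-(c * |z s| ^ (t - 2) * Real.exp (σ * s)) * z s) s)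
    (hi : Integrable fun s => (Real.exp (m * s) * z s) ^ 2) :
    ∃ z₀ τ : ℝ, ∀ s, z s = z₀ * zProf t σ (s + τ) := by
  have hzc : Continuous z := continuous_iff_continuousAt.2 fun s => (h s).continuousAt
  have hzp : Continuous fun s => |z s| ^ (t - 2) :=
    hzc.abs.rpow_const fun s => Or.inr (by linarith)
  have hg : Continuous fun s => -(c * |z s| ^ (t - 2) * Real.exp (σ * s)) := by fun_prop
  -- Read as a linear equation with a coefficient that depends on `z`, the equation shows that `z`
  -- never vanishes and keeps its sign.
  have he := eq_mul_exp_of_hasDerivAt hg h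
  have hz0 : z 0 ≠ 0 := fun h0 => by
    obtain ⟨s, hs⟩ := hz
    rw [he s, h0, zero_mul] at hs
    exact hs rfl
  set J : ℝ → ℝ := fun s => ∫ x in (0 : ℝ)..s, -(c * |z x| ^ (t - 2) * Real.exp (σ * x)) with hJ
  replace he : ∀ s, z s = z 0 * Real.exp (J s) := he
  rcases ht.eq_or_lt with rfl | ht2
  · have hJs : ∀ s, J s = c / σ - c * (Real.exp (σ * s) / σ) := fun s => by
      have := intervalIntegral.integral_eq_sub_of_hasDerivAt (a := 0) (b := s)
        (f := fun s => -(c * (Real.exp (σ * s) / σ)))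
        (f' := fun x => -(c * |z x| ^ ((2 : ℝ) - 2) * Real.exp (σ * x)))
        (fun x _ => ((hasDerivAt_exp_mul_div hσ.ne' x).const_mul c).fun_neg.congr_deriv (by simp))
        (hg.intervalIntegrable _ _)
      rw [hJ]
      simp only at this ⊢
      rw [this]
      simp only [mul_zero, Real.exp_zero]
      ring
    -- The translation absorbs the constant: `e^{στ} = c`.
    refine ⟨z 0 * Real.exp (c / σ), Real.log c / σ, fun s => ?_⟩
    rw [he s, hJs, zProf_two, mul_assoc, ← Real.exp_add, mul_add,
      mul_div_cancel₀ _ hσ.ne', Real.exp_add (σ * s), Real.exp_log hc]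
    ring_nf
  · have hv : ∀ s, |z s| = |z 0| * Real.exp (J s) := fun s => by
      rw [he s, abs_mul, Real.abs_exp]
    have hvpos : ∀ s, 0 < |z s| := fun s => by
      rw [hv]; exact mul_pos (abs_pos.2 hz0) (Real.exp_pos _)
    have hJd : ∀ s, HasDerivAt J (-(c * |z s| ^ (t - 2) * Real.exp (σ * s))) s := fun s =>
      intervalIntegral.integral_hasDerivAt_right (hg.intervalIntegrable _ _)
        (hg.stronglyMeasurableAtFilter _ _) hg.continuousAt
    have hvd : ∀ s, HasDerivAt (fun s => |z s|)
        (|z s| * -(c * |z s| ^ (t - 2) * Real.exp (σ * s))) s := fun s => by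
      rw [show (fun s => |z s|) = _ from funext hv]
      refine ((hJd s).exp.const_mul |z 0|).congr_deriv ?_
      rw [hv s]; ring
    -- Bernoulli substitution: the derivative of `|z|^{2-t}` is `(t-2) c e^{σs}`, free of `z`.
    have hpd : ∀ s, HasDerivAt (fun s => |z s| ^ (2 - t) - (t - 2) * (c * (Real.exp (σ * s) / σ)))
        0 s := fun s => by
      refine (((hvd s).rpow_const (p := 2 - t) (Or.inl (hvpos s).ne')).sub
        (((hasDerivAt_exp_mul_div hσ.ne' s).const_mul c).const_mul (t - 2))).congr_deriv ?_
      have e : |z s| * |z s| ^ (t - 2) * |z s| ^ (2 - t - 1) = 1 := by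
        nth_rewrite 1 [← Real.rpow_one |z s|]
        rw [← Real.rpow_add (hvpos s), ← Real.rpow_add (hvpos s)]
        ring_nf
        exact Real.rpow_zero _
      linear_combination (t - 2) * c * Real.exp (σ * s) * e
    have hconst : ∀ s, |z s| ^ (2 - t) =
        (|z 0| ^ (2 - t) - (t - 2) * (c / σ)) + (t - 2) * (c * (Real.exp (σ * s) / σ)) :=
      fun s => by
        have := is_const_of_deriv_eq_zero (fun s => (hpd s).differentiableAt)
          (fun s => (hpd s).deriv) s 0
        simp only [mul_zero, Real.exp_zero, mul_one_div] at this
        linarith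
    set C := |z 0| ^ (2 - t) - (t - 2) * (c / σ) with hC
    have ht2' : 0 < t - 2 := by linarith
    have hinv : ∀ s, |z s| = (|z s| ^ (2 - t)) ^ (1 / (2 - t)) := fun s => by
      rw [← Real.rpow_mul (hvpos s).le, mul_one_div_cancel (by linarith), Real.rpow_one]
    -- `C` is the limit at `-∞` of the positive function `|z|^{2-t}`.
    have hC0 : 0 ≤ C := by
      have hlim : Tendsto (fun s => C + (t - 2) * (c * (Real.exp (σ * s) / σ))) atBot (𝓝 C) := by
        have h1 : Tendsto (fun s => Real.exp (σ * s)) atBot (𝓝 0) :=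
          Real.tendsto_exp_atBot.comp (tendsto_id.const_mul_atBot hσ)
        simpa using (((h1.div_const σ).const_mul c).const_mul (t - 2)).const_add C
      refine ge_of_tendsto' hlim fun s => ?_
      rw [← hconst]; positivity
    -- If `C = 0`, then `|z|` is a multiple of an exponential, and so is the integrand in `hi`,
    -- which is not integrable on the line.
    have hC1 : 0 < C := by
      refine lt_of_le_of_ne hC0 fun hC0' => ?_
      have e : ∀ s, ENNReal.ofReal ((Real.exp (m * s) * z s) ^ 2) =
          ENNReal.ofReal ((((t - 2) * (c / σ)) ^ (1 / (2 - t))) ^ 2) *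
            ENNReal.ofReal (Real.exp (2 * (m + σ * (1 / (2 - t))) * s)) := fun s => by
        rw [← ENNReal.ofReal_mul (by positivity)]
        congr 1
        rw [mul_pow, ← sq_abs (z s), hinv s, hconst s, ← hC0', zero_add,
          show (t - 2) * (c * (Real.exp (σ * s) / σ)) = (t - 2) * (c / σ) * Real.exp (σ * s) by ring,
          Real.mul_rpow (by positivity) (Real.exp_pos _).le, ← Real.exp_mul, mul_pow,
          mul_left_comm, ← mul_pow, ← Real.exp_add, ← Real.exp_nat_mul]
        congr 2
        push_cast
        ring
      have hlt := hi.lintegral_lt_top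
      simp only [e] at hlt
      rw [lintegral_const_mul _ (by fun_prop), lintegral_exp_mul_eq_top, ENNReal.mul_top] at hlt
      · exact lt_irrefl _ hlt
      · have : 0 < (((t - 2) * (c / σ)) ^ (1 / (2 - t))) ^ 2 := by positivity
        simpa using this.ne'
    -- The power of `C` is factored out of the solution, and `e^{στ} = c/C`.
    refine ⟨z 0 / |z 0| * C ^ (1 / (2 - t)), Real.log (c / C) / σ, fun s => ?_⟩
    have e1 : z s = z 0 / |z 0| * |z s| := by
      have := (abs_pos.2 hz0).ne'
      rw [hv s, he s]
      field_simp
    rw [e1, mul_assoc]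
    congr 1
    rw [hinv s, hconst s, zProf_of_lt ht2, mul_add, mul_div_cancel₀ _ hσ.ne', Real.exp_add,
      Real.exp_log (by positivity), ← Real.mul_rpow hC0 (by positivity)]
    congr 1
    field_simp

section

variable {t α β γ : ℝ} {w W l : ℝ → ℝ}

/-- The equation of extremals, in integrated form. -/
lemma CoreIdentities.exists_eq_mul_dualPow {κ m : ℝ} {y a : ℝ → ℝ} (ht : 2 ≤ t)
    (hκ : 0 < κ + t * m) (h : CoreIdentities t κ m y a) (hyc : Continuous y) (hy : ∃ s, y s ≠ 0)
    (hb : Integrable fun s => |y s| ^ (2 * (t - 1)) * Real.exp (2 * κ * s))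
    (heq : (∫ s, a s ^ 2) * (∫ s, |y s| ^ (2 * (t - 1)) * Real.exp (2 * κ * s)) =
      ((κ + t * m) / t) ^ 2 * (∫ s, |y s| ^ t * Real.exp (κ * s)) ^ 2) :
    ∃ c, 0 < c ∧ (fun s => a s - 2 * m * y s) =ᵐ[volume] fun s => -c * dualPow t κ y s := by
  have ht0 : 0 < t := by linarith
  have hpos : ∀ p k : ℝ, 0 ≤ p → Integrable (fun s => |y s| ^ p * Real.exp (k * s)) →
      0 < ∫ s, |y s| ^ p * Real.exp (k * s) := fun p k hp hi => by
    have hc : Continuous fun s => |y s| ^ p := hyc.abs.rpow_const fun s => Or.inr hp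
    refine integral_pos_of_exists (by fun_prop) (fun s => by positivity) hi ?_
    obtain ⟨s, hs⟩ := hy
    exact ⟨s, (mul_pos (Real.rpow_pos_of_pos (abs_pos.2 hs) _) (Real.exp_pos _)).ne'⟩
  have hB := hpos _ _ (by linarith) hb
  have hD := hpos _ _ ht0.le h.integrable
  have h2 : ∫ s, (a s - 2 * m * y s) * dualPow t κ y s =
      -((κ + t * m) / t * ∫ s, |y s| ^ t * Real.exp (κ * s)) := by
    have := h.integral_mul
    field_simp
    linarith
  have hQ : ∫ s, dualPow t κ y s ^ 2 = ∫ s, |y s| ^ (2 * (t - 1)) * Real.exp (2 * κ * s) := by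
    simp only [dualPow_sq ht]
  have key := ae_eq_of_integral_mul_sq_eq h.memLp_left h.memLp_right (by rw [hQ]; exact hB)
    (by rw [h2, hQ, h.integral_sq, heq]; ring)
  rw [h2, hQ] at key
  refine ⟨(κ + t * m) / t * (∫ s, |y s| ^ t * Real.exp (κ * s)) /
    ∫ s, |y s| ^ (2 * (t - 1)) * Real.exp (2 * κ * s), by positivity, ?_⟩
  simpa only [neg_div] using key

/-- Radial functions with equality have the flux of a multiple of a dilation of the profile. -/
theorem RadialMem.exists_flux_eq (hn : 1 ≤ n) (ht : 2 ≤ t) (hσ : 0 < sig t α β)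
    (h3 : 0 < (n : ℝ) + 2 * α) (hbal : γ = (1 + α) / t + β / (2 * t)) {q : ℝ}
    (h : RadialMem n q α β w W l) (hB : wInt (2 * (t - 1)) β (radGrad W : E n → E n) < ⊤)
    (heq : wInt 2 (2 * α) (fun x : E n => l (Real.log ‖x‖)) *
        wInt (2 * (t - 1)) β (radGrad W : E n → E n) =
      ENNReal.ofReal (sharpConst n t α γ) * wInt t (t * γ) (radGrad W : E n → E n) ^ 2) :
    ∃ C τ : ℝ, ∀ s, W s = C * profFlux n t α β (s + τ) := by
  by_cases hW0 : W = 0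
  · exact ⟨0, 0, fun s => by simp [hW0]⟩
  have hm : 0 < (n : ℝ) / 2 + α := by linarith
  -- This number is `σ + 2m`. Its positivity gives the constant `c` below its sign.
  have hκ : 0 < kap n t α β + t * (n / 2 + α) := by
    have := sig_eq n t α β
    nlinarith
  have hWc := h.data.isPrim.continuous
  have hb := integrable_dual_of_wInt_lt_top (α := α) hn ht hWc hB
  have core := (h.data.isPrim_exp α).coreIdentities ht (Or.inl hm.ne') h.flux h.integrable_sq hb
  have hy2 := (h.data.isPrim_exp α).integrable_sq_of_fluxZero hm.ne' h.flux h.integrable_sq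
  have hyP := (h.data.isPrim_exp α).expWeighted
  rw [wInt_grad_mid_eq hn ht hbal hWc.measurable core.integrable,
    wInt_lap_eq hn h.data.measurable h.integrable_sq,
    wInt_grad_dual_eq hn ht hWc.measurable hb, sharpConst_eq ht hbal] at heq
  set y : ℝ → ℝ := fun s => Real.exp (-(n / 2 + α) * s) * W s with hydef
  have hyc : Continuous y := by fun_prop
  have hy0 : ∃ s, y s ≠ 0 := by
    obtain ⟨s, hs⟩ := Function.ne_iff.1 hW0
    exact ⟨s, mul_ne_zero (Real.exp_pos _).ne' hs⟩
  have heq' : (∫ s, (Real.exp ((n / 2 - α) * s) * l s) ^ 2) *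
      (∫ s, |y s| ^ (2 * (t - 1)) * Real.exp (2 * kap n t α β * s)) =
      ((kap n t α β + t * (n / 2 + α)) / t) ^ 2 *
        (∫ s, |y s| ^ t * Real.exp (kap n t α β * s)) ^ 2 := by
    have e1 : sphereMeasure n univ ^ 2 * ENNReal.ofReal
        ((∫ s, (Real.exp ((n / 2 - α) * s) * l s) ^ 2) *
        (∫ s, |y s| ^ (2 * (t - 1)) * Real.exp (2 * kap n t α β * s))) =
        sphereMeasure n univ ^ 2 * ENNReal.ofReal (((kap n t α β + t * (n / 2 + α)) / t) ^ 2 *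
        (∫ s, |y s| ^ t * Real.exp (kap n t α β * s)) ^ 2) := by
      rw [ENNReal.ofReal_mul (integral_nonneg fun s => sq_nonneg _),
        ENNReal.ofReal_mul (sq_nonneg _),
        ENNReal.ofReal_pow (integral_nonneg fun s => by positivity)]
      calc _ = _ := by ring
        _ = _ := heq
        _ = _ := by ring
    have e2 := (ENNReal.mul_right_inj (pow_ne_zero 2 (sphereMeasure_univ_ne_zero hn))
      (ENNReal.pow_ne_top sphereMeasure_univ_ne_top)).1 e1
    refine (ENNReal.ofReal_eq_ofReal_iff (mul_nonneg (integral_nonneg fun s => sq_nonneg _)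
      (integral_nonneg fun s => by positivity)) (by positivity)).1 e2
  obtain ⟨c, hc, hae⟩ := core.exists_eq_mul_dualPow ht hκ hyc hy0 hb heq'
  have hdual : Continuous (dualPow t (kap n t α β) y) := continuous_dualPow ht hyc
  -- The almost everywhere equation becomes classical because its right side is continuous.
  have hyd : ∀ s, HasDerivAt y (-c * dualPow t (kap n t α β) y s + (n / 2 + α) * y s) s := by
    refine (hyP.congr ?_).hasDerivAt (by fun_prop)
    filter_upwards [hae] with s hs
    linarith
  -- The factor `e^{-ms}` removes the linear term `m y` and leaves the Bernoulli equation with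
  -- exponent `σ`.
  obtain ⟨z₀, τ, hz⟩ := eq_zProf_of_hasDerivAt (m := n / 2 + α) ht hσ hc
    (z := fun s => Real.exp (-(n / 2 + α) * s) * y s)
    (by
      obtain ⟨s, hs⟩ := hy0
      exact ⟨s, mul_ne_zero (Real.exp_pos _).ne' hs⟩)
    (fun s => by
      refine ((hasDerivAt_exp_const_mul (-(n / 2 + α)) s).mul (hyd s)).congr_deriv ?_
      have e : sig t α β * s = kap n t α β * s + (n / 2 + α) * s * (t - 2) := by
        rw [sig_eq n]; ring
      have e' : -((n : ℝ) / 2 + α) * s * (t - 2) = -((n / 2 + α) * s * (t - 2)) := by ring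
      rw [abs_mul, Real.abs_exp, Real.mul_rpow (Real.exp_pos _).le (abs_nonneg _),
        ← Real.exp_mul, e, Real.exp_add, e', dualPow, Real.exp_neg ((n / 2 + α) * s * (t - 2))]
      field_simp
      ring)
    (by
      refine hy2.congr (Eventually.of_forall fun s => ?_)
      change y s ^ 2 = (Real.exp ((n / 2 + α) * s) * (Real.exp (-(n / 2 + α) * s) * y s)) ^ 2
      rw [← mul_assoc, ← Real.exp_add, ← add_mul, add_neg_cancel, zero_mul, Real.exp_zero, one_mul])
  refine ⟨-(z₀ * Real.exp (-((n + 2 * α) * τ))), τ, fun s => ?_⟩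
  have e1 : W s = Real.exp ((n + 2 * α) * s) * (Real.exp (-(n / 2 + α) * s) * y s) := by
    rw [hydef, ← mul_assoc, ← mul_assoc, ← Real.exp_add, ← Real.exp_add]
    ring_nf
    simp
  have e2 : Real.exp ((n + 2 * α) * s) =
      Real.exp (-((n + 2 * α) * τ)) * Real.exp ((n + 2 * α) * (s + τ)) := by
    rw [← Real.exp_add]; ring_nf
  rw [e1, hz s, e2, profFlux]
  ring

/-- The equality case for radial data. -/
theorem RadialMem.exists_eq_profLog (hn : 1 ≤ n) (ht : 2 ≤ t) (hσ : 0 < sig t α β)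
    (h3 : 0 < (n : ℝ) + 2 * α) (hbal : γ = (1 + α) / t + β / (2 * t)) {q : ℝ}
    (hp : ProfBounds n t α β)
    (h : RadialMem n q α β w W l) (hB : wInt (2 * (t - 1)) β (radGrad W : E n → E n) < ⊤)
    (heq : wInt 2 (2 * α) (fun x : E n => l (Real.log ‖x‖)) *
        wInt (2 * (t - 1)) β (radGrad W : E n → E n) =
      ENNReal.ofReal (sharpConst n t α γ) * wInt t (t * γ) (radGrad W : E n → E n) ^ 2) :
    ∃ c d τ : ℝ, ∀ s, w s = c * profLog t α β (s + τ) + d := by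
  obtain ⟨C, τ, hC⟩ := h.exists_flux_eq hn ht hσ h3 hbal hB heq
  set c := C * Real.exp ((n - 2) * τ) with hc
  have hd : ∀ s, HasDerivAt (fun s => w s - c * profLog t α β (s + τ)) 0 s := fun s => by
    refine ((h.data.hasDerivAt s).sub
      (((hp.hasDerivAt (s + τ)).comp_add_const s τ).const_mul c)).congr_deriv ?_
    rw [hC, hc, show -((n : ℝ) - 2) * s = (n - 2) * τ + -(n - 2) * (s + τ) by ring, Real.exp_add]
    ring
  refine ⟨c, w 0 - c * profLog t α β (0 + τ), τ, fun s => ?_⟩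
  have := is_const_of_deriv_eq_zero (fun s => (hd s).differentiableAt) (fun s => (hd s).deriv) s 0
  linarith

/-- The equality case. -/
theorem MemH2.exists_ae_eq_profile (hn : 1 ≤ n) (ht : 2 ≤ t) (hα : 0 < (n : ℝ) - 2 * α)
    (hβ : 0 < (n : ℝ) - β) (hσ : 0 < sig t α β)
    (h3 : 0 < (n : ℝ) + 2 * α) (hbal : γ = (1 + α) / t + β / (2 * t)) {q : ℝ} (hq : 1 < q)
    (hp : ProfBounds n t α β) {u L : E n → ℝ} {G : E n → E n} (h : MemH2 q α β u G L)
    (hu : IsRadial u) (hB : wInt (2 * (t - 1)) β G < ⊤)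
    (heq : wInt 2 (2 * α) L * wInt (2 * (t - 1)) β G =
      ENNReal.ofReal (sharpConst n t α γ) * wInt t (t * γ) G ^ 2) :
    ∃ c d lam : ℝ, 0 < lam ∧ u =ᵐ[volume] fun x => c * profile t α β (lam • x) + d := by
  obtain ⟨w, W, l, hr, huw, hG, hL⟩ := h.exists_radialMem hn hq hα hβ hu
  rw [wInt_congr_ae hG] at hB
  rw [wInt_congr_ae hG, wInt_congr_ae hG, wInt_congr_ae hL] at heq
  obtain ⟨c, d, τ, hw⟩ := hr.exists_eq_profLog hn ht hσ h3 hbal hp hB heq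
  refine ⟨c, d, Real.exp τ, Real.exp_pos τ, ?_⟩
  filter_upwards [huw, ae_ne_zero hn] with x hx hx0
  rw [hx, hw, profile_eq_profLog t α β (smul_ne_zero (Real.exp_pos τ).ne' hx0), norm_smul,
    Real.norm_eq_abs, Real.abs_exp, Real.log_mul (Real.exp_pos τ).ne' (norm_ne_zero_iff.2 hx0),
    Real.log_exp, add_comm τ]

end

end CKN

end

/-! ### Assembly of the theorem. -/

theorem theorem1p3 (n : ℕ) (hn : 1 ≤ n) (t α β γ : ℝ) (ht : 2 ≤ t)
    (hα : 0 < (n : ℝ) - 2 * α) (hβ : 0 < (n : ℝ) - β) (hγ : 0 < (n : ℝ) - t * γ)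
    (hbal : γ = (1 + α) / t + β / (2 * t))
    -- `q = 2` is the space of the theorem, `q = 2 (t - 1)` the one that contains all extremals
    (q : ℝ) (hq : q = 2 ∨ q = 2 * (t - 1)) :
    -- the inequality
    (∀ (u : CKN.E n → ℝ) (G : CKN.E n → CKN.E n) (L : CKN.E n → ℝ),
      CKN.MemH2 q α β u G L → CKN.IsRadial u →
      ENNReal.ofReal (CKN.sharpConst n t α γ) * CKN.wInt t (t * γ) G ^ 2 ≤
        CKN.wInt 2 (2 * α) L * CKN.wInt (2 * (t - 1)) β G) ∧
    (0 < (1 + 2 * α) * (t - 2) + 1 + α - β / 2 → t < 3 + α - β / 2 →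
      0 < (n : ℝ) + 2 * α →
      (2 < t → (n : ℝ) - β < 2 * (t - 1) / (t - 2) * (1 + α - β / 2)) →
      -- the constant is sharp
      (∀ C : ℝ,
        (∀ (u : CKN.E n → ℝ) (G : CKN.E n → CKN.E n) (L : CKN.E n → ℝ),
          CKN.MemH2 q α β u G L → CKN.IsRadial u →
          ENNReal.ofReal C * CKN.wInt t (t * γ) G ^ 2 ≤
            CKN.wInt 2 (2 * α) L * CKN.wInt (2 * (t - 1)) β G) →
        C ≤ CKN.sharpConst n t α γ) ∧
      -- the profile attains it, with finite and nonzero integrals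
      (∃ (G : CKN.E n → CKN.E n) (L : CKN.E n → ℝ),
        CKN.HasWeakGradient (CKN.profile t α β) G ∧
        CKN.HasWeakLaplacian (CKN.profile t α β) L ∧
        (0 < CKN.wInt 2 (2 * α) L ∧ CKN.wInt 2 (2 * α) L < ⊤) ∧
        (0 < CKN.wInt (2 * (t - 1)) β G ∧ CKN.wInt (2 * (t - 1)) β G < ⊤) ∧
        (0 < CKN.wInt t (t * γ) G ∧ CKN.wInt t (t * γ) G < ⊤) ∧
        CKN.wInt 2 (2 * α) L * CKN.wInt (2 * (t - 1)) β G =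
          ENNReal.ofReal (CKN.sharpConst n t α γ) * CKN.wInt t (t * γ) G ^ 2 ∧
        CKN.MemH2 (2 * (t - 1)) α β (CKN.profile t α β) G L ∧
        (((n : ℝ) - β) * (t - 2) < 2 * (1 + α - β / 2) →
          CKN.MemH2 2 α β (CKN.profile t α β) G L)) ∧
      -- equality holds exactly for the dilations and multiples of the profile
      (∀ (u : CKN.E n → ℝ) (G : CKN.E n → CKN.E n) (L : CKN.E n → ℝ),
        CKN.MemH2 q α β u G L → CKN.IsRadial u →
        ((CKN.wInt (2 * (t - 1)) β G < ⊤ ∧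
          CKN.wInt 2 (2 * α) L * CKN.wInt (2 * (t - 1)) β G =
            ENNReal.ofReal (CKN.sharpConst n t α γ) * CKN.wInt t (t * γ) G ^ 2) ↔
          ∃ c d lam : ℝ, 0 < lam ∧
            u =ᵐ[MeasureTheory.volume]
              fun x => c * CKN.profile t α β (lam • x) + d))) := by
  have hq1 : 1 < q := by rcases hq with rfl | rfl <;> linarith
  refine ⟨fun u G L h hu => ?_, fun h1 h2 h3 h4 => ?_⟩
  · obtain ⟨w, W, l, hr, -, hG, hL⟩ := h.exists_radialMem hn hq1 hα hβ hu
    rw [CKN.wInt_congr_ae hG, CKN.wInt_congr_ae hG, CKN.wInt_congr_ae hL]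
    exact hr.inequality hn ht hbal hq1
  · have hp := CKN.profBounds (n := n) ht h1 h2 h3 h4
    -- Test functions lie in the space for both values of `q`, so the assumed bound is needed only
    -- on them.
    refine ⟨fun C hC => hp.le_sharpConst hn ht h1 hbal fun φ hφ hr =>
        hC φ _ _ (hφ.memH2 (by linarith)) hr, hp.attained hn ht h1 hbal,
      fun u G L h hu => ⟨fun ⟨hB, heq⟩ => ?_, fun ⟨c, d, lam, hlam, hae⟩ => ?_⟩⟩
    · exact h.exists_ae_eq_profile hn ht hα hβ h1 h3 hbal hq1 hp hu hB heq
    · exact hp.eq_of_ae_eq hn ht h1 hbal h.weakGradient h.weakLaplacian hlam hae
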